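/- Theorem 3.3. Notation. For $f\in\mathcal S(\mathbb R^n)$ write $\widehat f(\xi)=\int e^{-ix\cdot\xi}f(x)\,dx$ and, for a Schwartz function $\psi$, $\psi(D)F=(\mathcal F^{-1}\psi)*F$ with $\mathcal F^{-1}\psi(x)=(2\pi)^{-n}\int e^{ix\cdot\xi}\psi(\xi)\,d\xi$. A Littlewood–Paley partition of unity on $\mathbb R^d$ is a sequence $\{\psi_k\}_{k\ge0}$ of the form $\psi_0=\phi$, $\psi_k=\phi(\cdot/2^k)-\phi(2\,\cdot/2^k)$ $(k\ge1)$, where $\phi\in\mathcal S(\mathbb R^d)$, $\phi=1$ on $\{|\xi|\le1\}$ and $\operatorname{supp}\phi\subset\{|\xi|\le2\}$. Let $\{\psi_k\}$ and $\{\Psi_j\}$ be any Littlewood–Paley partitions of unity on $\mathbb R^n$ and $(\mathbb R^n)^2$, respectively. For $0\le\rho<1$, $\sigma\in L^\infty((\mathbb R^n)^3)$, $j\in\mathbb N_0$ and $\boldsymbol k=(k_0,k_1,k_2)\in\mathbb N_0^3$ put $$\sigma_j^\rho(x,\xi,\eta)=\sigma(2^{-j\rho}x,2^{j\rho}\xi,2^{j\rho}\eta)\,\Psi_j(2^{j\rho}\xi,2^{j\rho}\eta),\qquad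 \Delta_{\boldsymbol k}=\psi_{k_0}(D_x)\psi_{k_1}(D_\xi)\psi_{k_2}(D_\eta),$$ and $\|F\|_{L^2_{ul}((\mathbb R^n)^3)}=\sup_{\nu\in\mathbb Z^{3n}}\big(\int_{[-1/2,1/2)^{3n}}|F(z+\nu)|^2\,dz\big)^{1/2}$. For $m\in\mathbb R$ and $\boldsymbol s=(s_0,s_1,s_2)\in[0,\infty)^3$, the class $BS^{m,*}_{\rho,\rho}(\boldsymbol s;\mathbb R^n)$ consists of all $\sigma\in L^\infty((\mathbb R^n)^3)$ with $$\sum_{k_0\in\mathbb N_0}\ \sup_{j\in\mathbb N_0}\Big\{\sum_{k_1,k_2\in\mathbb N_0}2^{-jm+k_0s_0+k_1s_1+k_2s_2}\,\|\Delta_{\boldsymbol k}[\sigma_j^\rho]\|_{L^2_{ul}((\mathbb R^n)^3)}\Big\}<\infty .$$ For $f,g\in\mathcal S(\mathbb R^n)$ let $$T_\sigma(f,g)(x)=\frac1{(2\pi)^{2n}}\int_{(\mathbb R^n)^2}e^{ix\cdot(\xi+\eta)}\sigma(x,\xi,\eta)\widehat f(\xi)\widehat g(\eta)\,d\xi\,d\eta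 ,$$ and let $$\|g\|_{bmo}=\sup_{|Q|\le1}\frac1{|Q|}\int_Q|g-g_Q|\,dx+\sup_{|Q|\ge1}\frac1{|Q|}\int_Q|g|\,dx,\qquad g_Q=\frac1{|Q|}\int_Q g,$$ where $Q$ ranges over the cubes in $\mathbb R^n$ with sides parallel to the axes. Statement. Let $0\le\rho<1$, $m=-(1-\rho)n/2$ and $s_0,s_1,s_2\ge n/2$ (the critical value $s_0=n/2$ is allowed). If $\sigma\in BS^{m,*}_{\rho,\rho}(\boldsymbol s;\mathbb R^n)$, then $T_\sigma$ is bounded from $L^2(\mathbb R^n)\times bmo(\mathbb R^n)$ to $L^2(\mathbb R^n)$: there is a constant $C$ such that for all $f,g\in\mathcal S(\mathbb R^n)$ one has $T_\sigma(f,g)\in L^2(\mathbb R^n)$ and $$\|T_\sigma(f,g)\|_{L^2}\le C\,\|f\|_{L^2}\,\|g\|_{bmo}.$$ -/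

import Mathlib

open MeasureTheory
open scoped ENNReal NNReal

noncomputable section

namespace BilinearPsiDO

/-- The Euclidean space `ℝⁿ`. -/
abbrev Eu (n : ℕ) : Type := EuclideanSpace ℝ (Fin n)

/-- The generator of a Littlewood-Paley partition of unity on `F`: a Schwartz function equal to `1`
on the closed unit ball and supported in the closed ball of radius `2`. -/
structure IsLPGenerator {F : Type*} [NormedAddCommGroup F] [NormedSpace ℝ F]
    (φ : SchwartzMap F ℂ) : Prop where
  eq_one : ∀ ξ : F, ‖ξ‖ ≤ 1 → φ ξ = 1
  support_subset : tsupport (φ : F → ℂ) ⊆ Metric.closedBall 0 2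

/-- The members `ψ_k` of the Littlewood-Paley partition of unity generated by `φ`: `ψ_0 = φ` and
`ψ_k = ψ(· / 2^k)` for `k ≥ 1`, where `ψ = φ - φ(2 ·)`. -/
def lpPiece {F : Type*} [NormedAddCommGroup F] [NormedSpace ℝ F]
    (φ : SchwartzMap F ℂ) : ℕ → F → ℂ
  | 0, ξ => φ ξ
  | k + 1, ξ => φ (((2 : ℝ) ^ (k + 1))⁻¹ • ξ) - φ ((2 : ℝ) • ((2 : ℝ) ^ (k + 1))⁻¹ • ξ)

variable {n : ℕ}

/-- The Fourier transform `∫ e^{-i x·ξ} f(x) dx`. -/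
def fourierHat (f : Eu n → ℂ) (ξ : Eu n) : ℂ :=
  ∫ x : Eu n, Complex.exp (-(Complex.I * (inner ℝ x ξ : ℝ))) * f x

/-- The inverse Fourier transform `(2π)^{-n} ∫ e^{i x·ξ} f(ξ) dξ`. -/
def fourierCheck (f : Eu n → ℂ) (x : Eu n) : ℂ :=
  ((2 * Real.pi : ℝ) : ℂ)⁻¹ ^ n * ∫ ξ : Eu n, Complex.exp (Complex.I * (inner ℝ x ξ : ℝ)) * f ξ

/-- `Δ_k F = ψ_{k₀}(D_x) ψ_{k₁}(D_ξ) ψ_{k₂}(D_η) F` for a bounded function `F` on `(ℝⁿ)³`, that is,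
the convolution of `F` with the integrable kernel
`(𝓕⁻¹ψ_{k₀})(x) (𝓕⁻¹ψ_{k₁})(ξ) (𝓕⁻¹ψ_{k₂})(η)`. -/
def lpBlock (φ : SchwartzMap (Eu n) ℂ) (k₀ k₁ k₂ : ℕ) (F : Eu n × Eu n × Eu n → ℂ)
    (z : Eu n × Eu n × Eu n) : ℂ :=
  ∫ w : Eu n × Eu n × Eu n,
    fourierCheck (lpPiece φ k₀) w.1 * fourierCheck (lpPiece φ k₁) w.2.1 *
      fourierCheck (lpPiece φ k₂) w.2.2 * F (z - w)

/-- The localized and rescaled symbol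
`σ_j^ρ(x,ξ,η) = σ(2^{-jρ}x, 2^{jρ}ξ, 2^{jρ}η) Ψ_j(2^{jρ}ξ, 2^{jρ}η)`, where `Ψ_j` is the
Littlewood-Paley partition of unity on `(ℝⁿ)²` (with its Euclidean norm) generated by `Φ`. -/
def scaledSymbol (Φ : SchwartzMap (WithLp 2 (Eu n × Eu n)) ℂ) (ρ : ℝ) (j : ℕ)
    (σ : Eu n × Eu n × Eu n → ℂ) (z : Eu n × Eu n × Eu n) : ℂ :=
  σ ((2 : ℝ) ^ (-((j : ℝ) * ρ)) • z.1, (2 : ℝ) ^ ((j : ℝ) * ρ) • z.2.1,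
      (2 : ℝ) ^ ((j : ℝ) * ρ) • z.2.2) *
    lpPiece Φ j (WithLp.toLp 2
      ((2 : ℝ) ^ ((j : ℝ) * ρ) • z.2.1, (2 : ℝ) ^ ((j : ℝ) * ρ) • z.2.2))

/-- The unit cube `[-1/2, 1/2)ⁿ`. -/
def unitCube (n : ℕ) : Set (Eu n) := {x | ∀ i, -(1 / 2 : ℝ) ≤ x i ∧ x i < 1 / 2}

/-- The point of `ℤⁿ ⊆ ℝⁿ` with the given integer coordinates. -/
def latticePt (ν : Fin n → ℤ) : Eu n := WithLp.toLp 2 (fun i => (ν i : ℝ))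

/-- The norm of the uniformly local space `L²_ul((ℝⁿ)³)`, with values in `[0, ∞]`. -/
def l2ulNorm (F : Eu n × Eu n × Eu n → ℂ) : ℝ≥0∞ :=
  ⨆ ν : (Fin n → ℤ) × (Fin n → ℤ) × (Fin n → ℤ),
    (∫⁻ z in unitCube n ×ˢ unitCube n ×ˢ unitCube n,
      ‖F (z + (latticePt ν.1, latticePt ν.2.1, latticePt ν.2.2))‖ₑ ^ 2) ^ (1 / 2 : ℝ)

/-- The `BS^{m,*}_{ρ,ρ}(s; ℝⁿ)` norm, `s = (s₀, s₁, s₂)`, with values in `[0, ∞]`. -/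
def bsStarNorm (φ : SchwartzMap (Eu n) ℂ) (Φ : SchwartzMap (WithLp 2 (Eu n × Eu n)) ℂ)
    (ρ m s₀ s₁ s₂ : ℝ) (σ : Eu n × Eu n × Eu n → ℂ) : ℝ≥0∞ :=
  ∑' k₀ : ℕ, ⨆ j : ℕ, ∑' k : ℕ × ℕ,
    ENNReal.ofReal ((2 : ℝ) ^ (-((j : ℝ) * m) + ((k₀ : ℝ) * s₀ + (k.1 : ℝ) * s₁ + (k.2 : ℝ) * s₂)))
      * l2ulNorm (lpBlock φ k₀ k.1 k.2 (scaledSymbol Φ ρ j σ))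

/-- The symbol class `BS^{m,*}_{ρ,ρ}(s; ℝⁿ)`: symbols in `L^∞((ℝⁿ)³)` with finite norm. -/
def MemBSStar (φ : SchwartzMap (Eu n) ℂ) (Φ : SchwartzMap (WithLp 2 (Eu n × Eu n)) ℂ)
    (ρ m s₀ s₁ s₂ : ℝ) (σ : Eu n × Eu n × Eu n → ℂ) : Prop :=
  MemLp σ ∞ volume ∧ bsStarNorm φ Φ ρ m s₀ s₁ s₂ σ < ∞

/-- The bilinear pseudo-differential operator `T_σ` on Schwartz functions. -/
def bilinOp (σ : Eu n × Eu n × Eu n → ℂ) (f g : SchwartzMap (Eu n) ℂ) (x : Eu n) : ℂ :=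
  ((2 * Real.pi : ℝ) : ℂ)⁻¹ ^ (2 * n) * ∫ p : Eu n × Eu n,
    Complex.exp (Complex.I * (inner ℝ x (p.1 + p.2) : ℝ)) * σ (x, p.1, p.2) *
      fourierHat f p.1 * fourierHat g p.2

/-- The closed cube `x + [-R, R]ⁿ`. -/
def cube (x : Eu n) (R : ℝ) : Set (Eu n) := {y | ∀ i, |y i - x i| ≤ R}

/-- The mean `f_Q = |Q|⁻¹ ∫_Q f`. -/
def cubeMean (f : Eu n → ℂ) (Q : Set (Eu n)) : ℂ :=
  ((volume.real Q : ℝ) : ℂ)⁻¹ * ∫ y in Q, f y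

/-- The norm of the local space `bmo(ℝⁿ)`, with values in `[0, ∞]`. -/
def bmoNorm (f : Eu n → ℂ) : ℝ≥0∞ :=
  (⨆ (x : Eu n) (R : ℝ) (_ : 0 < R) (_ : volume (cube x R) ≤ 1),
      (volume (cube x R))⁻¹ * ∫⁻ y in cube x R, ‖f y - cubeMean f (cube x R)‖ₑ) +
    ⨆ (x : Eu n) (R : ℝ) (_ : 0 < R) (_ : 1 ≤ volume (cube x R)),
      (volume (cube x R))⁻¹ * ∫⁻ y in cube x R, ‖f y‖ₑ

end BilinearPsiDO

end

open BilinearPsiDO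

noncomputable section

namespace BilinearPsiDO

open Filter Topology
open scoped FourierTransform SchwartzMap

variable {n : ℕ}

/-! By duality it is enough to bound the trilinear form ∫ T_σ(f,g) h, for Schwartz h, by ‖f‖₂
‖g‖_bmo ‖h‖₂. The symbol is split twice: by Ψ_j into frequency shells, which a dilation by 2^{jρ}
turns into σ_j^ρ, and then by Δ_k into blocks whose spectra in x, ξ, η lie in balls of radii K₀, K₁,
K₂ with K_i = 2^{k_i+1}. After the dilation f and g have frequencies at most about 2^{(1-ρ)j}.

One cell. Phase space (x, ξ, η) is cut into unit cells. As the spectrum of a block in ξ has radius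
K₁, its integral over the cell around (x₀, ν, μ) sees the wave packet of f at frequency ν only
within distance about K₁ of x₀; the same holds for g, μ and K₂. Cauchy-Schwarz and Plancherel then
bound the cell by the local L² size of the block, which the L²_ul norm controls, times local sizes
of f, g and h (`enorm_cellInt_le`). The squares of the local sizes of g have ν-integral at most a
multiple of K₂ⁿ ‖g‖_∞², uniformly in x₀ (`lintegral_locF_sq_le`); those of f and h are integrated
over x₀ as well and give L² norms.

Sum over cells. Let r₁, r₂, r₀ bound the frequencies of f, g, h. Cauchy-Schwarz in ν and μ
separately costs (r₁ r₂)^{n/2} and does not involve K₀ (`exists_enorm_lam_le`). Alternatively, the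
spectrum in x forces the frequency of h to be within about K₀ of -(ν+μ). This costs K₀^{n/2}, but
the sum becomes ∬ F(ν) G(μ) H(ν+μ), which is bounded by the smallest of the r_i^{n/2}, hence by (r₀
r₁ r₂)^{n/6} (`exists_enorm_lam_le_of_support`).

The space bmo enters only through the uniform bound for the Littlewood-Paley pieces of g
(`exists_enorm_lpS_le`). The bounds for these pieces grow geometrically with the frequency, so
summing over them costs no more than the top one.

Sum over scales (`exists_scale_sum_le`). Put a = 2^{(1-ρ)n/6}; the order m supplies the weight
2^{-jm} = a^{3j}. Fix k₀ and let J be the scale where 2^{(1-ρ)J} reaches 2^{k₀}. For j ≥ J the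
second estimate costs K₀^{n/2} a^j (∑_{i≤j} a^i ‖f_i‖)(∑_{i≤j} a^i ‖h_i‖); divided by a^{3j} this is
a product of two geometric averages, each in ℓ²(j) by almost orthogonality. For j < J the first
estimate costs a^{6j}, which exceeds the available K₀^{n/2} a^{3j} by the factor a^{3j} K₀^{-n/2};
these factors sum geometrically to O(1). Nothing is lost in k₀, which is why s₀ = n/2 is allowed,
and the outer sum over k₀ is the one in the norm of the class. -/

/-- The character `t ↦ e^{2πit}`, with values in `ℂ`. -/
def ee (t : ℝ) : ℂ := (Real.fourierChar t : ℂ)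

theorem ee_add (s t : ℝ) : ee (s + t) = ee s * ee t := by
  simp [ee, AddChar.map_add_eq_mul]

theorem ee_zero : ee 0 = 1 := by simp [ee]

theorem norm_ee (t : ℝ) : ‖ee t‖ = 1 := Circle.norm_coe _

theorem enorm_ee (t : ℝ) : ‖ee t‖ₑ = 1 := by
  rw [← ofReal_norm, norm_ee]; simp

theorem ee_eq_exp (t : ℝ) : ee t = Complex.exp (2 * Real.pi * t * Complex.I) := by
  simp [ee, Real.fourierChar_apply]

theorem continuous_ee : Continuous ee := by
  unfold ee
  exact continuous_subtype_val.comp Real.continuous_fourierChar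

/-! ### Modulations, translations and products under the Fourier transform -/

theorem fourier_ee (f : Eu n → ℂ) (w : Eu n) : 𝓕 f w = ∫ v, ee (-inner ℝ v w) * f v := by
  rw [Real.fourier_eq]; rfl

theorem fourierInv_ee (f : Eu n → ℂ) (w : Eu n) : 𝓕⁻ f w = ∫ v, ee (inner ℝ v w) * f v := by
  rw [Real.fourierInv_eq]; rfl

theorem integrable_ee_mul {f : Eu n → ℂ} (hf : Integrable f) {p : Eu n → ℝ} (hp : Continuous p) :
    Integrable (fun v => ee (p v) * f v) :=
  hf.bdd_mul (c := 1) (continuous_ee.comp hp).aestronglyMeasurable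
    (Filter.Eventually.of_forall fun _ => (norm_ee _).le)

theorem integral_fourier_mul {f g : Eu n → ℂ} (hf : Integrable f) (hg : Integrable g) :
    ∫ x, 𝓕 f x * g x = ∫ x, f x * 𝓕 g x := by
  simpa using! VectorFourier.integral_bilin_fourierIntegral_eq_flip (ContinuousLinearMap.mul ℂ ℂ)
    (L := innerₗ (Eu n)) Real.continuous_fourierChar continuous_inner hf hg

theorem fourierInv_comp_sub (f : Eu n → ℂ) (c x : Eu n) :
    𝓕⁻ (fun ξ => f (ξ - c)) x = ee (inner ℝ c x) * 𝓕⁻ f x := by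
  rw [fourierInv_ee, fourierInv_ee, ← integral_const_mul,
    ← integral_add_right_eq_self _ c]
  refine integral_congr_ae (Filter.Eventually.of_forall fun v => ?_)
  simp only [add_sub_cancel_right, inner_add_left, ee_add]; ring

theorem fourier_comp_sub (f : Eu n → ℂ) (c ξ : Eu n) :
    𝓕 (fun x => f (x - c)) ξ = ee (-inner ℝ c ξ) * 𝓕 f ξ := by
  rw [fourier_ee, fourier_ee, ← integral_const_mul,
    ← integral_add_right_eq_self _ c]
  refine integral_congr_ae (Filter.Eventually.of_forall fun v => ?_)
  simp only [add_sub_cancel_right, inner_add_left, neg_add, ee_add]; ring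

theorem fourier_ee_mul (f : Eu n → ℂ) (c ξ : Eu n) :
    𝓕 (fun x => ee (inner ℝ x c) * f x) ξ = 𝓕 f (ξ - c) := by
  rw [fourier_ee, fourier_ee]
  refine integral_congr_ae (Filter.Eventually.of_forall fun v => ?_)
  simp only [inner_sub_right, neg_sub]
  rw [sub_eq_neg_add, ee_add]; ring

/-- The inverse transform of D is the reflected transform of D, so self-adjointness of 𝓕 moves it
onto a modulated S. Only integrability is needed, no inversion formula. -/
theorem fourier_mul_fourierInv {S D : Eu n → ℂ} (hS : Integrable S) (hD : Integrable D)
    (a : Eu n) : 𝓕 (fun x => S x * 𝓕⁻ D x) a = ∫ ζ, D ζ * 𝓕 S (a - ζ) := by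
  have h1 : Integrable (fun x => ee (-inner ℝ x a) * S (x)) :=
    integrable_ee_mul hS (by fun_prop)
  have h2 : ∀ x, ee (-inner ℝ x a) * (S x * 𝓕⁻ D x)
      = (ee (-inner ℝ x a) * S x) * 𝓕 D (-x) := fun x => by
    rw [Real.fourierInv_eq_fourier_neg]; ring
  rw [fourier_ee]
  simp_rw [h2]
  have h3 := integral_fourier_mul hD (f := D) (g := fun x => ee (inner ℝ x a) * S (-x))
    (integrable_ee_mul hS.comp_neg (by fun_prop))
  rw [← integral_neg_eq_self (μ := volume)]
  simp only [inner_neg_left, neg_neg]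
  rw [← integral_congr_ae (Filter.Eventually.of_forall fun x => mul_comm _ _), h3]
  refine integral_congr_ae (Filter.Eventually.of_forall fun ζ => ?_)
  simp only
  congr 1
  rw [fourier_ee, fourier_ee, ← integral_neg_eq_self (μ := volume)]
  refine integral_congr_ae (Filter.Eventually.of_forall fun v => ?_)
  simp only [inner_neg_left, neg_neg, inner_sub_right, neg_sub]
  rw [sub_eq_add_neg, ee_add]; ring

theorem integral_enorm_sq_fourier (f : 𝓢(Eu n, ℂ)) :
    ∫⁻ ξ, ‖𝓕 f ξ‖ₑ ^ 2 = ∫⁻ x, ‖f x‖ₑ ^ 2 := by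
  have key : ∀ g : 𝓢(Eu n, ℂ), ∫⁻ x, ‖g x‖ₑ ^ 2 = ENNReal.ofReal (∫ x, ‖g x‖ ^ 2) := fun g => by
    rw [ofReal_integral_eq_lintegral_ofReal]
    · exact lintegral_congr fun x => by
        rw [ENNReal.ofReal_pow (norm_nonneg _), ofReal_norm]
    · exact (g.memLp 2).integrable_norm_pow (by norm_num)
    · exact Filter.Eventually.of_forall fun x => by positivity
  rw [key, key, SchwartzMap.integral_norm_sq_fourier]

theorem integral_enorm_sq_fourierInv (f : 𝓢(Eu n, ℂ)) :
    ∫⁻ ξ, ‖𝓕⁻ f ξ‖ₑ ^ 2 = ∫⁻ x, ‖f x‖ₑ ^ 2 := by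
  have := integral_enorm_sq_fourier (𝓕⁻ f)
  rw [← this]; simp

/-! ### Band-limited functions and wave packets -/

/-- `v` has spectrum in the closed ball of radius `K`. -/
def BandLimited (v : Eu n → ℂ) (K : ℝ) : Prop :=
  ∀ w : Eu n → ℂ, Integrable w → (∀ ζ, ‖ζ‖ ≤ K → 𝓕 w ζ = 0) → ∫ x, v x * w x = 0

theorem BandLimited.mono {v : Eu n → ℂ} {K L : ℝ} (h : BandLimited v K) (hKL : K ≤ L) :
    BandLimited v L := fun w hw h0 => h w hw fun ζ hζ => h0 ζ (hζ.trans hKL)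

/-- The product of two Schwartz functions. -/
def mulS (f g : 𝓢(Eu n, ℂ)) : 𝓢(Eu n, ℂ) :=
  SchwartzMap.pairing (ContinuousLinearMap.mul ℂ ℂ) f g

@[simp] theorem mulS_apply (f g : 𝓢(Eu n, ℂ)) (x : Eu n) : mulS f g x = f x * g x := by
  simp [mulS]

/-- The translate `f(· - c)` of a Schwartz function. -/
def trS (c : Eu n) (f : 𝓢(Eu n, ℂ)) : 𝓢(Eu n, ℂ) := f.compSubConstCLM ℂ c

@[simp] theorem trS_apply (f : 𝓢(Eu n, ℂ)) (c x : Eu n) : trS c f x = f (x - c) := rfl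

/-- The piece of `f` with frequencies cut off by `κ(· - ν)`. -/
def wp (κ f : 𝓢(Eu n, ℂ)) (ν : Eu n) : 𝓢(Eu n, ℂ) := 𝓕⁻ (mulS (𝓕 f) (trS ν κ))

theorem schwartz_fourierInv_ee (f : 𝓢(Eu n, ℂ)) (w : Eu n) :
    (𝓕⁻ f) w = ∫ v, ee (inner ℝ v w) * f v := by
  rw [SchwartzMap.fourierInv_coe]; exact fourierInv_ee _ _

theorem schwartz_fourier_ee (f : 𝓢(Eu n, ℂ)) (w : Eu n) :
    (𝓕 f) w = ∫ v, ee (-inner ℝ v w) * f v := by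
  rw [SchwartzMap.fourier_coe]; exact fourier_ee _ _

theorem wp_apply (κ f : 𝓢(Eu n, ℂ)) (ν y : Eu n) :
    wp κ f ν y = ∫ ξ, ee (inner ℝ ξ y) * (𝓕 f ξ * κ (ξ - ν)) := by
  rw [wp, schwartz_fourierInv_ee]; simp

/-- For fixed y, the packet is up to a unimodular factor a windowed Fourier transform of f with
window centred at y. This makes Plancherel available in the frequency ν. -/
theorem wp_eq_fourier (κ f : 𝓢(Eu n, ℂ)) (ν y : Eu n) :
    wp κ f ν y = ee (inner ℝ y ν) * (𝓕 (mulS f (trS y (𝓕 κ)))) ν := by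
  have h1 : ∀ z, ee (-inner ℝ z ν) * (f z * (𝓕 κ) (z - y)) =
      ee (-inner ℝ y ν) * (f z * 𝓕 (fun ξ => ee (inner ℝ ξ y) * κ (ξ - ν)) z) := fun z => by
    rw [fourier_ee_mul, fourier_comp_sub, ← SchwartzMap.fourier_coe, inner_sub_right,
      real_inner_comm ν z, real_inner_comm ν y]
    rw [show ee (-inner ℝ ν z) = ee (-inner ℝ ν y) * ee (-(inner ℝ ν z - inner ℝ ν y)) by
      rw [← ee_add]; ring_nf]
    ring
  rw [schwartz_fourier_ee]
  simp only [mulS_apply, trS_apply]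
  simp_rw [h1]
  rw [integral_const_mul, ← mul_assoc, ← ee_add, add_neg_cancel, ee_zero, one_mul,
    ← integral_fourier_mul f.integrable
      (g := fun ξ => ee (inner ℝ ξ y) * κ (ξ - ν))
      (integrable_ee_mul (trS ν κ).integrable (by fun_prop)), wp_apply]
  refine integral_congr_ae (Filter.Eventually.of_forall fun ξ => ?_)
  simp only [SchwartzMap.fourier_coe]; ring

theorem lintegral_enorm_sq_wp (κ f : 𝓢(Eu n, ℂ)) (y : Eu n) :
    ∫⁻ ν, ‖wp κ f ν y‖ₑ ^ 2 = ∫⁻ z, ‖f z‖ₑ ^ 2 * ‖𝓕 κ (z - y)‖ₑ ^ 2 := by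
  simp_rw [wp_eq_fourier, enorm_mul, enorm_ee, one_mul]
  rw [integral_enorm_sq_fourier]
  simp [mul_pow]

/-- The window has finite L² mass, so a sup bound on f suffices, uniformly in y. This is the place
where a bounded function can replace a square integrable one. -/
theorem lintegral_enorm_sq_wp_le (κ f : 𝓢(Eu n, ℂ)) (B : ℝ≥0∞) (hB : ∀ x, ‖f x‖ₑ ≤ B)
    (y : Eu n) : ∫⁻ ν, ‖wp κ f ν y‖ₑ ^ 2 ≤ B ^ 2 * ∫⁻ x, ‖κ x‖ₑ ^ 2 := by
  rw [lintegral_enorm_sq_wp, ← integral_enorm_sq_fourier κ,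
    ← lintegral_sub_right_eq_self (fun z => ‖𝓕 κ z‖ₑ ^ 2) y, ← lintegral_const_mul]
  · gcongr with z
    exact hB z
  · exact ((𝓕 κ).continuous.comp (by fun_prop)).enorm.measurable.pow_const _

theorem lintegral_lintegral_enorm_sq_wp (κ f : 𝓢(Eu n, ℂ)) :
    ∫⁻ y, ∫⁻ ν, ‖wp κ f ν y‖ₑ ^ 2 = (∫⁻ x, ‖f x‖ₑ ^ 2) * ∫⁻ x, ‖κ x‖ₑ ^ 2 := by
  simp_rw [lintegral_enorm_sq_wp]
  have hf := f.continuous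
  have hk := (𝓕 κ).continuous
  rw [lintegral_lintegral_swap, ← lintegral_mul_const]
  · refine lintegral_congr fun z => ?_
    rw [lintegral_const_mul]
    · rw [lintegral_sub_left_eq_self (fun y => ‖𝓕 κ y‖ₑ ^ 2) z, integral_enorm_sq_fourier κ]
    · exact (hk.comp (by fun_prop)).enorm.measurable.pow_const _
  · exact hf.enorm.measurable.pow_const _
  · refine Measurable.aemeasurable ?_
    exact ((hf.comp continuous_snd).enorm.measurable.pow_const _).mul
      ((hk.comp (continuous_snd.sub continuous_fst)).enorm.measurable.pow_const _)

theorem continuous_wp (κ f : 𝓢(Eu n, ℂ)) : Continuous (fun p : Eu n × Eu n => wp κ f p.1 p.2) := by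
  simp_rw [wp_apply]
  obtain ⟨C, hC⟩ : ∃ C, ∀ x, ‖κ x‖ ≤ C := ⟨_, κ.norm_le_seminorm ℝ⟩
  refine continuous_of_dominated (bound := fun ξ => ‖𝓕 f ξ‖ * C) ?_ ?_ ?_ ?_
  · intro p
    refine Continuous.aestronglyMeasurable ?_
    exact (continuous_ee.comp (by fun_prop)).mul ((𝓕 f).continuous.mul (κ.continuous.comp (by fun_prop)))
  · refine fun p => Filter.Eventually.of_forall fun ξ => ?_
    rw [norm_mul, norm_ee, one_mul, norm_mul]
    gcongr
    exact hC _
  · exact (𝓕 f).integrable.norm.mul_const _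
  · refine Filter.Eventually.of_forall fun ξ => ?_
    exact (continuous_ee.comp (by fun_prop)).mul (continuous_const.mul (κ.continuous.comp (by fun_prop)))

theorem wp_eq_zero {κ f : 𝓢(Eu n, ℂ)} {r s : ℝ} (hf : ∀ ξ, r < ‖ξ‖ → 𝓕 f ξ = 0)
    (hκ : ∀ ξ, s < ‖ξ‖ → κ ξ = 0) {ν : Eu n} (hν : r + s < ‖ν‖) : wp κ f ν = 0 := by
  ext y
  rw [wp_apply]
  refine integral_eq_zero_of_ae (Filter.Eventually.of_forall fun ξ => ?_)
  simp only [Pi.zero_apply]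
  by_cases h : r < ‖ξ‖
  · rw [hf ξ h]; simp
  · rw [hκ (ξ - ν)]
    · simp
    · have : ‖ν‖ ≤ ‖ξ‖ + ‖ξ - ν‖ := by
        rw [norm_sub_rev]; simpa using norm_add_le ξ (ν - ξ)
      linarith

attribute [irreducible] wp

theorem integrable_mul_schwartz (f g : 𝓢(Eu n, ℂ)) : Integrable (fun x => f x * g x) :=
  (mulS f g).integrable.congr (Filter.Eventually.of_forall fun x => mulS_apply f g x)

/-! ### Construction of the phase space windows -/

/-- Windows used to cut phase space into unit cells. -/
structure Windows (n : ℕ) where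
  /-- frequency window with compact support -/
  κ : 𝓢(Eu n, ℂ)
  /-- window with compactly supported Fourier transform -/
  θ : 𝓢(Eu n, ℂ)
  /-- position window with compactly supported Fourier transform -/
  κ₀ : 𝓢(Eu n, ℂ)
  κ_supp : ∀ x, 1 < ‖x‖ → κ x = 0
  θ_hat : ∀ ζ, 1 < ‖ζ‖ → 𝓕 θ ζ = 0
  integral_κ : ∫ x, θ x * κ x = 1
  integral_κ₀ : ∫ x, θ x * κ₀ x = 1
  hat_κ₀ : ∀ ζ, 2 < ‖ζ‖ → 𝓕 (fun x => θ x * κ₀ x) ζ = 0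

/-- From one even bump k, take θ = 𝓕⁻ k, with κ a multiple of k and κ₀ a multiple of θ. All support
conditions are then immediate; only the two normalizing integrals have to be shown nonzero. -/
theorem exists_windows (n : ℕ) : Nonempty (Windows n) := by
  let b : ContDiffBump (0 : Eu n) := ⟨1 / 4, 1 / 3, by norm_num, by norm_num⟩
  have hbc : HasCompactSupport (fun x => (b x : ℂ)) :=
    b.hasCompactSupport.comp_left (g := fun t : ℝ => (t : ℂ)) (by simp)
  have hbs : ContDiff ℝ ((⊤ : ℕ∞) : WithTop ℕ∞) (fun x => (b x : ℂ)) :=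
    Complex.ofRealCLM.contDiff.comp b.contDiff
  let k : 𝓢(Eu n, ℂ) := hbc.toSchwartzMap hbs
  have hk : ∀ x, k x = (b x : ℂ) := fun x => rfl
  have hb0 : ∀ x, 1 / 3 < ‖x‖ → b x = 0 := fun x hx =>
    b.zero_of_le_dist (by rw [dist_zero_right]; exact hx.le)
  have hk0 : ∀ x, 1 / 3 < ‖x‖ → k x = 0 := fun x hx => by
    rw [hk, hb0 x hx]; simp
  have hkneg : ∀ x, k (-x) = k x := fun x => by rw [hk, hk, b.neg]
  let θ : 𝓢(Eu n, ℂ) := 𝓕⁻ k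
  have hθhat : 𝓕 θ = k := by simp [θ]
  have hbint : Integrable (fun x => b x) := b.integrable
  have hbpos : 0 < ∫ x, b x := b.integral_pos
  set c : ℂ := ∫ x, θ x * k x with hc
  -- For v and ξ of norm at most 1/3 the phase 2π⟨v, ξ⟩ is at most 2π/9, where the cosine exceeds
  -- 1/2; hence θ has real part bounded below on the support of k.
  have hθre : ∀ ξ : Eu n, ‖ξ‖ ≤ 1 / 3 → (1 / 2) * ∫ x, b x ≤ (θ ξ).re := by
    intro ξ hξ
    have : θ ξ = ∫ v, ee (inner ℝ v ξ) * k v := schwartz_fourierInv_ee _ _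
    rw [this, ← RCLike.re_eq_complex_re, ← integral_re, ← integral_const_mul]
    · refine integral_mono (hbint.const_mul _) ?_ fun v => ?_
      · exact (integrable_ee_mul k.integrable (by fun_prop)).re
      · simp only [RCLike.re_eq_complex_re, hk, Complex.mul_re, Complex.ofReal_re,
          Complex.ofReal_im, mul_zero, sub_zero]
        by_cases hv : 1 / 3 < ‖v‖
        · have : b v = 0 := hb0 v hv
          simp [this]
        · gcongr
          · exact b.nonneg
          · rw [ee_eq_exp]
            have h1 : |inner ℝ v ξ| ≤ 1 / 9 := by
              refine (abs_real_inner_le_norm _ _).trans ?_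
              have := norm_nonneg v
              push Not at hv
              nlinarith [norm_nonneg ξ]
            have h2 : (2 * (Real.pi : ℂ) * (inner ℝ v ξ : ℝ) * Complex.I) =
              ((2 * Real.pi * inner ℝ v ξ : ℝ) : ℂ) * Complex.I := by push_cast; ring
            rw [h2, Complex.exp_ofReal_mul_I_re]
            have h3 := Real.one_sub_sq_div_two_le_cos (x := 2 * Real.pi * inner ℝ v ξ)
            have h4 : (inner ℝ v ξ) ^ 2 ≤ (1 / 9) ^ 2 := by
              rw [← sq_abs]; gcongr
            have h5 : Real.pi ^ 2 ≤ 10 := by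
              nlinarith [Real.pi_lt_d2, Real.pi_pos]
            have h6 : (2 * Real.pi * inner ℝ v ξ) ^ 2 = 4 * (Real.pi ^ 2 * (inner ℝ v ξ) ^ 2) := by
              ring
            have h7 : Real.pi ^ 2 * (inner ℝ v ξ) ^ 2 ≤ 10 * (1 / 9) ^ 2 := by gcongr
            linarith
    · exact integrable_ee_mul k.integrable (by fun_prop)
  have hθk : Integrable (fun x => θ x * k x) := integrable_mul_schwartz θ k
  have hc0 : c ≠ 0 := by
    have : 0 < c.re := by
      have h1 : (1 / 2 * ∫ x, b x) * ∫ x, b x ≤ c.re := by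
        rw [hc, ← RCLike.re_eq_complex_re, ← integral_re hθk, ← integral_const_mul]
        refine integral_mono (hbint.const_mul _) hθk.re fun v => ?_
        simp only [RCLike.re_eq_complex_re, hk, Complex.mul_re, Complex.ofReal_re,
          Complex.ofReal_im, mul_zero, sub_zero]
        by_cases hv : 1 / 3 < ‖v‖
        · have : b v = 0 := hb0 v hv
          simp [this]
        · gcongr
          · exact b.nonneg
          · exact hθre v (not_lt.1 hv)
      have : 0 < (1 / 2 * ∫ x, b x) * ∫ x, b x := by positivity
      linarith
    intro h; rw [h] at this; simp at this
  set c₁ : ℂ := ∫ x, θ x * θ x with hc₁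
  -- Since k is even, 𝓕 k = θ, so ∫ θ² = ∫ k² > 0.
  have hc₁0 : c₁ ≠ 0 := by
    have h1 : c₁ = ∫ x, k x * k x := by
      have h2 := SchwartzMap.integral_fourier_mul_eq k θ
      rw [hθhat] at h2
      have h3 : 𝓕 k = θ := by
        ext x
        have : θ x = 𝓕⁻ (k : Eu n → ℂ) x := by rw [← SchwartzMap.fourierInv_coe]
        rw [this, fourierInv_ee, schwartz_fourier_ee, ← integral_neg_eq_self]
        simp [hkneg]
      rw [h3] at h2
      exact h2
    have h2 : c₁ = ((∫ x, b x * b x : ℝ) : ℂ) := by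
      rw [h1, ← integral_complex_ofReal]; simp [hk]
    rw [h2]
    have hbb : Integrable (fun x => b x * b x) :=
      (b.continuous.mul b.continuous).integrable_of_hasCompactSupport b.hasCompactSupport.mul_left
    have : 0 < ∫ x, b x * b x := by
      refine (integral_pos_iff_support_of_nonneg (fun x => mul_self_nonneg _) hbb).2 ?_
      have : Function.support (fun x => b x * b x) = Function.support b := by
        ext; simp
      rw [this, b.support_eq]
      exact Metric.measure_ball_pos _ _ b.rOut_pos
    exact_mod_cast this.ne'
  refine ⟨⟨c⁻¹ • k, θ, c₁⁻¹ • θ, ?_, ?_, ?_, ?_, ?_⟩⟩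
  · intro x hx
    simp [hk0 x (by linarith)]
  · intro ζ hζ
    rw [hθhat]; exact hk0 ζ (by linarith)
  · simp only [_root_.smul_apply, smul_eq_mul]
    rw [← inv_mul_cancel₀ hc0, hc, ← integral_const_mul]
    congr 1; ext x; ring
  · simp only [_root_.smul_apply, smul_eq_mul]
    rw [← inv_mul_cancel₀ hc₁0, hc₁, ← integral_const_mul]
    congr 1; ext x; ring
  · intro ζ hζ
    have h1 : (fun x => θ x * (c₁⁻¹ • θ) x) = fun x => θ x * 𝓕⁻ ((c₁⁻¹ • k : 𝓢(Eu n, ℂ)) : Eu n → ℂ) x := by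
      ext x
      rw [← SchwartzMap.fourierInv_coe, FourierTransform.fourierInv_smul]
    -- The transform of θκ₀ is a convolution of two functions supported in the ball of radius 1/3,
    -- well inside radius 2.
    rw [h1, fourier_mul_fourierInv θ.integrable (c₁⁻¹ • k).integrable]
    refine integral_eq_zero_of_ae (Filter.Eventually.of_forall fun a => ?_)
    rw [← SchwartzMap.fourier_coe, hθhat]
    by_cases ha : 1 / 3 < ‖a‖
    · simp [hk0 a ha]
    · have : k (ζ - a) = 0 := by
        apply hk0
        have : ‖ζ‖ ≤ ‖ζ - a‖ + ‖a‖ := by simpa using norm_add_le (ζ - a) a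
        linarith
      simp [this]

/-! ### Cauchy-Schwarz and cut-offs against band-limited functions -/

theorem lintegral_mul_le_sqrt_mul_sqrt {α : Type*} [MeasurableSpace α] {m : Measure α}
    {f g : α → ℝ≥0∞} (hf : AEMeasurable f m) (hg : AEMeasurable g m) :
    ∫⁻ x, f x * g x ∂m ≤
      (∫⁻ x, f x ^ 2 ∂m) ^ (1 / 2 : ℝ) * (∫⁻ x, g x ^ 2 ∂m) ^ (1 / 2 : ℝ) := by
  have := ENNReal.lintegral_mul_le_Lp_mul_Lq m Real.HolderConjugate.two_two hf hg
  simpa using this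

theorem sqrt_mul_self_ennreal (a : ℝ≥0∞) : a ^ (1 / 2 : ℝ) * a ^ (1 / 2 : ℝ) = a := by
  rw [← ENNReal.rpow_add_of_nonneg _ _ (by norm_num) (by norm_num)]; norm_num

theorem sqrt_sq_ennreal (a : ℝ≥0∞) : (a ^ (1 / 2 : ℝ)) ^ 2 = a := by
  rw [sq, sqrt_mul_self_ennreal]

theorem sq_sqrt_ennreal (a : ℝ≥0∞) : (a ^ 2) ^ (1 / 2 : ℝ) = a := by
  rw [← ENNReal.rpow_natCast, ← ENNReal.rpow_mul]; norm_num

theorem sqrt_mul_ennreal (a b : ℝ≥0∞) :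
    (a * b) ^ (1 / 2 : ℝ) = a ^ (1 / 2 : ℝ) * b ^ (1 / 2 : ℝ) :=
  ENNReal.mul_rpow_of_nonneg _ _ (by norm_num)

theorem sqrt_le_sqrt_ennreal {a b : ℝ≥0∞} (h : a ≤ b) : a ^ (1 / 2 : ℝ) ≤ b ^ (1 / 2 : ℝ) :=
  ENNReal.rpow_le_rpow h (by norm_num)

/-- Multiplication convolves spectra: frequencies beyond K + r, moved by at most r, stay beyond K.
-/
theorem fourier_mul_fourierInv_eq_zero {S D : Eu n → ℂ} (hS : Integrable S) (hD : Integrable D)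
    {r K : ℝ} (hS0 : ∀ ζ, r < ‖ζ‖ → 𝓕 S ζ = 0) (hD0 : ∀ ζ, ‖ζ‖ ≤ K + r → D ζ = 0) {a : Eu n}
    (ha : ‖a‖ ≤ K) : 𝓕 (fun x => S x * 𝓕⁻ D x) a = 0 := by
  rw [fourier_mul_fourierInv hS hD]
  refine integral_eq_zero_of_ae (Filter.Eventually.of_forall fun ζ => ?_)
  simp only [Pi.zero_apply]
  by_cases h : ‖ζ‖ ≤ K + r
  · rw [hD0 ζ h, zero_mul]
  · rw [hS0, mul_zero]
    have : ‖ζ‖ ≤ ‖a‖ + ‖a - ζ‖ := by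
      rw [norm_sub_rev]; simpa using norm_add_le a (ζ - a)
    push Not at h
    linarith

theorem fourier_trS_eq_zero {θ : 𝓢(Eu n, ℂ)} {r : ℝ} (hθ : ∀ ζ, r < ‖ζ‖ → 𝓕 θ ζ = 0) (ν : Eu n)
    {ζ : Eu n} (hζ : r < ‖ζ‖) : 𝓕 (trS ν θ) ζ = 0 := by
  rw [SchwartzMap.fourier_coe]
  have : (trS ν θ : Eu n → ℂ) = fun x => θ (x - ν) := rfl
  rw [this, fourier_comp_sub, ← SchwartzMap.fourier_coe, hθ ζ hζ, mul_zero]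

/-- Against a band-limited function, the frequencies of a test function may be cut off. -/
theorem BandLimited.integral_cutoff {v : Eu n → ℂ} {K M : ℝ} (hv : BandLimited v K)
    (hvc : Continuous v) (hvb : ∀ x, ‖v x‖ ≤ M) {θ χ : 𝓢(Eu n, ℂ)}
    (hθ : ∀ ζ, 1 < ‖ζ‖ → 𝓕 θ ζ = 0) (hχ : ∀ ζ, ‖ζ‖ ≤ K + 1 → χ ζ = 1) (B : 𝓢(Eu n, ℂ))
    (ν : Eu n) :
    ∫ ξ, v ξ * (mulS (trS ν θ) (𝓕⁻ B)) ξ = ∫ ξ, v ξ * (mulS (trS ν θ) (𝓕⁻ (mulS χ B))) ξ := by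
  have hint : ∀ b : 𝓢(Eu n, ℂ), Integrable (fun ξ => v ξ * b ξ) := fun b =>
    b.integrable.bdd_mul hvc.aestronglyMeasurable (Filter.Eventually.of_forall hvb)
  -- The difference involves B - χB, which vanishes on the ball of radius K + 1. Multiplication by θ
  -- moves frequencies by at most 1, so `v` annihilates it.
  rw [← sub_eq_zero, ← integral_sub (hint _) (hint _)]
  have h1 : ∀ ξ, v ξ * (mulS (trS ν θ) (𝓕⁻ B)) ξ - v ξ * (mulS (trS ν θ) (𝓕⁻ (mulS χ B))) ξ =
      v ξ * (trS ν θ ξ * 𝓕⁻ ((B - mulS χ B : 𝓢(Eu n, ℂ)) : Eu n → ℂ) ξ) := fun ξ => by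
    rw [← SchwartzMap.fourierInv_coe]
    have : 𝓕⁻ (B - mulS χ B) = 𝓕⁻ B - 𝓕⁻ (mulS χ B) := by
      simpa using map_sub (FourierTransform.fourierInvCLM ℂ 𝓢(Eu n, ℂ)) B (mulS χ B)
    rw [this]
    simp only [mulS_apply, _root_.sub_apply]
    ring
  simp_rw [h1]
  refine hv _ ?_ fun ζ hζ => ?_
  · rw [← SchwartzMap.fourierInv_coe]
    exact integrable_mul_schwartz _ _
  · refine fourier_mul_fourierInv_eq_zero (r := 1) (K := K) (trS ν θ).integrable
      (SchwartzMap.integrable _) (fun ζ hζ => ?_) (fun ζ hζ => ?_) hζ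
    · rw [← SchwartzMap.fourier_coe]; exact fourier_trS_eq_zero hθ ν hζ
    · simp [hχ ζ hζ]

theorem integrable_bdd_mul_prod {v : Eu n × Eu n → ℂ} {M : ℝ} (hvc : Continuous v)
    (hvb : ∀ x, ‖v x‖ ≤ M) (b c : 𝓢(Eu n, ℂ)) :
    Integrable (fun p : Eu n × Eu n => v p * (b p.1 * c p.2)) :=
  (b.integrable.mul_prod c.integrable).bdd_mul hvc.aestronglyMeasurable
    (Filter.Eventually.of_forall hvb)

theorem lintegral_enorm_sq_mul (b c : 𝓢(Eu n, ℂ)) :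
    ∫⁻ p : Eu n × Eu n, ‖b p.1‖ₑ ^ 2 * ‖c p.2‖ₑ ^ 2 =
      (∫⁻ x, ‖b x‖ₑ ^ 2) * ∫⁻ x, ‖c x‖ₑ ^ 2 := by
  rw [Measure.volume_eq_prod, lintegral_prod_mul (f := fun x => ‖b x‖ₑ ^ 2)
    (g := fun x => ‖c x‖ₑ ^ 2)]
  · exact (b.continuous.enorm.measurable.pow_const _).aemeasurable
  · exact (c.continuous.enorm.measurable.pow_const _).aemeasurable

/-- Band-limitation in ξ and in η permits cutting B and C by χ₁ and χ₂ before absolute values are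
taken. After that, Cauchy-Schwarz and Plancherel suffice: the windows θ stay with v, and only the
parts of B and C on the supports of the cut-offs remain. -/
theorem enorm_integral_pair_le {v : Eu n × Eu n → ℂ} {K₁ K₂ M : ℝ} (hvc : Continuous v)
    (hvb : ∀ x, ‖v x‖ ≤ M) (h1 : ∀ η, BandLimited (fun ξ => v (ξ, η)) K₁)
    (h2 : ∀ ξ, BandLimited (fun η => v (ξ, η)) K₂) {θ χ₁ χ₂ : 𝓢(Eu n, ℂ)}
    (hθ : ∀ ζ, 1 < ‖ζ‖ → 𝓕 θ ζ = 0) (hχ₁ : ∀ ζ, ‖ζ‖ ≤ K₁ + 1 → χ₁ ζ = 1)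
    (hχ₂ : ∀ ζ, ‖ζ‖ ≤ K₂ + 1 → χ₂ ζ = 1) (B C : 𝓢(Eu n, ℂ)) (ν μ : Eu n) :
    ‖∫ p : Eu n × Eu n, v p * ((mulS (trS ν θ) (𝓕⁻ B)) p.1 * (mulS (trS μ θ) (𝓕⁻ C)) p.2)‖ₑ ≤
      (∫⁻ p : Eu n × Eu n, (‖v p‖ₑ * (‖θ (p.1 - ν)‖ₑ * ‖θ (p.2 - μ)‖ₑ)) ^ 2) ^ (1 / 2 : ℝ) *
        ((∫⁻ ζ, ‖χ₁ ζ * B ζ‖ₑ ^ 2) ^ (1 / 2 : ℝ) * (∫⁻ ζ, ‖χ₂ ζ * C ζ‖ₑ ^ 2) ^ (1 / 2 : ℝ)) := by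
  have e1 : ∫ p : Eu n × Eu n,
        v p * ((mulS (trS ν θ) (𝓕⁻ B)) p.1 * (mulS (trS μ θ) (𝓕⁻ C)) p.2) =
      ∫ p : Eu n × Eu n,
        v p * ((mulS (trS ν θ) (𝓕⁻ (mulS χ₁ B))) p.1 * (mulS (trS μ θ) (𝓕⁻ C)) p.2) := by
    rw [Measure.volume_eq_prod, integral_prod_symm _ (integrable_bdd_mul_prod hvc hvb _ _),
      integral_prod_symm _ (integrable_bdd_mul_prod hvc hvb _ _)]
    congr 1; ext η
    simp_rw [← mul_assoc]
    rw [integral_mul_const, integral_mul_const, (h1 η).integral_cutoff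
      (hvc.comp (by fun_prop)) (fun _ => hvb _) hθ hχ₁]
  have e2 : ∫ p : Eu n × Eu n,
        v p * ((mulS (trS ν θ) (𝓕⁻ (mulS χ₁ B))) p.1 * (mulS (trS μ θ) (𝓕⁻ C)) p.2) =
      ∫ p : Eu n × Eu n, v p *
        ((mulS (trS ν θ) (𝓕⁻ (mulS χ₁ B))) p.1 * (mulS (trS μ θ) (𝓕⁻ (mulS χ₂ C))) p.2) := by
    rw [Measure.volume_eq_prod, integral_prod _ (integrable_bdd_mul_prod hvc hvb _ _),
      integral_prod _ (integrable_bdd_mul_prod hvc hvb _ _)]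
    congr 1; ext ξ
    have e : ∀ b c : 𝓢(Eu n, ℂ), ∫ η, v (ξ, η) * (b ξ * c η) = b ξ * ∫ η, v (ξ, η) * c η := by
      intro b c
      rw [← integral_const_mul]; congr 1; ext η; ring
    simp only [e]
    rw [(h2 ξ).integral_cutoff
      (hvc.comp (by fun_prop)) (fun _ => hvb _) hθ hχ₂]
  rw [e1, e2]
  refine (enorm_integral_le_lintegral_enorm _).trans ?_
  have hm : ∀ b : 𝓢(Eu n, ℂ), Measurable (fun x => ‖b x‖ₑ) := fun b => b.continuous.enorm.measurable
  have e3 : ∀ p : Eu n × Eu n, ‖v p * ((mulS (trS ν θ) (𝓕⁻ (mulS χ₁ B))) p.1 *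
        (mulS (trS μ θ) (𝓕⁻ (mulS χ₂ C))) p.2)‖ₑ =
      (‖v p‖ₑ * (‖θ (p.1 - ν)‖ₑ * ‖θ (p.2 - μ)‖ₑ)) *
        (‖(𝓕⁻ (mulS χ₁ B)) p.1‖ₑ * ‖(𝓕⁻ (mulS χ₂ C)) p.2‖ₑ) := fun p => by
    simp only [mulS_apply, trS_apply, enorm_mul]; ring
  simp_rw [e3]
  refine (lintegral_mul_le_sqrt_mul_sqrt ?_ ?_).trans (le_of_eq ?_)
  · exact (hvc.enorm.measurable.mul (((hm (trS ν θ)).comp measurable_fst).mul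
      ((hm (trS μ θ)).comp measurable_snd))).aemeasurable
  · exact (((hm _).comp measurable_fst).mul ((hm _).comp measurable_snd)).aemeasurable
  · congr 1
    simp_rw [mul_pow]
    rw [lintegral_enorm_sq_mul, sqrt_mul_ennreal, integral_enorm_sq_fourierInv, integral_enorm_sq_fourierInv]
    simp [mul_pow]

/-! ### The trilinear form on a phase space cell -/

/-- The test function paired with the symbol. -/
def wave (f g : 𝓢(Eu n, ℂ)) (h : Eu n → ℂ) (z : Eu n × Eu n × Eu n) : ℂ :=
  h z.1 * ((ee (inner ℝ z.2.1 z.1) * 𝓕 f z.2.1) * (ee (inner ℝ z.2.2 z.1) * 𝓕 g z.2.2))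

/-- The trilinear form with symbol `v`. -/
def lam (v : Eu n × Eu n × Eu n → ℂ) (f g : 𝓢(Eu n, ℂ)) (h : Eu n → ℂ) : ℂ :=
  ∫ z, v z * wave f g h z

/-- The weight adapted to the length `K`. -/
def wt (K : ℝ) (y : Eu n) : ℝ≥0∞ := ENNReal.ofReal ((1 + ‖y‖ / K) ^ (n + 1))⁻¹

/-- Local size of the wave packet of `f` at frequency `ν` near `x₀`. -/
def locF (κ f : 𝓢(Eu n, ℂ)) (K : ℝ) (x₀ ν : Eu n) : ℝ≥0∞ :=
  (∫⁻ y, ‖wp κ f ν y‖ₑ ^ 2 * wt K (y - x₀)) ^ (1 / 2 : ℝ)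

/-- As a function of ξ, the modulated packet is the inverse transform of t ↦ `wp κ f ν (x - t)`. A
cut-off in the variable dual to ξ is therefore a spatial cut-off of the wave packet around x. -/
theorem wave_packet_mod (κ f : 𝓢(Eu n, ℂ)) (ν ξ x : Eu n) :
    ee (inner ℝ ξ x) * (𝓕 f ξ * κ (ξ - ν)) =
      (𝓕⁻ (trS x (𝓕 (mulS (𝓕 f) (trS ν κ)))) : 𝓢(Eu n, ℂ)) ξ := by
  rw [SchwartzMap.fourierInv_coe]
  have : (trS x (𝓕 (mulS (𝓕 f) (trS ν κ))) : Eu n → ℂ) =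
    fun t => (𝓕 (mulS (𝓕 f) (trS ν κ)) : 𝓢(Eu n, ℂ)) (t - x) := rfl
  rw [this, fourierInv_comp_sub, ← SchwartzMap.fourierInv_coe, real_inner_comm]
  simp

theorem fourier_mulS_eq_wp (κ f : 𝓢(Eu n, ℂ)) (ν s : Eu n) :
    (𝓕 (mulS (𝓕 f) (trS ν κ)) : 𝓢(Eu n, ℂ)) s = wp κ f ν (-s) := by
  rw [wp, schwartz_fourier_ee, schwartz_fourierInv_ee]
  simp

/-- By the triangle inequality 1 + ‖x - t - x₀‖/K ≤ 5(1 + ‖x - x₀‖). Localization around x is thus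
traded for a weight around the centre x₀ of the cell, at a polynomial price in x - x₀ that the decay
of κ₀ will absorb. -/
theorem one_le_wt {K : ℝ} (hK : 1 ≤ K) {x t x₀ : Eu n} (ht : ‖t‖ ≤ 4 * K) :
    1 ≤ (ENNReal.ofReal 5) ^ (n + 1) * (ENNReal.ofReal (1 + ‖x - x₀‖)) ^ (n + 1) *
      wt K (x - t - x₀) := by
  rw [wt, ← ENNReal.ofReal_pow (by norm_num), ← ENNReal.ofReal_pow (by positivity),
    ← ENNReal.ofReal_mul (by positivity), ← ENNReal.ofReal_mul (by positivity),
    ENNReal.one_le_ofReal, ← mul_pow, ← inv_pow, ← mul_pow]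
  refine one_le_pow₀ ?_
  have hK0 : 0 < K := by linarith
  rw [← div_eq_mul_inv, one_le_div (by positivity)]
  have h1 : ‖x - t - x₀‖ ≤ ‖x - x₀‖ + 4 * K := by
    rw [show x - t - x₀ = (x - x₀) - t by abel]
    exact (norm_sub_le _ _).trans (by linarith)
  have h2 : ‖x - t - x₀‖ / K ≤ ‖x - x₀‖ + 4 := by
    rw [div_le_iff₀ hK0]
    nlinarith [norm_nonneg (x - x₀)]
  nlinarith [norm_nonneg (x - x₀)]

theorem lintegral_cutoff_packet_le {χ : 𝓢(Eu n, ℂ)} {c K : ℝ} (hK : 1 ≤ K)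
    (hc : ∀ t, ‖χ t‖ ≤ c) (hχ : ∀ t, 4 * K < ‖t‖ → χ t = 0) (κ f : 𝓢(Eu n, ℂ)) (ν x x₀ : Eu n) :
    ∫⁻ t, ‖χ t * (trS x (𝓕 (mulS (𝓕 f) (trS ν κ)))) t‖ₑ ^ 2 ≤
      (ENNReal.ofReal c ^ 2 * ENNReal.ofReal 5 ^ (n + 1)) *
        (ENNReal.ofReal (1 + ‖x - x₀‖)) ^ (n + 1) * (locF κ f K x₀ ν) ^ 2 := by
  rw [locF, sqrt_sq_ennreal, ← lintegral_sub_left_eq_self (fun y => ‖wp κ f ν y‖ₑ ^ 2 * wt K (y - x₀)) x,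
    ← lintegral_const_mul']
  · refine lintegral_mono fun t => ?_
    simp only [trS_apply, fourier_mulS_eq_wp, neg_sub]
    by_cases ht : 4 * K < ‖t‖
    · simp [hχ t ht]
    · have h1 := one_le_wt hK (x := x) (x₀ := x₀) (not_lt.1 ht)
      have h2 : ‖χ t‖ₑ ≤ ENNReal.ofReal c := by
        rw [← ofReal_norm]; exact ENNReal.ofReal_le_ofReal (hc t)
      rw [enorm_mul, mul_pow]
      calc ‖χ t‖ₑ ^ 2 * ‖wp κ f ν (x - t)‖ₑ ^ 2
          ≤ ENNReal.ofReal c ^ 2 * ‖wp κ f ν (x - t)‖ₑ ^ 2 * 1 := by rw [mul_one]; gcongr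
        _ ≤ ENNReal.ofReal c ^ 2 * ‖wp κ f ν (x - t)‖ₑ ^ 2 * _ := mul_le_mul_right h1 _
        _ = _ := by ring
  · finiteness

/-- Cell window. -/
def Windows.cell (W : Windows n) (z : Eu n × Eu n × Eu n) : ℂ :=
  (W.θ z.1 * W.κ₀ z.1) * ((W.θ z.2.1 * W.κ z.2.1) * (W.θ z.2.2 * W.κ z.2.2))

/-- The part of the trilinear form that lives in the cell around `z₀`. -/
def cellInt (W : Windows n) (v : Eu n × Eu n × Eu n → ℂ) (f g : 𝓢(Eu n, ℂ)) (h : Eu n → ℂ)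
    (z₀ : Eu n × Eu n × Eu n) : ℂ :=
  ∫ z, v z * wave f g h z * W.cell (z - z₀)

/-- Local size of the symbol in the cell around `z₀`. -/
def locN (W : Windows n) (v : Eu n × Eu n × Eu n → ℂ) (z₀ : Eu n × Eu n × Eu n) : ℝ≥0∞ :=
  (∫⁻ z, (‖v z‖ₑ * (‖W.θ (z.1 - z₀.1)‖ₑ * (‖W.θ (z.2.1 - z₀.2.1)‖ₑ *
    ‖W.θ (z.2.2 - z₀.2.2)‖ₑ))) ^ 2) ^ (1 / 2 : ℝ)

/-- The weight that localizes the position variable. -/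
def posWt (W : Windows n) (x : Eu n) : ℝ≥0∞ :=
  (‖W.κ₀ x‖ₑ * ENNReal.ofReal (1 + ‖x‖) ^ (n + 1)) ^ 2

/-- Local size of `h` near `x₀`. -/
def locH (W : Windows n) (h : Eu n → ℂ) (x₀ : Eu n) : ℝ≥0∞ :=
  (∫⁻ x, ‖h x‖ₑ ^ 2 * posWt W (x - x₀)) ^ (1 / 2 : ℝ)

/-- The three windows, each multiplied with the part of the test function that does not depend on
the position. -/
theorem integrable_cell_integrand (W : Windows n) {v : Eu n × Eu n × Eu n → ℂ} {M Mh : ℝ}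
    (hvc : Continuous v) (hvb : ∀ z, ‖v z‖ ≤ M) (f g : 𝓢(Eu n, ℂ)) {h : Eu n → ℂ}
    (hh : Continuous h) (hhb : ∀ x, ‖h x‖ ≤ Mh) (z₀ : Eu n × Eu n × Eu n) :
    Integrable (fun z => v z * wave f g h z * W.cell (z - z₀)) := by
  have h1 : Integrable (fun z : Eu n × Eu n × Eu n =>
      (mulS (trS z₀.1 W.θ) (trS z₀.1 W.κ₀)) z.1 *
      ((mulS (𝓕 f) (mulS (trS z₀.2.1 W.θ) (trS z₀.2.1 W.κ))) z.2.1 *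
        (mulS (𝓕 g) (mulS (trS z₀.2.2 W.θ) (trS z₀.2.2 W.κ))) z.2.2)) :=
    (SchwartzMap.integrable _).mul_prod ((SchwartzMap.integrable _).mul_prod
      (SchwartzMap.integrable _))
  have h2 : Continuous (fun z : Eu n × Eu n × Eu n =>
      v z * h z.1 * (ee (inner ℝ z.2.1 z.1) * ee (inner ℝ z.2.2 z.1))) := by
    have := continuous_ee
    fun_prop
  refine (h1.bdd_mul (c := M * Mh) h2.aestronglyMeasurable
    (Filter.Eventually.of_forall fun z => ?_)).congr (Filter.Eventually.of_forall fun z => ?_)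
  · rw [norm_mul, norm_mul, norm_mul, norm_ee, norm_ee, mul_one, mul_one]
    exact mul_le_mul (hvb z) (hhb _) (norm_nonneg _) ((norm_nonneg _).trans (hvb z))
  · simp only [mulS_apply, trS_apply, wave, Windows.cell, Prod.fst_sub, Prod.snd_sub]; ring

/-- For fixed x the pair estimate applies in (ξ, η), and Cauchy-Schwarz in x finishes. Each window
is a product of two factors because one, θ, must stay with the symbol, while κ localizes f and g in
frequency and κ₀ localizes h in space. -/
theorem enorm_cellInt_le (W : Windows n) {v : Eu n × Eu n × Eu n → ℂ} {K₁ K₂ M Mh c : ℝ}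
    (hK₁ : 1 ≤ K₁) (hK₂ : 1 ≤ K₂)
    (hvc : Continuous v) (hvb : ∀ z, ‖v z‖ ≤ M)
    (h1 : ∀ x η, BandLimited (fun ξ => v (x, ξ, η)) K₁)
    (h2 : ∀ x ξ, BandLimited (fun η => v (x, ξ, η)) K₂) {χ₁ χ₂ : 𝓢(Eu n, ℂ)}
    (hχ₁ : ∀ ζ, ‖ζ‖ ≤ K₁ + 1 → χ₁ ζ = 1) (hχ₁' : ∀ ζ, 4 * K₁ < ‖ζ‖ → χ₁ ζ = 0)
    (hχ₁c : ∀ ζ, ‖χ₁ ζ‖ ≤ c)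
    (hχ₂ : ∀ ζ, ‖ζ‖ ≤ K₂ + 1 → χ₂ ζ = 1) (hχ₂' : ∀ ζ, 4 * K₂ < ‖ζ‖ → χ₂ ζ = 0)
    (hχ₂c : ∀ ζ, ‖χ₂ ζ‖ ≤ c)
    (f g : 𝓢(Eu n, ℂ)) {h : Eu n → ℂ}
    (hh : Continuous h) (hhb : ∀ x, ‖h x‖ ≤ Mh) (z₀ : Eu n × Eu n × Eu n) :
    ‖cellInt W v f g h z₀‖ₑ ≤ (ENNReal.ofReal c ^ 2 * ENNReal.ofReal 5 ^ (n + 1)) * locN W v z₀ *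
      (locF W.κ f K₁ z₀.1 z₀.2.1 * locF W.κ g K₂ z₀.1 z₀.2.2 * locH W h z₀.1) := by
  obtain ⟨x₀, ν, μ⟩ := z₀
  set A : ℝ≥0∞ := ENNReal.ofReal c ^ 2 * ENNReal.ofReal 5 ^ (n + 1) with hA
  have hi := integrable_cell_integrand W hvc hvb f g hh hhb (x₀, ν, μ)
  set qf := mulS (𝓕 f) (trS ν W.κ)
  set qg := mulS (𝓕 g) (trS μ W.κ)
  have e1 : cellInt W v f g h (x₀, ν, μ) = ∫ x, (W.θ (x - x₀) * W.κ₀ (x - x₀) * h x) *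
      ∫ p : Eu n × Eu n, v (x, p) * ((mulS (trS ν W.θ) (𝓕⁻ (trS x (𝓕 qf)))) p.1 *
        (mulS (trS μ W.θ) (𝓕⁻ (trS x (𝓕 qg)))) p.2) := by
    rw [cellInt, Measure.volume_eq_prod, integral_prod _ hi]
    congr 1; ext x
    rw [← integral_const_mul]
    congr 1; ext p
    simp only [mulS_apply, trS_apply]
    rw [← wave_packet_mod, ← wave_packet_mod]
    simp only [wave, Windows.cell, Prod.fst_sub, Prod.snd_sub]
    ring
  rw [e1]
  refine (enorm_integral_le_lintegral_enorm _).trans ?_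
  set Nx : Eu n → ℝ≥0∞ := fun x => ∫⁻ p : Eu n × Eu n,
    (‖v (x, p)‖ₑ * (‖W.θ (p.1 - ν)‖ₑ * ‖W.θ (p.2 - μ)‖ₑ)) ^ 2 with hNx
  have hmeas : Measurable (fun z : Eu n × Eu n × Eu n =>
      (‖v z‖ₑ * (‖W.θ (z.2.1 - ν)‖ₑ * ‖W.θ (z.2.2 - μ)‖ₑ)) ^ 2) := by
    have := W.θ.continuous
    have h1 : Continuous (fun z : Eu n × Eu n × Eu n => W.θ (z.2.1 - ν)) := by fun_prop
    have h2 : Continuous (fun z : Eu n × Eu n × Eu n => W.θ (z.2.2 - μ)) := by fun_prop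
    exact (hvc.enorm.measurable.mul (h1.enorm.measurable.mul h2.enorm.measurable)).pow_const _
  have hNm : Measurable Nx := hmeas.lintegral_prod_right'
  have hp : ∀ x, ‖(W.θ (x - x₀) * W.κ₀ (x - x₀) * h x) *
      ∫ p : Eu n × Eu n, v (x, p) * ((mulS (trS ν W.θ) (𝓕⁻ (trS x (𝓕 qf)))) p.1 *
        (mulS (trS μ W.θ) (𝓕⁻ (trS x (𝓕 qg)))) p.2)‖ₑ ≤
      (A * (locF W.κ f K₁ x₀ ν * locF W.κ g K₂ x₀ μ)) * ((‖W.θ (x - x₀)‖ₑ * Nx x ^ (1 / 2 : ℝ)) *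
        (‖h x‖ₑ * (‖W.κ₀ (x - x₀)‖ₑ * ENNReal.ofReal (1 + ‖x - x₀‖) ^ (n + 1)))) := by
    intro x
    have hpair := enorm_integral_pair_le (v := fun p => v (x, p)) (hvc.comp (by fun_prop))
      (fun _ => hvb _) (h1 x) (h2 x) W.θ_hat hχ₁ hχ₂ (trS x (𝓕 qf)) (trS x (𝓕 qg)) ν μ
    have hf' := sqrt_le_sqrt_ennreal
      (lintegral_cutoff_packet_le hK₁ hχ₁c hχ₁' W.κ f ν x x₀)
    have hg' := sqrt_le_sqrt_ennreal
      (lintegral_cutoff_packet_le hK₂ hχ₂c hχ₂' W.κ g μ x x₀)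
    rw [sqrt_mul_ennreal, sq_sqrt_ennreal, ← hA] at hf' hg'
    -- f and g each contribute a square root of D, so h receives a full power (1 + ‖x - x₀‖)^(n+1);
    -- this explains the exponent in `posWt`.
    set D := A * ENNReal.ofReal (1 + ‖x - x₀‖) ^ (n + 1) with hD
    have hpair2 := hpair.trans (mul_le_mul_right (mul_le_mul' hf' hg') _)
    rw [enorm_mul, enorm_mul, enorm_mul]
    calc _ ≤ ‖W.θ (x - x₀)‖ₑ * ‖W.κ₀ (x - x₀)‖ₑ * ‖h x‖ₑ * _ := mul_le_mul_right hpair2 _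
      _ = ‖W.θ (x - x₀)‖ₑ * ‖W.κ₀ (x - x₀)‖ₑ * ‖h x‖ₑ * (Nx x ^ (1 / 2 : ℝ) *
          ((D ^ (1 / 2 : ℝ) * D ^ (1 / 2 : ℝ)) *
            (locF W.κ f K₁ x₀ ν * locF W.κ g K₂ x₀ μ))) := by
          simp only [hNx]; ring
      _ = _ := by rw [sqrt_mul_self_ennreal, hD]; ring
  refine (lintegral_mono hp).trans ?_
  have hθm : Measurable (fun x => ‖W.θ (x - x₀)‖ₑ) :=
    (W.θ.continuous.comp (by fun_prop)).enorm.measurable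
  have hκm : Measurable (fun x => ‖W.κ₀ (x - x₀)‖ₑ) :=
    (W.κ₀.continuous.comp (by fun_prop)).enorm.measurable
  have hm1 : Measurable (fun x => ‖W.θ (x - x₀)‖ₑ * Nx x ^ (1 / 2 : ℝ)) :=
    hθm.mul (hNm.pow_const _)
  have hpm : Measurable (fun x : Eu n => ENNReal.ofReal (1 + ‖x - x₀‖) ^ (n + 1)) := by fun_prop
  have hm2 : Measurable (fun x => ‖h x‖ₑ * (‖W.κ₀ (x - x₀)‖ₑ *
      ENNReal.ofReal (1 + ‖x - x₀‖) ^ (n + 1))) :=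
    hh.enorm.measurable.mul (hκm.mul hpm)
  refine (lintegral_const_mul _ (hm1.mul hm2)).le.trans ?_
  have hcs := lintegral_mul_le_sqrt_mul_sqrt (m := (volume : Measure (Eu n)))
    hm1.aemeasurable hm2.aemeasurable
  refine (mul_le_mul_right hcs _).trans (le_of_eq ?_)
  have eN : (∫⁻ x, (‖W.θ (x - x₀)‖ₑ * Nx x ^ (1 / 2 : ℝ)) ^ 2) ^ (1 / 2 : ℝ) =
      locN W v (x₀, ν, μ) := by
    rw [locN, Measure.volume_eq_prod, lintegral_prod]
    · congr 1
      refine lintegral_congr fun x => ?_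
      rw [mul_pow, sqrt_sq_ennreal, hNx, ← lintegral_const_mul' _ _ (by finiteness)]
      refine lintegral_congr fun p => ?_
      ring
    · have := (hmeas.mul ((hθm.comp measurable_fst).pow_const 2)).aemeasurable (μ := volume)
      refine this.congr (Filter.Eventually.of_forall fun z => ?_)
      simp only [Function.comp, Pi.mul_apply]
      ring
  have eH : (∫⁻ x, (‖h x‖ₑ * (‖W.κ₀ (x - x₀)‖ₑ *
      ENNReal.ofReal (1 + ‖x - x₀‖) ^ (n + 1))) ^ 2) ^ (1 / 2 : ℝ) = locH W h x₀ := by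
    rw [locH]
    congr 1
    refine lintegral_congr fun x => ?_
    rw [mul_pow, posWt]
  rw [eN, eH]
  ring

attribute [irreducible] locF locH locN cellInt lam

/-! ### Dilations, L² norms and integrable weights -/

theorem lintegral_comp_inv_smul (f : Eu n → ℝ≥0∞) {s : ℝ} (hs : 0 < s) :
    ∫⁻ x, f (s⁻¹ • x) = ENNReal.ofReal s ^ n * ∫⁻ x, f x := by
  have h1 : MeasurableEmbedding (fun x : Eu n => s⁻¹ • x) :=
    (Homeomorph.smulOfNeZero s⁻¹ (inv_ne_zero hs.ne')).measurableEmbedding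
  rw [← h1.lintegral_map, Measure.map_addHaar_smul volume (inv_ne_zero hs.ne'),
    lintegral_smul_measure, finrank_euclideanSpace_fin, ← inv_pow, inv_inv, abs_of_pos (by positivity),
    ENNReal.ofReal_pow hs.le, smul_eq_mul]

/-- The dilate `f(s⁻¹ ·)` of a Schwartz function. -/
def dilS (s : ℝ) (hs : 0 < s) (f : 𝓢(Eu n, ℂ)) : 𝓢(Eu n, ℂ) :=
  SchwartzMap.compCLMOfContinuousLinearEquiv ℂ
    (ContinuousLinearEquiv.smulLeft (Units.mk0 s⁻¹ (inv_ne_zero hs.ne'))) f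

@[simp] theorem dilS_apply (s : ℝ) (hs : 0 < s) (f : 𝓢(Eu n, ℂ)) (x : Eu n) :
    dilS s hs f x = f (s⁻¹ • x) := rfl

/-- The `L²` norm. -/
def nrm2 (f : Eu n → ℂ) : ℝ≥0∞ := (∫⁻ x, ‖f x‖ₑ ^ 2) ^ (1 / 2 : ℝ)

theorem nrm2_sq (f : Eu n → ℂ) : nrm2 f ^ 2 = ∫⁻ x, ‖f x‖ₑ ^ 2 := sqrt_sq_ennreal _

theorem nrm2_eq_eLpNorm (f : Eu n → ℂ) : nrm2 f = eLpNorm f 2 volume := by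
  rw [eLpNorm_eq_lintegral_rpow_enorm_toReal (by norm_num) (by norm_num), nrm2]
  simp

theorem nrm2_schwartz_ne_top (f : 𝓢(Eu n, ℂ)) : nrm2 f ≠ ∞ := by
  rw [nrm2_eq_eLpNorm]
  have h : MemLp (f : Eu n → ℂ) 2 volume := f.memLp 2 volume
  exact h.2.ne

theorem nrm2_dilS (s : ℝ) (hs : 0 < s) (f : 𝓢(Eu n, ℂ)) :
    nrm2 (dilS s hs f) ^ 2 = ENNReal.ofReal s ^ n * nrm2 f ^ 2 := by
  rw [nrm2_sq, nrm2_sq, ← lintegral_comp_inv_smul _ hs]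
  simp only [dilS_apply]

theorem measurable_wt (K : ℝ) : Measurable (wt K : Eu n → ℝ≥0∞) := by
  unfold wt; fun_prop

theorem lintegral_wt_one_lt_top : ∫⁻ y : Eu n, wt 1 y < ∞ := by
  -- The exponent n + 1 is chosen to exceed the dimension.
  have h := finite_integral_one_add_norm (μ := (volume : Measure (Eu n))) (r := (n + 1 : ℝ)) (by simp)
  refine lt_of_le_of_lt (lintegral_mono fun y => ?_) h
  rw [wt, div_one, Real.rpow_neg (by positivity)]
  norm_cast

theorem lintegral_wt {K : ℝ} (hK : 0 < K) :
    ∫⁻ y : Eu n, wt K y = ENNReal.ofReal K ^ n * ∫⁻ y : Eu n, wt 1 y := by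
  rw [← lintegral_comp_inv_smul _ hK]
  refine lintegral_congr fun y => ?_
  simp only [wt, norm_smul, norm_inv, Real.norm_eq_abs, abs_of_pos hK, div_one]
  rw [inv_mul_eq_div]

theorem schwartz_decay (f : 𝓢(Eu n, ℂ)) (k : ℕ) : ∃ C : ℝ, 0 ≤ C ∧
    ∀ x, (1 + ‖x‖) ^ k * ‖f x‖ ≤ C := by
  refine ⟨2 ^ k * (Finset.Iic (k, 0)).sup (fun m => SchwartzMap.seminorm ℝ m.1 m.2) f, by positivity,
    fun x => ?_⟩
  have := SchwartzMap.one_add_le_sup_seminorm_apply (𝕜 := ℝ) (m := (k, 0)) le_rfl le_rfl f x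
  simpa using this

theorem measurable_posWt (W : Windows n) : Measurable (posWt W) := by
  unfold posWt
  exact (W.κ₀.continuous.enorm.measurable.mul (by fun_prop)).pow_const _

theorem lintegral_posWt_lt_top (W : Windows n) : ∫⁻ x, posWt W x < ∞ := by
  obtain ⟨C, hC0, hC⟩ := schwartz_decay W.κ₀ ((n + 1) + (n + 1))
  have : ∀ x, posWt W x ≤ ENNReal.ofReal C ^ 2 * wt 1 x := by
    intro x
    have hx := hC x
    have h1 : 0 < 1 + ‖x‖ := by positivity
    have h2 : ‖W.κ₀ x‖ * (1 + ‖x‖) ^ (n + 1) ≤ C * ((1 + ‖x‖) ^ (n + 1))⁻¹ := by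
      rw [← div_eq_mul_inv, le_div_iff₀ (by positivity)]
      rw [pow_add] at hx; linarith
    have h3 : ((1 + ‖x‖) ^ (n + 1))⁻¹ ≤ 1 :=
      inv_le_one_of_one_le₀ (one_le_pow₀ (by linarith [norm_nonneg x]))
    have h4 : 0 ≤ ((1 + ‖x‖) ^ (n + 1))⁻¹ := by positivity
    rw [posWt, wt, div_one, ← ofReal_norm, ← ENNReal.ofReal_pow h1.le,
      ← ENNReal.ofReal_mul (norm_nonneg _), ← ENNReal.ofReal_pow (by positivity),
      ← ENNReal.ofReal_pow hC0, ← ENNReal.ofReal_mul (by positivity)]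
    refine ENNReal.ofReal_le_ofReal ?_
    calc _ ≤ (C * ((1 + ‖x‖) ^ (n + 1))⁻¹) ^ 2 := by gcongr
      _ = C ^ 2 * (((1 + ‖x‖) ^ (n + 1))⁻¹ * ((1 + ‖x‖) ^ (n + 1))⁻¹) := by ring
      _ ≤ C ^ 2 * (((1 + ‖x‖) ^ (n + 1))⁻¹ * 1) := by gcongr
      _ = _ := by rw [mul_one]
  refine lt_of_le_of_lt (lintegral_mono this) ?_
  rw [lintegral_const_mul' _ _ (by finiteness)]
  exact ENNReal.mul_lt_top (by finiteness) lintegral_wt_one_lt_top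

/-! ### Phase space integrals of the local sizes -/

theorem measurable_wp_sq (κ f : 𝓢(Eu n, ℂ)) :
    Measurable (fun p : Eu n × Eu n => ‖wp κ f p.1 p.2‖ₑ ^ 2) :=
  (continuous_wp κ f).enorm.measurable.pow_const _

theorem measurable_locF (κ f : 𝓢(Eu n, ℂ)) (K : ℝ) :
    Measurable (fun p : Eu n × Eu n => locF κ f K p.1 p.2) := by
  unfold locF
  refine Measurable.pow_const ?_ _
  have : Measurable (fun q : (Eu n × Eu n) × Eu n =>
      ‖wp κ f q.1.2 q.2‖ₑ ^ 2 * wt K (q.2 - q.1.1)) :=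
    ((measurable_wp_sq κ f).comp (by fun_prop : Measurable fun q : (Eu n × Eu n) × Eu n =>
      (q.1.2, q.2))).mul ((measurable_wt K).comp (by fun_prop))
  exact this.lintegral_prod_right'

theorem locF_sq (κ f : 𝓢(Eu n, ℂ)) (K : ℝ) (x₀ ν : Eu n) :
    locF κ f K x₀ ν ^ 2 = ∫⁻ y, ‖wp κ f ν y‖ₑ ^ 2 * wt K (y - x₀) := by
  rw [locF, sqrt_sq_ennreal]

theorem lintegral_locF_sq (κ f : 𝓢(Eu n, ℂ)) (K : ℝ) (x₀ : Eu n) :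
    ∫⁻ ν, locF κ f K x₀ ν ^ 2 = ∫⁻ y, (∫⁻ ν, ‖wp κ f ν y‖ₑ ^ 2) * wt K (y - x₀) := by
  have hm : Measurable fun q : Eu n × Eu n => ‖wp κ f q.1 q.2‖ₑ ^ 2 * wt K (q.2 - x₀) :=
    (measurable_wp_sq κ f).mul ((measurable_wt K).comp (measurable_snd.sub_const x₀))
  have hsw : ∫⁻ ν, ∫⁻ y, ‖wp κ f ν y‖ₑ ^ 2 * wt K (y - x₀) =
      ∫⁻ y, ∫⁻ ν, ‖wp κ f ν y‖ₑ ^ 2 * wt K (y - x₀) :=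
    lintegral_lintegral_swap hm.aemeasurable
  have hc : ∀ y, Measurable fun ν => ‖wp κ f ν y‖ₑ ^ 2 := fun y =>
    ((continuous_wp κ f).comp (by fun_prop :
      Continuous fun ν : Eu n => (ν, y))).enorm.measurable.pow_const 2
  calc ∫⁻ ν, locF κ f K x₀ ν ^ 2 = ∫⁻ ν, ∫⁻ y, ‖wp κ f ν y‖ₑ ^ 2 * wt K (y - x₀) :=
        lintegral_congr fun ν => locF_sq κ f K x₀ ν
    _ = _ := hsw
    _ = _ := lintegral_congr fun y => lintegral_mul_const (wt K (y - x₀)) (hc y)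

/-- The packets of a bounded function have uniformly bounded energy at every point, and the weight
has mass of order Kⁿ. The bound does not depend on x₀; it is applied to g. -/
theorem lintegral_locF_sq_le (κ f : 𝓢(Eu n, ℂ)) {K : ℝ} (hK : 0 < K) {B : ℝ≥0∞}
    (hB : ∀ x, ‖f x‖ₑ ≤ B) (x₀ : Eu n) :
    ∫⁻ ν, locF κ f K x₀ ν ^ 2 ≤
      B ^ 2 * nrm2 κ ^ 2 * (ENNReal.ofReal K ^ n * ∫⁻ y : Eu n, wt 1 y) := by
  rw [lintegral_locF_sq, nrm2_sq, ← lintegral_wt hK, ← lintegral_sub_right_eq_self (wt K) x₀,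
    ← lintegral_const_mul]
  · gcongr with y
    exact lintegral_enorm_sq_wp_le κ f B hB y
  · exact (measurable_wt K).comp (by fun_prop)

/-- Integrating over x₀ first replaces the weight by its mass, and the remaining phase space energy
factors by Plancherel. This is applied to f. -/
theorem lintegral_lintegral_locF_sq (κ f : 𝓢(Eu n, ℂ)) {K : ℝ} (hK : 0 < K) :
    ∫⁻ x₀, ∫⁻ ν, locF κ f K x₀ ν ^ 2 =
      nrm2 f ^ 2 * nrm2 κ ^ 2 * (ENNReal.ofReal K ^ n * ∫⁻ y : Eu n, wt 1 y) := by
  simp_rw [lintegral_locF_sq]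
  have hm : Measurable (fun y => ∫⁻ ν, ‖wp κ f ν y‖ₑ ^ 2) :=
    (measurable_wp_sq κ f).lintegral_prod_left'
  rw [nrm2_sq, nrm2_sq, ← lintegral_wt hK, ← lintegral_lintegral_enorm_sq_wp κ f,
    lintegral_lintegral_swap, ← lintegral_mul_const _ hm]
  · refine lintegral_congr fun y => ?_
    have hw : Measurable fun x => wt K (y - x) :=
      (measurable_wt K).comp (measurable_id.const_sub y)
    rw [lintegral_const_mul _ hw, lintegral_sub_left_eq_self (wt K) y]
  · exact ((hm.comp measurable_snd).mul ((measurable_wt K).comp (by fun_prop))).aemeasurable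

theorem lintegral_locH_sq (W : Windows n) {h : Eu n → ℂ} (hh : Continuous h) :
    ∫⁻ x₀, locH W h x₀ ^ 2 = nrm2 h ^ 2 * ∫⁻ x, posWt W x := by
  simp_rw [locH, sqrt_sq_ennreal]
  rw [nrm2_sq, lintegral_lintegral_swap, ← lintegral_mul_const _ (hh.enorm.measurable.pow_const _)]
  · refine lintegral_congr fun y => ?_
    have hw : Measurable fun x => posWt W (y - x) :=
      (measurable_posWt W).comp (measurable_id.const_sub y)
    rw [lintegral_const_mul _ hw, lintegral_sub_left_eq_self (posWt W) y]
  · exact (((hh.enorm.measurable.pow_const _).comp measurable_snd).mul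
      ((measurable_posWt W).comp (by fun_prop))).aemeasurable

theorem measurable_locH (W : Windows n) {h : Eu n → ℂ} (hh : Continuous h) :
    Measurable (locH W h) := by
  unfold locH
  refine Measurable.pow_const ?_ _
  have : Measurable (fun q : Eu n × Eu n => ‖h q.2‖ₑ ^ 2 * posWt W (q.2 - q.1)) :=
    (((hh.enorm.measurable.pow_const _).comp measurable_snd).mul
      ((measurable_posWt W).comp (by fun_prop)))
  exact this.lintegral_prod_right'

theorem measurable_locH_wp (W : Windows n) (χ h : 𝓢(Eu n, ℂ)) :
    Measurable (fun p : Eu n × Eu n => locH W (wp χ h (-p.2)) p.1) := by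
  unfold locH
  refine Measurable.pow_const ?_ _
  have : Measurable (fun q : (Eu n × Eu n) × Eu n =>
      ‖wp χ h (-q.1.2) q.2‖ₑ ^ 2 * posWt W (q.2 - q.1.1)) :=
    ((measurable_wp_sq χ h).comp (by fun_prop : Measurable fun q : (Eu n × Eu n) × Eu n =>
      (-q.1.2, q.2))).mul ((measurable_posWt W).comp (by fun_prop))
  exact this.lintegral_prod_right'

/-- The analogue for h split into packets of frequency -l. The factor `nrm2 χ ^ 2` is the price of
the splitting: for a cut-off of width K₀ it is of order K₀ⁿ. -/
theorem lintegral_lintegral_locH_wp (W : Windows n) (χ h : 𝓢(Eu n, ℂ)) :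
    ∫⁻ x₀, ∫⁻ l, locH W (wp χ h (-l)) x₀ ^ 2 =
      nrm2 h ^ 2 * nrm2 χ ^ 2 * ∫⁻ x, posWt W x := by
  rw [lintegral_lintegral_swap]
  · simp_rw [lintegral_locH_sq W (wp χ h _).continuous]
    rw [lintegral_mul_const]
    · congr 1
      rw [nrm2_sq, nrm2_sq, ← lintegral_lintegral_enorm_sq_wp, lintegral_lintegral_swap]
      · rw [← lintegral_neg_eq_self]
        simp [nrm2_sq]
      · exact ((measurable_wp_sq χ h).comp measurable_swap).aemeasurable
    · simp_rw [nrm2_sq]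
      have : Measurable (fun l => ∫⁻ x, ‖wp χ h l x‖ₑ ^ 2) :=
        (measurable_wp_sq χ h).lintegral_prod_right'
      exact this.comp measurable_neg
  · exact ((measurable_locH_wp W χ h).pow_const 2).aemeasurable

/-! ### Trilinear sums -/

theorem lintegral_le_of_support {α : Type*} [MeasurableSpace α] {m : Measure α} {F : α → ℝ≥0∞}
    (hF : Measurable F) {A : Set α} (hA : MeasurableSet A) (h0 : ∀ x, x ∉ A → F x = 0) :
    ∫⁻ x, F x ∂m ≤ m A ^ (1 / 2 : ℝ) * (∫⁻ x, F x ^ 2 ∂m) ^ (1 / 2 : ℝ) := by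
  have h1 : ∀ x, F x = A.indicator 1 x * F x := fun x => by
    by_cases hx : x ∈ A
    · simp [hx]
    · simp [h0 x hx]
  have h2 := lintegral_mul_le_sqrt_mul_sqrt (m := m)
    (measurable_one.indicator hA : Measurable (A.indicator (1 : α → ℝ≥0∞))).aemeasurable
    hF.aemeasurable
  simp_rw [← h1] at h2
  refine h2.trans (le_of_eq ?_)
  congr 2
  rw [← lintegral_indicator_one hA]
  refine lintegral_congr fun x => ?_
  by_cases hx : x ∈ A <;> simp [hx]

variable {F G H : Eu n → ℝ≥0∞}

/-- Cauchy-Schwarz in μ at fixed ν, where translation invariance removes ν from H, leaves ∫ F, which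
is at most |A|^(1/2) times an L² norm. Only one of the three supports is paid for. -/
theorem trilinear_le_left (hF : Measurable F) (hG : Measurable G) (hH : Measurable H)
    {A : Set (Eu n)} (hA : MeasurableSet A) (h0 : ∀ x, x ∉ A → F x = 0) :
    ∫⁻ ν, ∫⁻ μ, F ν * (G μ * H (ν + μ)) ≤ volume A ^ (1 / 2 : ℝ) *
      ((∫⁻ x, F x ^ 2) ^ (1 / 2 : ℝ) * (∫⁻ x, G x ^ 2) ^ (1 / 2 : ℝ) *
        (∫⁻ x, H x ^ 2) ^ (1 / 2 : ℝ)) := by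
  have h1 : ∀ ν, ∫⁻ μ, F ν * (G μ * H (ν + μ)) ≤
      F ν * ((∫⁻ x, G x ^ 2) ^ (1 / 2 : ℝ) * (∫⁻ x, H x ^ 2) ^ (1 / 2 : ℝ)) := fun ν => by
    have hH' : Measurable fun μ => H (ν + μ) := hH.comp (by fun_prop)
    refine (lintegral_const_mul _ (hG.mul hH')).le.trans ?_
    refine mul_le_mul_right ?_ _
    refine (lintegral_mul_le_sqrt_mul_sqrt hG.aemeasurable hH'.aemeasurable).trans (le_of_eq ?_)
    rw [lintegral_add_left_eq_self (fun x => H x ^ 2) ν]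
  refine (lintegral_mono h1).trans ?_
  rw [lintegral_mul_const _ hF]
  refine (mul_le_mul_left (lintegral_le_of_support hF hA h0) _).trans (le_of_eq ?_)
  ring

theorem trilinear_le_middle (hF : Measurable F) (hG : Measurable G) (hH : Measurable H)
    {A : Set (Eu n)} (hA : MeasurableSet A) (h0 : ∀ x, x ∉ A → G x = 0) :
    ∫⁻ ν, ∫⁻ μ, F ν * (G μ * H (ν + μ)) ≤ volume A ^ (1 / 2 : ℝ) *
      ((∫⁻ x, F x ^ 2) ^ (1 / 2 : ℝ) * (∫⁻ x, G x ^ 2) ^ (1 / 2 : ℝ) *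
        (∫⁻ x, H x ^ 2) ^ (1 / 2 : ℝ)) := by
  rw [lintegral_lintegral_swap]
  · have := trilinear_le_left hG hF hH hA h0
    refine le_trans (le_of_eq ?_) (this.trans (le_of_eq (by ring)))
    refine lintegral_congr fun μ => lintegral_congr fun ν => ?_
    rw [add_comm, mul_left_comm]
  · exact ((hF.comp measurable_fst).mul ((hG.comp measurable_snd).mul
      (hH.comp measurable_add))).aemeasurable

/-- The substitution l = ν + μ together with a reflection of ν exchanges the roles of G and H. -/
theorem trilinear_le_right (hF : Measurable F) (hG : Measurable G) (hH : Measurable H)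
    {A : Set (Eu n)} (hA : MeasurableSet A) (h0 : ∀ x, x ∉ A → H x = 0) :
    ∫⁻ ν, ∫⁻ μ, F ν * (G μ * H (ν + μ)) ≤ volume A ^ (1 / 2 : ℝ) *
      ((∫⁻ x, F x ^ 2) ^ (1 / 2 : ℝ) * (∫⁻ x, G x ^ 2) ^ (1 / 2 : ℝ) *
        (∫⁻ x, H x ^ 2) ^ (1 / 2 : ℝ)) := by
  have hF' : Measurable fun x => F (-x) := hF.comp measurable_neg
  have h1 := trilinear_le_middle hF' (G := H) (H := G) hH hG hA h0
  have h3 : ∫⁻ x, F (-x) ^ 2 = ∫⁻ x, F x ^ 2 := lintegral_neg_eq_self (fun x => F x ^ 2)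
  rw [h3] at h1
  refine le_trans (le_of_eq ?_) (h1.trans (le_of_eq (by ring)))
  rw [← lintegral_neg_eq_self]
  refine lintegral_congr fun ν => ?_
  rw [← lintegral_add_left_eq_self _ ν]
  refine lintegral_congr fun μ => ?_
  rw [neg_add_cancel_left, mul_comm (G _)]

/-! ### Decomposition of the trilinear form into cells -/

instance isAddHaarMeasure_prod : (volume : Measure (Eu n × Eu n)).IsAddHaarMeasure :=
  Measure.prod.instIsAddHaarMeasure (volume : Measure (Eu n)) (volume : Measure (Eu n))

instance isAddHaarMeasure_prod₃ : (volume : Measure (Eu n × Eu n × Eu n)).IsAddHaarMeasure :=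
  Measure.prod.instIsAddHaarMeasure (volume : Measure (Eu n)) (volume : Measure (Eu n × Eu n))

instance isNegInvariant_prod₃ : (volume : Measure (Eu n × Eu n × Eu n)).IsNegInvariant := by
  have h := Measure.measurePreserving_neg (volume : Measure (Eu n))
  exact ⟨(h.prod (h.prod h)).map_eq⟩

theorem schwartz_bdd (f : 𝓢(Eu n, ℂ)) : ∃ C : ℝ, ∀ x, ‖f x‖ ≤ C := ⟨_, f.norm_le_seminorm ℝ⟩

theorem fourierInv_ee_shift (D : 𝓢(Eu n, ℂ)) (c x : Eu n) :
    𝓕⁻ (trS c D : Eu n → ℂ) x = ee (inner ℝ c x) * (𝓕⁻ D : 𝓢(Eu n, ℂ)) x := by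
  have : (trS c D : Eu n → ℂ) = fun t => D (t - c) := rfl
  rw [this, fourierInv_comp_sub, ← SchwartzMap.fourierInv_coe]

theorem schwartz_fourierInv_sub (a b : 𝓢(Eu n, ℂ)) :
    (𝓕⁻ (a - b) : 𝓢(Eu n, ℂ)) = 𝓕⁻ a - 𝓕⁻ b := by
  simpa using map_sub (FourierTransform.fourierInvCLM ℂ 𝓢(Eu n, ℂ)) a b

/-- In a cell only the frequencies of `h` close to `-(ν + μ)` matter. -/
theorem cellInt_project (W : Windows n) {v : Eu n × Eu n × Eu n → ℂ} {K₀ M : ℝ}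
    (hvc : Continuous v) (hvb : ∀ z, ‖v z‖ ≤ M)
    (h0 : ∀ ξ η, BandLimited (fun x => v (x, ξ, η)) K₀) {χ₀ : 𝓢(Eu n, ℂ)}
    (hχ₀ : ∀ ζ, ‖ζ‖ ≤ K₀ + 4 → χ₀ ζ = 1) (f g h : 𝓢(Eu n, ℂ)) (z₀ : Eu n × Eu n × Eu n) :
    cellInt W v f g h z₀ = cellInt W v f g (wp χ₀ h (-(z₀.2.1 + z₀.2.2))) z₀ := by
  obtain ⟨x₀, ν, μ⟩ := z₀
  obtain ⟨M1, hM1⟩ := schwartz_bdd h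
  obtain ⟨M2, hM2⟩ := schwartz_bdd (wp χ₀ h (-(ν + μ)))
  have i1 := integrable_cell_integrand W hvc hvb f g h.continuous hM1 (x₀, ν, μ)
  have i2 := integrable_cell_integrand W hvc hvb f g (wp χ₀ h (-(ν + μ))).continuous hM2 (x₀, ν, μ)
  have i3 : Integrable (fun z => v z * wave f g h z * W.cell (z - (x₀, ν, μ)) -
      v z * wave f g (wp χ₀ h (-(ν + μ))) z * W.cell (z - (x₀, ν, μ))) := i1.sub i2
  rw [← sub_eq_zero, cellInt, cellInt, ← integral_sub i1 i2, Measure.volume_eq_prod,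
    integral_prod_symm _ i3]
  refine integral_eq_zero_of_ae (Filter.Eventually.of_forall fun p => ?_)
  obtain ⟨ξ, η⟩ := p
  simp only [Pi.zero_apply]
  by_cases hξ : 1 < ‖ξ - ν‖
  · refine integral_eq_zero_of_ae (Filter.Eventually.of_forall fun x => ?_)
    simp [Windows.cell, W.κ_supp _ hξ]
  by_cases hη : 1 < ‖η - μ‖
  · refine integral_eq_zero_of_ae (Filter.Eventually.of_forall fun x => ?_)
    simp [Windows.cell, W.κ_supp _ hη]
  push Not at hξ hη
  -- D is the part of the transform of h away from -(ν + μ); it has to be shown invisible to the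
  -- x-integral.
  set D : 𝓢(Eu n, ℂ) := 𝓕 h - mulS (𝓕 h) (trS (-(ν + μ)) χ₀) with hD
  have hD' : (𝓕⁻ D : 𝓢(Eu n, ℂ)) = h - wp χ₀ h (-(ν + μ)) := by
    rw [hD, schwartz_fourierInv_sub, wp]; simp
  set S : Eu n → ℂ := fun x => W.θ (x - x₀) * W.κ₀ (x - x₀) with hS
  have hSi : Integrable S := integrable_mul_schwartz (trS x₀ W.θ) (trS x₀ W.κ₀)
  have e : ∀ x, v (x, ξ, η) * wave f g h (x, ξ, η) * W.cell ((x, ξ, η) - (x₀, ν, μ)) -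
      v (x, ξ, η) * wave f g (wp χ₀ h (-(ν + μ))) (x, ξ, η) * W.cell ((x, ξ, η) - (x₀, ν, μ)) =
      (𝓕 f ξ * 𝓕 g η * ((W.θ (ξ - ν) * W.κ (ξ - ν)) * (W.θ (η - μ) * W.κ (η - μ)))) *
        (v (x, ξ, η) * (S x * 𝓕⁻ (trS (ξ + η) D : Eu n → ℂ) x)) := fun x => by
    rw [fourierInv_ee_shift, hD', inner_add_left, ee_add]
    simp only [wave, Windows.cell, hS, _root_.sub_apply, Prod.fst_sub, Prod.snd_sub]
    ring
  simp_rw [e]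
  rw [integral_const_mul, h0 ξ η, mul_zero]
  · have : Integrable fun x => S x * (𝓕⁻ (trS (ξ + η) D) : 𝓢(Eu n, ℂ)) x :=
      (integrable_mul_schwartz (mulS (trS x₀ W.θ) (trS x₀ W.κ₀)) (𝓕⁻ (trS (ξ + η) D))).congr
        (Filter.Eventually.of_forall fun x => by simp [hS])
    rw [SchwartzMap.fourierInv_coe] at this
    exact this
  · intro ζ hζ
    refine fourier_mul_fourierInv_eq_zero (r := 2) hSi (trS _ D).integrable (fun a ha => ?_)
      (fun a ha => ?_) hζ
    · rw [hS, fourier_comp_sub (fun x => W.θ x * W.κ₀ x), W.hat_κ₀ a ha, mul_zero]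
    -- The 4 is 2 + 1 + 1: the spectral radius of θκ₀ in x and the radii of the windows κ around ν
    -- and μ.
    · have : ‖a - (ξ + η) - -(ν + μ)‖ ≤ K₀ + 4 := by
        have : a - (ξ + η) - -(ν + μ) = a - (ξ - ν) - (η - μ) := by abel
        rw [this]
        have h1 := norm_sub_le (a - (ξ - ν)) (η - μ)
        have h2 := norm_sub_le a (ξ - ν)
        linarith
      simp only [trS_apply, hD, _root_.sub_apply, mulS_apply, hχ₀ _ this, mul_one, sub_self]

theorem integral_cell (W : Windows n) : ∫ z, W.cell z = 1 := by
  have : ∫ z : Eu n × Eu n × Eu n, (fun x => W.θ x * W.κ₀ x) z.1 * (fun p : Eu n × Eu n =>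
      (W.θ p.1 * W.κ p.1) * (W.θ p.2 * W.κ p.2)) z.2 = 1 := by
    rw [Measure.volume_eq_prod, integral_prod_mul (fun x => W.θ x * W.κ₀ x) (fun p : Eu n × Eu n =>
      (W.θ p.1 * W.κ p.1) * (W.θ p.2 * W.κ p.2)), W.integral_κ₀, Measure.volume_eq_prod,
      integral_prod_mul (fun x => W.θ x * W.κ x) (fun x => W.θ x * W.κ x), W.integral_κ]
    simp
  exact this

theorem integrable_cell (W : Windows n) : Integrable W.cell :=
  (integrable_mul_schwartz W.θ W.κ₀).mul_prod ((integrable_mul_schwartz W.θ W.κ).mul_prod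
    (integrable_mul_schwartz W.θ W.κ))

theorem integrable_lam_integrand {v : Eu n × Eu n × Eu n → ℂ} {M : ℝ}
    (hvm : AEStronglyMeasurable v) (hvb : ∀ z, ‖v z‖ ≤ M) (f g h : 𝓢(Eu n, ℂ)) :
    Integrable (fun z => v z * wave f g h z) := by
  have h1 : Integrable (fun z : Eu n × Eu n × Eu n => h z.1 * (𝓕 f z.2.1 * 𝓕 g z.2.2)) :=
    h.integrable.mul_prod ((𝓕 f).integrable.mul_prod (𝓕 g).integrable)
  have h2 : Continuous (fun z : Eu n × Eu n × Eu n =>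
      (ee (inner ℝ z.2.1 z.1) * ee (inner ℝ z.2.2 z.1))) := by
    have := continuous_ee
    fun_prop
  refine (h1.bdd_mul (c := M) (hvm.mul h2.aestronglyMeasurable)
    (Filter.Eventually.of_forall fun z => ?_)).congr (Filter.Eventually.of_forall fun z => ?_)
  · simpa [norm_mul, norm_ee] using hvb z
  · simp only [wave, Pi.mul_apply]; ring

/-- The cell window has integral 1, so its translates form a continuous partition of unity and
Fubini gives the decomposition. -/
theorem enorm_lam_le_lintegral_cellInt (W : Windows n) {v : Eu n × Eu n × Eu n → ℂ} {M : ℝ}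
    (hvm : AEStronglyMeasurable v) (hvb : ∀ z, ‖v z‖ ≤ M) (f g h : 𝓢(Eu n, ℂ)) :
    ‖lam v f g h‖ₑ ≤ ∫⁻ z₀, ‖cellInt W v f g h z₀‖ₑ := by
  have hu := integrable_lam_integrand hvm hvb f g h
  set u := fun z => v z * wave f g h z with hu'
  have hi : Integrable (fun q : (Eu n × Eu n × Eu n) × (Eu n × Eu n × Eu n) =>
      u q.2 * W.cell (q.2 - q.1)) (volume.prod volume) := by
    have h1 := hu.convolution_integrand (ContinuousLinearMap.mul ℂ ℂ) (integrable_cell W).comp_neg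
    refine h1.congr (Filter.Eventually.of_forall fun q => ?_)
    simp
  have : lam v f g h = ∫ z₀, cellInt W v f g h z₀ := by
    have h1 : ∀ z₀, cellInt W v f g h z₀ = ∫ z, u z * W.cell (z - z₀) := fun z₀ => by rw [cellInt]
    simp_rw [h1]
    rw [integral_integral_swap hi]
    simp_rw [integral_const_mul]
    simp_rw [integral_sub_left_eq_self W.cell, integral_cell, mul_one]
    rw [lam]
  rw [this]
  exact enorm_integral_le_lintegral_enorm _

/-- Symbols whose spectrum lies in a product of balls and whose local sizes are at most `N`. -/
structure IsLocalSymbol (W : Windows n) (v : Eu n × Eu n × Eu n → ℂ) (K₀ K₁ K₂ : ℝ)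
    (N : ℝ≥0∞) : Prop where
  continuous : Continuous v
  bounded : ∃ M : ℝ, ∀ z, ‖v z‖ ≤ M
  band₀ : ∀ ξ η, BandLimited (fun x => v (x, ξ, η)) K₀
  band₁ : ∀ x η, BandLimited (fun ξ => v (x, ξ, η)) K₁
  band₂ : ∀ x ξ, BandLimited (fun η => v (x, ξ, η)) K₂
  locN_le : ∀ z₀, locN W v z₀ ≤ N

theorem lintegral_prod₃ {F : Eu n × Eu n × Eu n → ℝ≥0∞} (hF : Measurable F) :
    ∫⁻ z, F z = ∫⁻ x, ∫⁻ ν, ∫⁻ μ, F (x, ν, μ) := by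
  rw [Measure.volume_eq_prod, lintegral_prod _ hF.aemeasurable]
  refine lintegral_congr fun x => ?_
  have h : Measurable fun p : Eu n × Eu n => F (x, p) := hF.comp measurable_prodMk_left
  rw [Measure.volume_eq_prod, lintegral_prod _ h.aemeasurable]

theorem dilS_eq_one {φ : 𝓢(Eu n, ℂ)} (hφ : IsLPGenerator φ) {s : ℝ} (hs : 0 < s) {ζ : Eu n}
    (h : ‖ζ‖ ≤ s) : dilS s hs φ ζ = 1 := by
  rw [dilS_apply]
  refine hφ.eq_one _ ?_
  rw [norm_smul, norm_inv, Real.norm_of_nonneg hs.le, inv_mul_le_iff₀ hs]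
  simpa using h

theorem IsLPGenerator.eq_zero {F : Type*} [NormedAddCommGroup F] [NormedSpace ℝ F]
    {φ : SchwartzMap F ℂ} (hφ : IsLPGenerator φ) {ζ : F} (h : 2 < ‖ζ‖) : φ ζ = 0 := by
  by_contra h0
  have := hφ.support_subset (subset_tsupport _ h0)
  rw [mem_closedBall_zero_iff] at this
  linarith

theorem dilS_eq_zero {φ : 𝓢(Eu n, ℂ)} (hφ : IsLPGenerator φ) {s : ℝ} (hs : 0 < s) {ζ : Eu n}
    (h : 2 * s < ‖ζ‖) : dilS s hs φ ζ = 0 := by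
  rw [dilS_apply]
  refine hφ.eq_zero ?_
  rw [norm_smul, norm_inv, Real.norm_of_nonneg hs.le, lt_inv_mul_iff₀ hs]
  linarith

theorem IsLocalSymbol.enorm_cellInt_le {W : Windows n} {v : Eu n × Eu n × Eu n → ℂ}
    {K₀ K₁ K₂ : ℝ} {N : ℝ≥0∞} (S : IsLocalSymbol W v K₀ K₁ K₂ N) (hK₁ : 1 ≤ K₁) (hK₂ : 1 ≤ K₂)
    {φ : 𝓢(Eu n, ℂ)} (hφ : IsLPGenerator φ) {c : ℝ} (hc : ∀ ζ, ‖φ ζ‖ ≤ c) (f g h : 𝓢(Eu n, ℂ))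
    (z₀ : Eu n × Eu n × Eu n) :
    ‖cellInt W v f g h z₀‖ₑ ≤ (ENNReal.ofReal c ^ 2 * ENNReal.ofReal 5 ^ (n + 1)) * N *
      (locF W.κ f K₁ z₀.1 z₀.2.1 * (locF W.κ g K₂ z₀.1 z₀.2.2 * locH W h z₀.1)) := by
  obtain ⟨M, hM⟩ := S.bounded
  obtain ⟨Mh, hMh⟩ := schwartz_bdd h
  have h1 : 0 < 2 * K₁ := by linarith
  have h2 : 0 < 2 * K₂ := by linarith
  rw [← mul_assoc (locF _ _ _ _ _)]
  -- The cut-offs φ(·/(2K)) equal 1 up to 2K ≥ K + 1, because K ≥ 1, and vanish beyond 4K.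
  refine (BilinearPsiDO.enorm_cellInt_le W hK₁ hK₂ S.continuous hM S.band₁ S.band₂
    (χ₁ := dilS (2 * K₁) h1 φ) (χ₂ := dilS (2 * K₂) h2 φ) (c := c)
    (fun ζ hζ => dilS_eq_one hφ h1 (by linarith)) (fun ζ hζ => dilS_eq_zero hφ h1 (by linarith))
    (fun ζ => hc _)
    (fun ζ hζ => dilS_eq_one hφ h2 (by linarith)) (fun ζ hζ => dilS_eq_zero hφ h2 (by linarith))
    (fun ζ => hc _) f g h.continuous hMh z₀).trans ?_
  gcongr
  exact S.locN_le z₀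

theorem locF_eq_zero {κ f : 𝓢(Eu n, ℂ)} {K : ℝ} {x₀ ν : Eu n} (h : wp κ f ν = 0) :
    locF κ f K x₀ ν = 0 := by
  simp [locF, h]

theorem locH_zero (W : Windows n) (x₀ : Eu n) : locH W (0 : 𝓢(Eu n, ℂ)) x₀ = 0 := by
  simp [locH]

theorem volume_closedBall_le {r s : ℝ} (hr : 0 ≤ r) (hs : 0 ≤ s) :
    volume (Metric.closedBall (0 : Eu n) (s * r)) =
      ENNReal.ofReal r ^ n * volume (Metric.closedBall (0 : Eu n) s) := by
  rw [mul_comm, Measure.addHaar_closedBall_mul volume (0 : Eu n) hr hs,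
    finrank_euclideanSpace_fin, ENNReal.ofReal_pow hr]

theorem measurable_locF_right (κ f : 𝓢(Eu n, ℂ)) (K : ℝ) (x₀ : Eu n) :
    Measurable fun ν => locF κ f K x₀ ν := (measurable_locF κ f K).comp measurable_prodMk_left

/-- Packets of f vanish unless ‖ν‖ ≤ r + 1 ≤ 2r, so Cauchy-Schwarz over that ball costs r^(n/2). -/
theorem lintegral_locF_le {κ f : 𝓢(Eu n, ℂ)} {r : ℝ} (hr : 1 ≤ r)
    (hκ : ∀ x, 1 < ‖x‖ → κ x = 0) (hf : ∀ ξ, r < ‖ξ‖ → 𝓕 f ξ = 0) (K : ℝ) (x₀ : Eu n) :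
    ∫⁻ ν, locF κ f K x₀ ν ≤ (ENNReal.ofReal r ^ n) ^ (1 / 2 : ℝ) *
      (volume (Metric.closedBall (0 : Eu n) 2) ^ (1 / 2 : ℝ) *
        (∫⁻ ν, locF κ f K x₀ ν ^ 2) ^ (1 / 2 : ℝ)) := by
  refine (lintegral_le_of_support (measurable_locF_right κ f K x₀)
    (A := Metric.closedBall 0 (2 * r)) Metric.isClosed_closedBall.measurableSet
    fun ν hν => locF_eq_zero (wp_eq_zero hf hκ ?_)).trans (le_of_eq ?_)
  · rw [mem_closedBall_zero_iff, not_le] at hν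
    linarith
  · rw [volume_closedBall_le (by linarith) (by norm_num), sqrt_mul_ennreal, mul_assoc]

/-! ### Estimates at a single scale -/

/-- The estimate at a single scale with frequency restrictions on `f` and `g` only. -/
theorem exists_enorm_lam_le (W : Windows n) {φ : 𝓢(Eu n, ℂ)} (hφ : IsLPGenerator φ) :
    ∃ C : ℝ≥0∞, C ≠ ∞ ∧ ∀ (v : Eu n × Eu n × Eu n → ℂ) (K₀ K₁ K₂ r₁ r₂ : ℝ) (N B : ℝ≥0∞)
      (f g h : 𝓢(Eu n, ℂ)), IsLocalSymbol W v K₀ K₁ K₂ N → 1 ≤ K₁ → 1 ≤ K₂ → 1 ≤ r₁ → 1 ≤ r₂ →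
      (∀ ξ, r₁ < ‖ξ‖ → 𝓕 f ξ = 0) → (∀ ξ, r₂ < ‖ξ‖ → 𝓕 g ξ = 0) → (∀ x, ‖g x‖ₑ ≤ B) →
      ‖lam v f g h‖ₑ ≤ C * (N * ((ENNReal.ofReal K₁ ^ n) ^ (1 / 2 : ℝ) *
        (ENNReal.ofReal K₂ ^ n) ^ (1 / 2 : ℝ)) * ((ENNReal.ofReal r₁ ^ n) ^ (1 / 2 : ℝ) *
        (ENNReal.ofReal r₂ ^ n) ^ (1 / 2 : ℝ)) * (nrm2 f * B * nrm2 h)) := by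
  obtain ⟨c, hc⟩ := schwartz_bdd φ
  set A := ENNReal.ofReal c ^ 2 * ENNReal.ofReal 5 ^ (n + 1) with hA
  set w := (∫⁻ y : Eu n, wt 1 y) ^ (1 / 2 : ℝ) with hw
  set V := volume (Metric.closedBall (0 : Eu n) 2) ^ (1 / 2 : ℝ) with hV
  set P := (∫⁻ x, posWt W x) ^ (1 / 2 : ℝ) with hP
  have hw' : w ≠ ∞ := ENNReal.rpow_ne_top_of_nonneg (by norm_num) lintegral_wt_one_lt_top.ne
  have hV' : V ≠ ∞ := ENNReal.rpow_ne_top_of_nonneg (by norm_num) measure_closedBall_lt_top.ne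
  have hP' : P ≠ ∞ := ENNReal.rpow_ne_top_of_nonneg (by norm_num) (lintegral_posWt_lt_top W).ne
  have hk := nrm2_schwartz_ne_top W.κ
  refine ⟨A * (V * V) * (w * w) * P * nrm2 W.κ ^ 2, by finiteness, ?_⟩
  intro v K₀ K₁ K₂ r₁ r₂ N B f g h S hK₁ hK₂ hr₁ hr₂ hf hg hB
  obtain ⟨M, hM⟩ := S.bounded
  have hF := measurable_locF W.κ f K₁
  have hG := measurable_locF W.κ g K₂
  have hH := measurable_locH W h.continuous
  have m1 : Measurable fun z : Eu n × Eu n × Eu n => locF W.κ f K₁ z.1 z.2.1 :=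
    hF.comp (by fun_prop : Measurable fun z : Eu n × Eu n × Eu n => (z.1, z.2.1))
  have m2 : Measurable fun z : Eu n × Eu n × Eu n => locF W.κ g K₂ z.1 z.2.2 :=
    hG.comp (by fun_prop : Measurable fun z : Eu n × Eu n × Eu n => (z.1, z.2.2))
  have m3 : Measurable fun z : Eu n × Eu n × Eu n => locH W h z.1 := hH.comp measurable_fst
  refine (enorm_lam_le_lintegral_cellInt W S.continuous.aestronglyMeasurable hM f g h).trans ?_
  refine (lintegral_mono fun z₀ => S.enorm_cellInt_le hK₁ hK₂ hφ hc f g h z₀).trans ?_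
  refine (lintegral_const_mul _ (m1.mul (m2.mul m3))).le.trans ?_
  have e := lintegral_prod₃ (m1.mul (m2.mul m3))
  simp only [Pi.mul_apply] at e
  refine (mul_le_mul_right e.le _).trans ?_
  have bG : ∀ x₀, (∫⁻ ν, locF W.κ g K₂ x₀ ν ^ 2) ^ (1 / 2 : ℝ) ≤
      B * nrm2 W.κ * ((ENNReal.ofReal K₂ ^ n) ^ (1 / 2 : ℝ) * w) := fun x₀ => by
    refine (sqrt_le_sqrt_ennreal (lintegral_locF_sq_le W.κ g (by linarith) hB x₀)).trans (le_of_eq ?_)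
    rw [sqrt_mul_ennreal, sqrt_mul_ennreal, sqrt_mul_ennreal, sq_sqrt_ennreal, sq_sqrt_ennreal]
  -- The size of h does not depend on ν, μ here, so the two frequency integrals separate. Both
  -- supports are paid for, but K₀ does not occur.
  have inner : ∀ x₀, ∫⁻ ν, ∫⁻ μ, locF W.κ f K₁ x₀ ν * (locF W.κ g K₂ x₀ μ * locH W h x₀) ≤
      (((ENNReal.ofReal r₁ ^ n) ^ (1 / 2 : ℝ) * V) * ((ENNReal.ofReal r₂ ^ n) ^ (1 / 2 : ℝ) * V) *
        (B * nrm2 W.κ * ((ENNReal.ofReal K₂ ^ n) ^ (1 / 2 : ℝ) * w))) *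
      ((∫⁻ ν, locF W.κ f K₁ x₀ ν ^ 2) ^ (1 / 2 : ℝ) * locH W h x₀) := fun x₀ => by
    have h1 : ∀ ν, ∫⁻ μ, locF W.κ f K₁ x₀ ν * (locF W.κ g K₂ x₀ μ * locH W h x₀) =
        locF W.κ f K₁ x₀ ν * ((∫⁻ μ, locF W.κ g K₂ x₀ μ) * locH W h x₀) := fun ν => by
      have mg := measurable_locF_right W.κ g K₂ x₀
      have mg' : Measurable fun μ => locF W.κ g K₂ x₀ μ * locH W h x₀ := mg.mul_const _
      refine (lintegral_const_mul _ mg').trans ?_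
      rw [lintegral_mul_const _ mg]
    simp_rw [h1]
    rw [lintegral_mul_const _ (measurable_locF_right W.κ f K₁ x₀)]
    calc _ ≤ ((ENNReal.ofReal r₁ ^ n) ^ (1 / 2 : ℝ) *
          (V * (∫⁻ ν, locF W.κ f K₁ x₀ ν ^ 2) ^ (1 / 2 : ℝ))) *
          (((ENNReal.ofReal r₂ ^ n) ^ (1 / 2 : ℝ) *
          (V * (B * nrm2 W.κ * ((ENNReal.ofReal K₂ ^ n) ^ (1 / 2 : ℝ) * w)))) * locH W h x₀) := by
          refine mul_le_mul' (lintegral_locF_le hr₁ W.κ_supp hf K₁ x₀) (mul_le_mul' ?_ le_rfl)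
          refine (lintegral_locF_le hr₂ W.κ_supp hg K₂ x₀).trans ?_
          gcongr
          exact bG x₀
      _ = _ := by ring
  have mF : Measurable fun x₀ => (∫⁻ ν, locF W.κ f K₁ x₀ ν ^ 2) ^ (1 / 2 : ℝ) :=
    (hF.pow_const 2).lintegral_prod_right'.pow_const _
  have outer := lintegral_mul_le_sqrt_mul_sqrt (m := (volume : Measure (Eu n)))
    mF.aemeasurable hH.aemeasurable
  simp_rw [sqrt_sq_ennreal] at outer
  rw [lintegral_lintegral_locF_sq W.κ f (by linarith), lintegral_locH_sq W h.continuous,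
    sqrt_mul_ennreal, sqrt_mul_ennreal, sqrt_mul_ennreal, sqrt_mul_ennreal, sq_sqrt_ennreal,
    sq_sqrt_ennreal, sq_sqrt_ennreal] at outer
  refine (mul_le_mul_right ((lintegral_mono inner).trans
    ((lintegral_const_mul _ (mF.mul hH)).le.trans (mul_le_mul_right outer _))) _).trans
    (le_of_eq ?_)
  ring

/-- A minimum of three numbers is at most their geometric mean. The symmetric form yields a growing
geometric factor in each of the three dyadic indices at once. -/
theorem le_geom_mean {X a b c : ℝ≥0∞} {T : ℝ≥0∞} (ha : T ≤ a ^ (1 / 2 : ℝ) * X)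
    (hb : T ≤ b ^ (1 / 2 : ℝ) * X) (hc : T ≤ c ^ (1 / 2 : ℝ) * X) :
    T ≤ (a * b * c) ^ (1 / 6 : ℝ) * X := by
  have h3 : T ^ (3 : ℝ) ≤ (a * b * c) ^ (1 / 2 : ℝ) * X ^ (3 : ℝ) := by
    have : T * T * T ≤ _ := mul_le_mul' (mul_le_mul' ha hb) hc
    rw [sqrt_mul_ennreal, sqrt_mul_ennreal]
    refine le_trans (le_of_eq ?_) (this.trans (le_of_eq ?_))
    · norm_cast; ring
    · norm_cast; ring
  have := ENNReal.rpow_le_rpow h3 (by norm_num : (0 : ℝ) ≤ 1 / 3)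
  rw [ENNReal.mul_rpow_of_nonneg _ _ (by norm_num), ← ENNReal.rpow_mul, ← ENNReal.rpow_mul,
    ← ENNReal.rpow_mul] at this
  norm_num at this
  norm_num
  exact this


/-- The estimate at a single scale with frequency restrictions on `f`, `g` and `h`. -/
theorem exists_enorm_lam_le_of_support (W : Windows n) {φ : 𝓢(Eu n, ℂ)} (hφ : IsLPGenerator φ) :
    ∃ C : ℝ≥0∞, C ≠ ∞ ∧ ∀ (v : Eu n × Eu n × Eu n → ℂ) (K₀ K₁ K₂ r₀ r₁ r₂ : ℝ) (N B : ℝ≥0∞)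
      (f g h : 𝓢(Eu n, ℂ)), IsLocalSymbol W v K₀ K₁ K₂ N → 1 ≤ K₀ → 1 ≤ K₁ → 1 ≤ K₂ →
      1 ≤ r₁ → 1 ≤ r₂ → K₀ ≤ r₀ → (∀ ξ, r₁ < ‖ξ‖ → 𝓕 f ξ = 0) → (∀ ξ, r₂ < ‖ξ‖ → 𝓕 g ξ = 0) →
      (∀ ξ, r₀ < ‖ξ‖ → 𝓕 h ξ = 0) → (∀ x, ‖g x‖ₑ ≤ B) →
      ‖lam v f g h‖ₑ ≤ C * (N * ((ENNReal.ofReal K₀ ^ n) ^ (1 / 2 : ℝ) *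
        (ENNReal.ofReal K₁ ^ n) ^ (1 / 2 : ℝ) * (ENNReal.ofReal K₂ ^ n) ^ (1 / 2 : ℝ)) *
        (ENNReal.ofReal r₁ ^ n * ENNReal.ofReal r₂ ^ n * ENNReal.ofReal r₀ ^ n) ^ (1 / 6 : ℝ) *
        (nrm2 f * B * nrm2 h)) := by
  obtain ⟨c, hc⟩ := schwartz_bdd φ
  set A := ENNReal.ofReal c ^ 2 * ENNReal.ofReal 5 ^ (n + 1) with hA
  set w := (∫⁻ y : Eu n, wt 1 y) ^ (1 / 2 : ℝ) with hw
  set V := volume (Metric.closedBall (0 : Eu n) 11) with hV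
  set P := (∫⁻ x, posWt W x) ^ (1 / 2 : ℝ) with hP
  have hw' : w ≠ ∞ := ENNReal.rpow_ne_top_of_nonneg (by norm_num) lintegral_wt_one_lt_top.ne
  have hV' : V ≠ ∞ := measure_closedBall_lt_top.ne
  have hV'' : (V ^ 3) ^ (1 / 6 : ℝ) ≠ ∞ :=
    ENNReal.rpow_ne_top_of_nonneg (by norm_num) (by finiteness)
  have hP' : P ≠ ∞ := ENNReal.rpow_ne_top_of_nonneg (by norm_num) (lintegral_posWt_lt_top W).ne
  have hk := nrm2_schwartz_ne_top W.κ
  have hφ2 := nrm2_schwartz_ne_top φ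
  have h5 : (ENNReal.ofReal 5 ^ n) ^ (1 / 2 : ℝ) ≠ ∞ :=
    ENNReal.rpow_ne_top_of_nonneg (by norm_num) (by finiteness)
  refine ⟨A * (V ^ 3) ^ (1 / 6 : ℝ) * (w * w) * P * nrm2 W.κ ^ 2 * nrm2 φ *
    (ENNReal.ofReal 5 ^ n) ^ (1 / 2 : ℝ), by finiteness, ?_⟩
  intro v K₀ K₁ K₂ r₀ r₁ r₂ N B f g h S hK₀ hK₁ hK₂ hr₁ hr₂ hr₀ hf hg hh hB
  obtain ⟨M, hM⟩ := S.bounded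
  have hK5 : 0 < 5 * K₀ := by linarith
  -- Since K₀ ≥ 1, the cut-off equals 1 up to 5K₀ ≥ K₀ + 4, as the projection of h requires.
  set χ := dilS (5 * K₀) hK5 φ with hχ
  have hF := measurable_locF W.κ f K₁
  have hG := measurable_locF W.κ g K₂
  have hH := measurable_locH_wp W χ h
  have m1 : Measurable fun z : Eu n × Eu n × Eu n => locF W.κ f K₁ z.1 z.2.1 :=
    hF.comp (by fun_prop : Measurable fun z : Eu n × Eu n × Eu n => (z.1, z.2.1))
  have m2 : Measurable fun z : Eu n × Eu n × Eu n => locF W.κ g K₂ z.1 z.2.2 :=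
    hG.comp (by fun_prop : Measurable fun z : Eu n × Eu n × Eu n => (z.1, z.2.2))
  have m3 : Measurable fun z : Eu n × Eu n × Eu n => locH W (wp χ h (-(z.2.1 + z.2.2))) z.1 :=
    hH.comp (by fun_prop : Measurable fun z : Eu n × Eu n × Eu n => (z.1, z.2.1 + z.2.2))
  refine (enorm_lam_le_lintegral_cellInt W S.continuous.aestronglyMeasurable hM f g h).trans ?_
  have hcell : ∀ z₀ : Eu n × Eu n × Eu n, ‖cellInt W v f g h z₀‖ₑ ≤ A * N *
      (locF W.κ f K₁ z₀.1 z₀.2.1 * (locF W.κ g K₂ z₀.1 z₀.2.2 *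
        locH W (wp χ h (-(z₀.2.1 + z₀.2.2))) z₀.1)) := fun z₀ => by
    rw [cellInt_project W S.continuous hM S.band₀ (χ₀ := χ)
      (fun ζ hζ => dilS_eq_one hφ hK5 (by linarith)) f g h z₀]
    exact S.enorm_cellInt_le hK₁ hK₂ hφ hc f g _ z₀
  refine (lintegral_mono hcell).trans ?_
  refine (lintegral_const_mul _ (m1.mul (m2.mul m3))).le.trans ?_
  have e := lintegral_prod₃ (m1.mul (m2.mul m3))
  simp only [Pi.mul_apply] at e
  refine (mul_le_mul_right e.le _).trans ?_
  have bG : ∀ x₀, (∫⁻ ν, locF W.κ g K₂ x₀ ν ^ 2) ^ (1 / 2 : ℝ) ≤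
      B * nrm2 W.κ * ((ENNReal.ofReal K₂ ^ n) ^ (1 / 2 : ℝ) * w) := fun x₀ => by
    refine (sqrt_le_sqrt_ennreal (lintegral_locF_sq_le W.κ g (by linarith) hB x₀)).trans (le_of_eq ?_)
    rw [sqrt_mul_ennreal, sqrt_mul_ennreal, sqrt_mul_ennreal, sq_sqrt_ennreal, sq_sqrt_ennreal]
  set R := (ENNReal.ofReal r₁ ^ n * ENNReal.ofReal r₂ ^ n * ENNReal.ofReal r₀ ^ n) ^ (1 / 6 : ℝ)
    with hR
  have inner : ∀ x₀, ∫⁻ ν, ∫⁻ μ, locF W.κ f K₁ x₀ ν * (locF W.κ g K₂ x₀ μ *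
        locH W (wp χ h (-(ν + μ))) x₀) ≤
      ((R * (V ^ 3) ^ (1 / 6 : ℝ)) *
        (B * nrm2 W.κ * ((ENNReal.ofReal K₂ ^ n) ^ (1 / 2 : ℝ) * w))) *
      ((∫⁻ ν, locF W.κ f K₁ x₀ ν ^ 2) ^ (1 / 2 : ℝ) *
        (∫⁻ l, locH W (wp χ h (-l)) x₀ ^ 2) ^ (1 / 2 : ℝ)) := fun x₀ => by
    have mf := measurable_locF_right W.κ f K₁ x₀
    have mg := measurable_locF_right W.κ g K₂ x₀
    have mh : Measurable fun l => locH W (wp χ h (-l)) x₀ := hH.comp measurable_prodMk_left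
    have mb : ∀ r : ℝ, MeasurableSet (Metric.closedBall (0 : Eu n) r) := fun r =>
      Metric.isClosed_closedBall.measurableSet
    -- The factor 11 serves all three functions: the packets of f and g live in radius r + 1, those
    -- of h in radius r₀ + 10K₀ ≤ 11r₀.
    have t1 := trilinear_le_left mf mg mh (mb (11 * r₁)) fun ν hν =>
      locF_eq_zero (wp_eq_zero hf W.κ_supp (by
        rw [mem_closedBall_zero_iff, not_le] at hν
        linarith))
    have t2 := trilinear_le_middle mf mg mh (mb (11 * r₂)) fun ν hν =>
      locF_eq_zero (wp_eq_zero hg W.κ_supp (by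
        rw [mem_closedBall_zero_iff, not_le] at hν
        linarith))
    have t3 := trilinear_le_right mf mg mh (mb (11 * r₀)) fun l hl => by
      rw [wp_eq_zero (s := 2 * (5 * K₀)) hh (fun ζ hζ => dilS_eq_zero hφ hK5 hζ) (by
        rw [mem_closedBall_zero_iff, not_le] at hl
        rw [norm_neg]
        linarith), locH_zero]
    have t := le_geom_mean t1 t2 t3
    rw [volume_closedBall_le (by linarith) (by norm_num),
      volume_closedBall_le (by linarith) (by norm_num),
      volume_closedBall_le (by linarith) (by norm_num), ← hV,
      show ∀ a b c : ℝ≥0∞, a * V * (b * V) * (c * V) = (a * b * c) * V ^ 3 by intros; ring,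
      ENNReal.mul_rpow_of_nonneg _ _ (by norm_num : (0 : ℝ) ≤ 1 / 6), ← hR] at t
    refine t.trans ?_
    calc _ ≤ (R * (V ^ 3) ^ (1 / 6 : ℝ)) * ((∫⁻ ν, locF W.κ f K₁ x₀ ν ^ 2) ^ (1 / 2 : ℝ) *
          (B * nrm2 W.κ * ((ENNReal.ofReal K₂ ^ n) ^ (1 / 2 : ℝ) * w)) *
          (∫⁻ l, locH W (wp χ h (-l)) x₀ ^ 2) ^ (1 / 2 : ℝ)) := by
          gcongr
          exact bG x₀
      _ = _ := by ring
  have mF : Measurable fun x₀ => (∫⁻ ν, locF W.κ f K₁ x₀ ν ^ 2) ^ (1 / 2 : ℝ) :=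
    (hF.pow_const 2).lintegral_prod_right'.pow_const _
  have mH : Measurable fun x₀ => (∫⁻ l, locH W (wp χ h (-l)) x₀ ^ 2) ^ (1 / 2 : ℝ) :=
    (hH.pow_const 2).lintegral_prod_right'.pow_const _
  have outer := lintegral_mul_le_sqrt_mul_sqrt (m := (volume : Measure (Eu n)))
    mF.aemeasurable mH.aemeasurable
  simp_rw [sqrt_sq_ennreal] at outer
  -- The norm of the dilated cut-off χ produces (5K₀)^(n/2), the price for localizing h in
  -- frequency.
  rw [lintegral_lintegral_locF_sq W.κ f (by linarith), lintegral_lintegral_locH_wp,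
    hχ, nrm2_dilS, ENNReal.ofReal_mul (by norm_num), mul_pow,
    sqrt_mul_ennreal, sqrt_mul_ennreal, sqrt_mul_ennreal, sqrt_mul_ennreal, sqrt_mul_ennreal,
    sqrt_mul_ennreal, sqrt_mul_ennreal, sq_sqrt_ennreal,
    sq_sqrt_ennreal, sq_sqrt_ennreal, sq_sqrt_ennreal] at outer
  refine (mul_le_mul_right ((lintegral_mono inner).trans
    ((lintegral_const_mul _ (mF.mul mH)).le.trans (mul_le_mul_right outer _))) _).trans
    (le_of_eq ?_)
  ring

/-- The form vanishes if the frequencies of `h` are too large. -/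
theorem lam_eq_zero {v : Eu n × Eu n × Eu n → ℂ} {K₀ M r₁ r₂ : ℝ} (hvm : AEStronglyMeasurable v)
    (hvb : ∀ z, ‖v z‖ ≤ M) (h0 : ∀ ξ η, BandLimited (fun x => v (x, ξ, η)) K₀)
    {f g h : 𝓢(Eu n, ℂ)} (hf : ∀ ξ, r₁ < ‖ξ‖ → 𝓕 f ξ = 0) (hg : ∀ ξ, r₂ < ‖ξ‖ → 𝓕 g ξ = 0)
    (hh : ∀ ξ, ‖ξ‖ ≤ r₁ + r₂ + K₀ → 𝓕 h ξ = 0) : lam v f g h = 0 := by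
  have hi := integrable_lam_integrand hvm hvb f g h
  rw [lam, Measure.volume_eq_prod, integral_prod_symm _ hi]
  refine integral_eq_zero_of_ae (Filter.Eventually.of_forall fun p => ?_)
  obtain ⟨ξ, η⟩ := p
  simp only [Pi.zero_apply]
  by_cases hξ : r₁ < ‖ξ‖
  · refine integral_eq_zero_of_ae (Filter.Eventually.of_forall fun x => ?_)
    simp [wave, hf ξ hξ]
  by_cases hη : r₂ < ‖η‖
  · refine integral_eq_zero_of_ae (Filter.Eventually.of_forall fun x => ?_)
    simp [wave, hg η hη]
  push Not at hξ hη
  have e : ∀ x, v (x, ξ, η) * wave f g h (x, ξ, η) = (𝓕 f ξ * 𝓕 g η) *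
      (v (x, ξ, η) * (ee (inner ℝ x (ξ + η)) * h x)) := fun x => by
    rw [inner_add_right, ee_add, real_inner_comm ξ x, real_inner_comm η x]
    simp only [wave]; ring
  simp_rw [e]
  rw [integral_const_mul, h0 ξ η _ (integrable_ee_mul h.integrable (by fun_prop)), mul_zero]
  intro ζ hζ
  rw [fourier_ee_mul, ← SchwartzMap.fourier_coe]
  refine hh _ ?_
  have h1 := norm_sub_le ζ (ξ + η)
  have h2 := norm_add_le ξ η
  linarith

/-! ### Tiling by lattice cubes -/

/-- The lattice point whose unit cube contains `x`. -/
def latticeIdx (x : Eu n) : Fin n → ℤ := fun i => ⌊x i + 1 / 2⌋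

theorem measurable_latticeIdx : Measurable (latticeIdx : Eu n → Fin n → ℤ) := by
  refine measurable_pi_lambda _ fun i => Int.measurable_floor.comp ?_
  fun_prop

theorem sub_latticePt_mem_unitCube_iff (x : Eu n) (ν : Fin n → ℤ) :
    x - latticePt ν ∈ unitCube n ↔ latticeIdx x = ν := by
  rw [funext_iff]
  refine forall_congr' fun i => ?_
  simp only [latticeIdx, latticePt, PiLp.sub_apply, Int.floor_eq_iff]
  constructor <;> rintro ⟨h1, h2⟩ <;> constructor <;> linarith

theorem norm_sub_le_of_latticeIdx_eq {x y : Eu n} (h : latticeIdx x = latticeIdx y) :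
    ‖x - y‖ ≤ √n := by
  rw [EuclideanSpace.norm_eq]
  refine Real.sqrt_le_sqrt ?_
  calc ∑ i, ‖(x - y) i‖ ^ 2 ≤ ∑ _i : Fin n, (1 : ℝ) := by
        refine Finset.sum_le_sum fun i _ => ?_
        have hi : ⌊x i + 1 / 2⌋ = ⌊y i + 1 / 2⌋ := congrFun h i
        have := Int.abs_sub_lt_one_of_floor_eq_floor hi
        rw [Real.norm_eq_abs, PiLp.sub_apply, sq_le_one_iff_abs_le_one, abs_abs]
        have e : x i + 1 / 2 - (y i + 1 / 2) = x i - y i := by ring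
        rw [e] at this
        exact this.le
    _ = n := by simp

theorem volume_unitCube : volume (unitCube n) = 1 := by
  have h := (EuclideanSpace.volume_preserving_symm_measurableEquiv_toLp (Fin n)).symm
  have hs : MeasurableSet (Set.univ.pi fun _ : Fin n => Set.Ico (-(1 / 2) : ℝ) (1 / 2)) :=
    MeasurableSet.univ_pi fun _ => measurableSet_Ico
  have e : unitCube n = (MeasurableEquiv.toLp 2 (Fin n → ℝ)).symm ⁻¹'
      (Set.univ.pi fun _ : Fin n => Set.Ico (-(1 / 2) : ℝ) (1 / 2)) := by
    ext x; simp [unitCube]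
  rw [e, (EuclideanSpace.volume_preserving_symm_measurableEquiv_toLp (Fin n)).measure_preimage
    hs.nullMeasurableSet, Real.volume_pi_Ico]
  norm_num

/-- The index of the lattice cube in `(ℝⁿ)³`. -/
def latticeIdx₃ (z : Eu n × Eu n × Eu n) : (Fin n → ℤ) × (Fin n → ℤ) × (Fin n → ℤ) :=
  (latticeIdx z.1, latticeIdx z.2.1, latticeIdx z.2.2)

theorem measurable_latticeIdx₃ : Measurable (latticeIdx₃ : Eu n × Eu n × Eu n → _) :=
  (measurable_latticeIdx.comp measurable_fst).prodMk
    ((measurable_latticeIdx.comp (measurable_fst.comp measurable_snd)).prodMk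
      (measurable_latticeIdx.comp (measurable_snd.comp measurable_snd)))

theorem lintegral_eq_tsum_latticeIdx₃ (F : Eu n × Eu n × Eu n → ℝ≥0∞) :
    ∫⁻ z, F z = ∑' ν, ∫⁻ z in latticeIdx₃ ⁻¹' {ν}, F z := by
  rw [← lintegral_iUnion (fun ν => measurable_latticeIdx₃ (measurableSet_singleton ν))]
  · have : ⋃ ν, latticeIdx₃ ⁻¹' {ν} = (Set.univ : Set (Eu n × Eu n × Eu n)) := by
      ext z; simp
    rw [this, setLIntegral_univ]
  · intro ν ν' h
    exact Disjoint.preimage _ (Set.disjoint_singleton.2 h)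

theorem latticeIdx₃_preimage (ν : (Fin n → ℤ) × (Fin n → ℤ) × (Fin n → ℤ)) :
    (fun z : Eu n × Eu n × Eu n => z + (latticePt ν.1, latticePt ν.2.1, latticePt ν.2.2)) ⁻¹'
      (latticeIdx₃ ⁻¹' {ν}) = unitCube n ×ˢ unitCube n ×ˢ unitCube n := by
  ext z
  simp only [Set.mem_preimage, Set.mem_singleton_iff, latticeIdx₃, Prod.ext_iff, Set.mem_prod,
    ← sub_latticePt_mem_unitCube_iff]
  simp

theorem setLIntegral_latticeIdx₃_le (u : Eu n × Eu n × Eu n → ℂ)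
    (ν : (Fin n → ℤ) × (Fin n → ℤ) × (Fin n → ℤ)) :
    ∫⁻ z in latticeIdx₃ ⁻¹' {ν}, ‖u z‖ₑ ^ 2 ≤ l2ulNorm u ^ 2 := by
  set c : Eu n × Eu n × Eu n := (latticePt ν.1, latticePt ν.2.1, latticePt ν.2.2) with hc
  have h1 : MeasurePreserving (fun z : Eu n × Eu n × Eu n => z + c) volume volume :=
    measurePreserving_add_right volume c
  have h2 : MeasurableEmbedding (fun z : Eu n × Eu n × Eu n => z + c) :=
    measurableEmbedding_addRight c
  rw [← h1.setLIntegral_comp_preimage_emb h2, latticeIdx₃_preimage]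
  have h3 := le_iSup (fun ν : (Fin n → ℤ) × (Fin n → ℤ) × (Fin n → ℤ) =>
    (∫⁻ z in unitCube n ×ˢ unitCube n ×ˢ unitCube n,
      ‖u (z + (latticePt ν.1, latticePt ν.2.1, latticePt ν.2.2))‖ₑ ^ 2) ^ (1 / 2 : ℝ)) ν
  have h4 := pow_le_pow_left' h3 2
  rw [sqrt_sq_ennreal] at h4
  exact h4

theorem volume_latticeIdx₃ (ν : (Fin n → ℤ) × (Fin n → ℤ) × (Fin n → ℤ)) :
    volume (latticeIdx₃ ⁻¹' {ν} : Set (Eu n × Eu n × Eu n)) = 1 := by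
  set c : Eu n × Eu n × Eu n := (latticePt ν.1, latticePt ν.2.1, latticePt ν.2.2) with hc
  have h1 : MeasurePreserving (fun z : Eu n × Eu n × Eu n => z + c) volume volume :=
    measurePreserving_add_right volume c
  have h2 : MeasurableEmbedding (fun z : Eu n × Eu n × Eu n => z + c) :=
    measurableEmbedding_addRight c
  rw [← h1.measure_preimage_emb h2, latticeIdx₃_preimage, Measure.volume_eq_prod,
    Measure.prod_prod, Measure.volume_eq_prod, Measure.prod_prod, volume_unitCube]
  simp

/-- On a lattice cube, which has volume 1, a slowly varying weight is at most a constant times its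
own integral over the cube. Summing over cubes turns the uniform local bound into a weighted global
one. -/
theorem lintegral_mul_weight_le (u : Eu n × Eu n × Eu n → ℂ)
    {Ω : Eu n × Eu n × Eu n → ℝ≥0∞} {C : ℝ≥0∞} (hC : C ≠ ∞)
    (hΩi : ∫⁻ z, Ω z ≠ ∞)
    (hΩ : ∀ z z', latticeIdx₃ z = latticeIdx₃ z' → Ω z ≤ C * Ω z') :
    ∫⁻ z, ‖u z‖ₑ ^ 2 * Ω z ≤ C * (∫⁻ z, Ω z) * l2ulNorm u ^ 2 := by
  rw [lintegral_eq_tsum_latticeIdx₃, lintegral_eq_tsum_latticeIdx₃ Ω, ← ENNReal.tsum_mul_left,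
    ← ENNReal.tsum_mul_right]
  refine ENNReal.tsum_le_tsum fun ν => ?_
  have hQ : MeasurableSet (latticeIdx₃ ⁻¹' {ν} : Set (Eu n × Eu n × Eu n)) :=
    measurable_latticeIdx₃ (measurableSet_singleton ν)
  have h1 : ∀ z ∈ latticeIdx₃ ⁻¹' {ν}, Ω z ≤ C * ∫⁻ z' in latticeIdx₃ ⁻¹' {ν}, Ω z' := by
    intro z hz
    rw [← lintegral_const_mul' _ _ hC]
    calc Ω z = ∫⁻ _ in latticeIdx₃ ⁻¹' {ν}, Ω z := by
          rw [setLIntegral_const, volume_latticeIdx₃, mul_one]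
      _ ≤ _ := by
          refine setLIntegral_mono' hQ fun z' hz' => hΩ z z' ?_
          rw [Set.mem_preimage, Set.mem_singleton_iff] at hz hz'
          rw [hz, hz']
  set I := ∫⁻ z' in latticeIdx₃ ⁻¹' {ν}, Ω z'
  have hI : I ≠ ∞ := ((setLIntegral_le_lintegral _ _).trans_lt hΩi.lt_top).ne
  calc ∫⁻ z in latticeIdx₃ ⁻¹' {ν}, ‖u z‖ₑ ^ 2 * Ω z
      ≤ ∫⁻ z in latticeIdx₃ ⁻¹' {ν}, ‖u z‖ₑ ^ 2 * (C * I) :=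
        setLIntegral_mono' hQ fun z hz => mul_le_mul_right (h1 z hz) _
    _ = (∫⁻ z in latticeIdx₃ ⁻¹' {ν}, ‖u z‖ₑ ^ 2) * (C * I) :=
        lintegral_mul_const' _ _ (by finiteness)
    _ ≤ l2ulNorm u ^ 2 * (C * I) := mul_le_mul_left (setLIntegral_latticeIdx₃_le u ν) _
    _ = _ := by ring

theorem wt_le_mul_wt {K D : ℝ} (hK : 1 ≤ K) (hD : 0 ≤ D) {y y' : Eu n} (h : ‖y - y'‖ ≤ D) :
    wt K y ≤ ENNReal.ofReal ((1 + D) ^ (n + 1)) * wt K y' := by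
  rw [wt, wt, ← ENNReal.ofReal_mul (by positivity)]
  refine ENNReal.ofReal_le_ofReal ?_
  have hK0 : 0 < K := by linarith
  rw [← div_eq_mul_inv, ← one_div, div_le_div_iff₀ (by positivity) (by positivity), one_mul,
    ← mul_pow]
  refine pow_le_pow_left₀ (by positivity) ?_ _
  have h1 : ‖y'‖ ≤ ‖y‖ + D := by
    have := norm_sub_le y (y - y')
    rw [sub_sub_cancel] at this
    linarith
  have h2 : ‖y'‖ / K ≤ ‖y‖ / K + D := by
    rw [div_le_iff₀ hK0, add_mul, div_mul_cancel₀ _ hK0.ne']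
    nlinarith
  have h3 : 0 ≤ ‖y‖ / K := by positivity
  nlinarith

theorem exists_enorm_sq_le_wt (f : 𝓢(Eu n, ℂ)) : ∃ C : ℝ≥0∞, C ≠ ∞ ∧
    ∀ x, ‖f x‖ₑ ^ 2 ≤ C * wt 1 x := by
  obtain ⟨C, hC0, hC⟩ := schwartz_decay f (n + 1)
  refine ⟨ENNReal.ofReal (C ^ 2), by finiteness, fun x => ?_⟩
  rw [wt, ← ENNReal.ofReal_mul (by positivity), ← ofReal_norm, ← ENNReal.ofReal_pow (norm_nonneg _)]
  refine ENNReal.ofReal_le_ofReal ?_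
  rw [div_one, ← div_eq_mul_inv, le_div_iff₀ (by positivity)]
  have h1 : (1 : ℝ) ≤ (1 + ‖x‖) ^ (n + 1) := one_le_pow₀ (by linarith [norm_nonneg x])
  calc ‖f x‖ ^ 2 * (1 + ‖x‖) ^ (n + 1)
      ≤ (‖f x‖ ^ 2 * (1 + ‖x‖) ^ (n + 1)) * (1 + ‖x‖) ^ (n + 1) :=
        le_mul_of_one_le_right (by positivity) h1
    _ = ((1 + ‖x‖) ^ (n + 1) * ‖f x‖) ^ 2 := by ring
    _ ≤ C ^ 2 := by gcongr; exact hC x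

theorem lintegral_comp_smul_right {F : Eu n × Eu n × Eu n → ℝ≥0∞} (hF : Measurable F) {s : ℝ}
    (hs : 0 < s) : ∫⁻ z : Eu n × Eu n × Eu n, F (z.1, s⁻¹ • z.2.1, s⁻¹ • z.2.2) =
      ENNReal.ofReal s ^ n * ENNReal.ofReal s ^ n * ∫⁻ z, F z := by
  have hF' : Measurable fun z : Eu n × Eu n × Eu n => F (z.1, s⁻¹ • z.2.1, s⁻¹ • z.2.2) :=
    hF.comp (by fun_prop)
  rw [lintegral_prod₃ hF, lintegral_prod₃ hF', ← lintegral_const_mul' _ _ (by finiteness)]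
  refine lintegral_congr fun x => ?_
  rw [mul_assoc, ← lintegral_const_mul' _ _ (by finiteness),
    ← lintegral_comp_inv_smul _ hs]
  refine lintegral_congr fun ξ => ?_
  rw [← lintegral_comp_inv_smul (fun η => F (x, s⁻¹ • ξ, η)) hs]

/-- The local sizes of a rescaled function are controlled by its uniformly local norm. -/
theorem exists_locN_le (W : Windows n) : ∃ C : ℝ≥0∞, C ≠ ∞ ∧
    ∀ u : Eu n × Eu n × Eu n → ℂ, Measurable u → ∀ z₀,
      locN W (fun z => u (z.1, (2 * Real.pi) • z.2.1, (2 * Real.pi) • z.2.2)) z₀ ≤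
        C * l2ulNorm u := by
  obtain ⟨A, hA, hθ⟩ := exists_enorm_sq_le_wt W.θ
  have hπ : (0 : ℝ) < 2 * Real.pi := by positivity
  have hπ1 : (1 : ℝ) ≤ 2 * Real.pi := by linarith [Real.pi_gt_three]
  set s : ℝ := (2 * Real.pi)⁻¹ with hs
  have hs0 : 0 < s := by positivity
  set D : ℝ≥0∞ := ENNReal.ofReal ((1 + √n) ^ (n + 1)) with hD
  set I₁ := ∫⁻ y : Eu n, wt 1 y with hI₁
  set I₂ := ∫⁻ y : Eu n, wt (2 * Real.pi) y with hI₂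
  have hI₁' : I₁ ≠ ∞ := lintegral_wt_one_lt_top.ne
  have hI₂' : I₂ ≠ ∞ := by rw [hI₂, lintegral_wt hπ]; finiteness
  refine ⟨((ENNReal.ofReal s ^ n * ENNReal.ofReal s ^ n) * (A ^ 3 * (D ^ 3 * (I₁ * (I₂ * I₂))))) ^
    (1 / 2 : ℝ), ENNReal.rpow_ne_top_of_nonneg (by norm_num) (by finiteness), fun u hu z₀ => ?_⟩
  obtain ⟨x₀, ν, μ⟩ := z₀
  rw [← sq_sqrt_ennreal (l2ulNorm u), ← sqrt_mul_ennreal, locN]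
  refine sqrt_le_sqrt_ennreal ?_
  -- The frequency weights have width 2π and centres 2πν, 2πμ: undoing the scaling turns them into
  -- `wt 1` around ν and μ, multiples of which dominate |θ|².
  set Ω : Eu n × Eu n × Eu n → ℝ≥0∞ := fun z => wt 1 (z.1 - x₀) *
    (wt (2 * Real.pi) (z.2.1 - (2 * Real.pi) • ν) * wt (2 * Real.pi) (z.2.2 - (2 * Real.pi) • μ))
    with hΩ
  have w1 := measurable_wt (n := n) 1
  have w2 := measurable_wt (n := n) (2 * Real.pi)
  have hΩm : Measurable Ω := (w1.comp (by fun_prop)).mul ((w2.comp (by fun_prop)).mul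
    (w2.comp (by fun_prop)))
  have hΩi : ∫⁻ z, Ω z = I₁ * (I₂ * I₂) := by
    have h1 : Measurable fun x : Eu n => wt 1 (x - x₀) := w1.comp (by fun_prop)
    have h2 : ∀ c : Eu n, Measurable fun x : Eu n => wt (2 * Real.pi) (x - c) :=
      fun c => w2.comp (by fun_prop)
    have h3 : Measurable fun p : Eu n × Eu n => wt (2 * Real.pi) (p.1 - (2 * Real.pi) • ν) *
      wt (2 * Real.pi) (p.2 - (2 * Real.pi) • μ) :=
      ((h2 _).comp measurable_fst).mul ((h2 _).comp measurable_snd)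
    rw [Measure.volume_eq_prod, lintegral_prod_mul (f := fun x => wt 1 (x - x₀)) h1.aemeasurable
      h3.aemeasurable, Measure.volume_eq_prod,
      lintegral_prod_mul (f := fun x => wt (2 * Real.pi) (x - (2 * Real.pi) • ν))
        (g := fun x => wt (2 * Real.pi) (x - (2 * Real.pi) • μ)) (h2 _).aemeasurable
        (h2 _).aemeasurable, lintegral_sub_right_eq_self (wt 1), lintegral_sub_right_eq_self
        (wt (2 * Real.pi)), lintegral_sub_right_eq_self (wt (2 * Real.pi))]
  have hsim : ∀ z z', latticeIdx₃ z = latticeIdx₃ z' → Ω z ≤ D ^ 3 * Ω z' := by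
    intro z z' h
    simp only [latticeIdx₃, Prod.ext_iff] at h
    have hn : ∀ {a b c : Eu n}, latticeIdx a = latticeIdx b → ‖(a - c) - (b - c)‖ ≤ √n :=
      fun hab => by rw [sub_sub_sub_cancel_right]; exact norm_sub_le_of_latticeIdx_eq hab
    calc Ω z ≤ (D * _) * ((D * _) * (D * _)) := mul_le_mul'
          (wt_le_mul_wt le_rfl (by positivity) (hn h.1)) (mul_le_mul'
          (wt_le_mul_wt hπ1 (by positivity) (hn h.2.1))
          (wt_le_mul_wt hπ1 (by positivity) (hn h.2.2)))
      _ = D ^ 3 * Ω z' := by simp only [hΩ]; ring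
  have hmain := lintegral_mul_weight_le u (C := D ^ 3) (by finiteness) (by rw [hΩi]; finiteness)
    hsim
  have hm : Measurable fun z : Eu n × Eu n × Eu n => ‖u z‖ₑ ^ 2 * Ω z :=
    (hu.enorm.pow_const 2).mul hΩm
  have hsc := lintegral_comp_smul_right hm hs0
  rw [hs, inv_inv, ← hs] at hsc
  have hwt : ∀ a c : Eu n, wt (2 * Real.pi) ((2 * Real.pi) • a - (2 * Real.pi) • c) =
      wt 1 (a - c) := fun a c => by
    rw [← smul_sub, wt, wt, norm_smul, Real.norm_of_nonneg hπ.le, mul_div_cancel_left₀ _ hπ.ne',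
      div_one]
  calc _ ≤ ∫⁻ z : Eu n × Eu n × Eu n, A ^ 3 *
        (‖u (z.1, (2 * Real.pi) • z.2.1, (2 * Real.pi) • z.2.2)‖ₑ ^ 2 *
          Ω (z.1, (2 * Real.pi) • z.2.1, (2 * Real.pi) • z.2.2)) := by
        refine lintegral_mono fun z => ?_
        simp only [hΩ, hwt, mul_pow]
        calc _ ≤ ‖u (z.1, (2 * Real.pi) • z.2.1, (2 * Real.pi) • z.2.2)‖ₑ ^ 2 *
              ((A * wt 1 (z.1 - x₀)) * ((A * wt 1 (z.2.1 - ν)) * (A * wt 1 (z.2.2 - μ)))) := by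
              gcongr <;> exact hθ _
          _ = _ := by ring
    _ = A ^ 3 * (ENNReal.ofReal s ^ n * ENNReal.ofReal s ^ n * ∫⁻ z, ‖u z‖ₑ ^ 2 * Ω z) := by
        rw [lintegral_const_mul' _ _ (by finiteness), hsc]
    _ ≤ A ^ 3 * (ENNReal.ofReal s ^ n * ENNReal.ofReal s ^ n *
          (D ^ 3 * (∫⁻ z, Ω z) * l2ulNorm u ^ 2)) := by gcongr
    _ = _ := by rw [hΩi]; ring


/-! ### Convolution with tensor products -/

/-- Translations are continuous in `L¹`. -/
theorem tendsto_lintegral_enorm_translate {F : Eu n × Eu n × Eu n → ℂ} (hF : Integrable F) :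
    Tendsto (fun h => ∫⁻ z, ‖F (z + h) - F z‖ₑ) (𝓝 0) (𝓝 0) := by
  have hF1 : MemLp F 1 volume := memLp_one_iff_integrable.2 hF
  set f := hF1.toLp F with hf
  let g : Eu n × Eu n × Eu n → C(Eu n × Eu n × Eu n, Eu n × Eu n × Eu n) :=
    fun h => ⟨fun z => z + h, by fun_prop⟩
  have hg : Continuous g := by
    refine ContinuousMap.continuous_of_continuous_uncurry g ?_
    change Continuous fun p : (Eu n × Eu n × Eu n) × (Eu n × Eu n × Eu n) => p.2 + p.1
    fun_prop
  have hgm : ∀ h, MeasurePreserving (g h) volume volume := fun h =>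
    measurePreserving_add_right volume h
  have hc := ((continuous_const (y := f)).compMeasurePreservingLp hg hgm (by norm_num)).tendsto 0
  have hd := tendsto_iff_edist_tendsto_0.1 hc
  refine hd.congr fun h => ?_
  rw [Lp.edist_def, eLpNorm_one_eq_lintegral_enorm]
  refine lintegral_congr_ae ?_
  have e1 := Lp.coeFn_compMeasurePreserving f (hgm h)
  have e2 := Lp.coeFn_compMeasurePreserving f (hgm 0)
  have e3 := (hgm h).quasiMeasurePreserving.ae_eq_comp hF1.coeFn_toLp
  have e4 := (hgm 0).quasiMeasurePreserving.ae_eq_comp hF1.coeFn_toLp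
  filter_upwards [e1, e2, e3, e4] with z h1 h2 h3 h4
  rw [Pi.sub_apply, h1, h2, hf, h3, h4]
  simp [g]

/-- Tensor product of three functions. -/
def ten (a b c : Eu n → ℂ) (w : Eu n × Eu n × Eu n) : ℂ := a w.1 * b w.2.1 * c w.2.2

/-- Convolution with a tensor product. -/
def conv₃ (a b c : Eu n → ℂ) (F : Eu n × Eu n × Eu n → ℂ) (z : Eu n × Eu n × Eu n) : ℂ :=
  ∫ w, ten a b c w * F (z - w)

theorem integrable_ten {a b c : Eu n → ℂ} (ha : Integrable a) (hb : Integrable b)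
    (hc : Integrable c) : Integrable (ten a b c) := by
  refine (ha.mul_prod (hb.mul_prod hc)).congr (Eventually.of_forall fun z => ?_)
  simp only [ten, mul_assoc]

section conv

variable {a b c : Eu n → ℂ} {F : Eu n × Eu n × Eu n → ℂ} {M : ℝ}

theorem norm_conv₃_le (ha : Integrable a) (hb : Integrable b) (hc : Integrable c)
    (hM : ∀ z, ‖F z‖ ≤ M) (z : Eu n × Eu n × Eu n) :
    ‖conv₃ a b c F z‖ ≤ (∫ w, ‖ten a b c w‖) * M := by
  rw [← integral_mul_const]
  refine norm_integral_le_of_norm_le ((integrable_ten ha hb hc).norm.mul_const M)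
    (Eventually.of_forall fun w => ?_)
  rw [norm_mul]
  gcongr
  exact hM _

theorem integrable_conv₃_integrand (ha : Integrable a) (hb : Integrable b) (hc : Integrable c)
    (hF : Measurable F) (hM : ∀ z, ‖F z‖ ≤ M) (z : Eu n × Eu n × Eu n) :
    Integrable fun w => ten a b c w * F (z - w) := by
  refine (integrable_ten ha hb hc).mul_bdd (c := M) ?_ (Eventually.of_forall fun w => hM _)
  exact (hF.comp (by fun_prop)).aestronglyMeasurable

/-- F is merely bounded and measurable, so continuity comes from the L¹-continuity of translations
of the kernel. -/
theorem continuous_conv₃ (ha : Integrable a) (hb : Integrable b) (hc : Integrable c)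
    (hF : Measurable F) (hM : ∀ z, ‖F z‖ ≤ M) : Continuous (conv₃ a b c F) := by
  have hT := integrable_ten ha hb hc
  have h1 := tendsto_lintegral_enorm_translate hT
  rw [continuous_iff_continuousAt]
  intro z
  rw [ContinuousAt, tendsto_iff_edist_tendsto_0]
  have h2 : Tendsto (fun y : Eu n × Eu n × Eu n => y - z) (𝓝 z) (𝓝 0) := by
    have : ContinuousAt (fun y : Eu n × Eu n × Eu n => y - z) z := by fun_prop
    simpa [ContinuousAt] using this
  have h3 := ENNReal.Tendsto.mul_const (h1.comp h2) (b := ENNReal.ofReal M)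
    (Or.inr ENNReal.ofReal_ne_top)
  rw [zero_mul] at h3
  refine tendsto_of_tendsto_of_tendsto_of_le_of_le tendsto_const_nhds h3
    (fun _ => zero_le) fun y => ?_
  simp only [Function.comp_apply]
  have e : conv₃ a b c F y = ∫ w, ten a b c (w + (y - z)) * F (z - w) := by
    rw [conv₃, ← integral_add_right_eq_self _ (y - z)]
    congr 1; ext w
    congr 2; abel
  have hi : Integrable fun w => ten a b c (w + (y - z)) * F (z - w) := by
    refine (hT.comp_add_right (y - z)).mul_bdd (c := M) ?_ (Eventually.of_forall fun w => hM _)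
    exact (hF.comp (by fun_prop)).aestronglyMeasurable
  rw [edist_eq_enorm_sub, e, conv₃, ← integral_sub hi
    (integrable_conv₃_integrand ha hb hc hF hM z), ← lintegral_mul_const' _ _ (by finiteness)]
  refine (enorm_integral_le_lintegral_enorm _).trans (lintegral_mono fun w => ?_)
  rw [← sub_mul, enorm_mul]
  gcongr
  rw [← ofReal_norm]
  exact ENNReal.ofReal_le_ofReal (hM _)

/-- Fubini and a shift of x move the kernel variable from F to the test function w. The innermost
integral then pairs `a` with a translate of w, whose transform is a modulation of that of w and so
vanishes on the same ball. -/
theorem bandLimited_conv₃_fst {K : ℝ} (haK : BandLimited a K) (ha : Integrable a)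
    (hb : Integrable b) (hc : Integrable c)
    (hF : Measurable F) (hM : ∀ z, ‖F z‖ ≤ M) (ξ η : Eu n) :
    BandLimited (fun x => conv₃ a b c F (x, ξ, η)) K := by
  intro w hw hw0
  have hT := integrable_ten ha hb hc
  have hmeas : Measurable fun q : Eu n × (Eu n × Eu n × Eu n) => F ((q.1, ξ, η) - q.2) :=
    hF.comp (by fun_prop)
  have hi : Integrable (Function.uncurry fun (x : Eu n) (y : Eu n × Eu n × Eu n) =>
      ten a b c y * F ((x, ξ, η) - y) * w x) (volume.prod volume) := by
    refine ((hw.mul_prod hT).mul_bdd (c := M) hmeas.aestronglyMeasurable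
      (Eventually.of_forall fun q => hM _)).congr (Eventually.of_forall fun q => ?_)
    simp only [Function.uncurry]; ring
  simp_rw [conv₃, ← integral_mul_const]
  rw [integral_integral_swap hi]
  have e1 : ∀ y : Eu n × Eu n × Eu n, ∫ x, ten a b c y * F ((x, ξ, η) - y) * w x =
      ∫ x, ten a b c y * F (x, ξ - y.2.1, η - y.2.2) * w (x + y.1) := fun y => by
    rw [← integral_add_right_eq_self _ y.1]
    congr 1; ext x
    congr 3
    ext1
    · simp
    · ext1 <;> rfl
  simp_rw [e1]
  have hmeas2 : Measurable fun q : (Eu n × Eu n × Eu n) × Eu n =>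
      F (q.2, ξ - q.1.2.1, η - q.1.2.2) := hF.comp (by fun_prop)
  have hi2 : Integrable (Function.uncurry fun (y : Eu n × Eu n × Eu n) (x : Eu n) =>
      ten a b c y * F (x, ξ - y.2.1, η - y.2.2) * w (x + y.1)) (volume.prod volume) := by
    have h1 : Integrable (fun q : (Eu n × Eu n × Eu n) × Eu n => ten a b c q.1 * w (q.2 + q.1.1))
        (volume.prod volume) := by
      refine (integrable_prod_iff ?_).2 ⟨Eventually.of_forall fun y =>
        (hw.comp_add_right y.1).const_mul (ten a b c y), ?_⟩
      · refine (hT.aestronglyMeasurable.comp_fst).mul ?_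
        have hq : Measure.QuasiMeasurePreserving (fun q : (Eu n × Eu n × Eu n) × Eu n =>
            q.2 + q.1.1) (volume.prod volume) volume := by
          refine QuasiMeasurePreserving.prod_of_right (by fun_prop) (Eventually.of_forall fun y => ?_)
          exact (measurePreserving_add_right volume y.1).quasiMeasurePreserving
        exact hw.aestronglyMeasurable.comp_quasiMeasurePreserving hq
      · simp only [norm_mul, integral_const_mul]
        simp_rw [integral_add_right_eq_self (fun x => ‖w x‖)]
        exact hT.norm.mul_const _
    refine (h1.mul_bdd (c := M) hmeas2.aestronglyMeasurable
      (Eventually.of_forall fun q => hM _)).congr (Eventually.of_forall fun q => ?_)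
    simp only [Function.uncurry]; ring
  rw [integral_integral_swap hi2]
  refine integral_eq_zero_of_ae ?_
  filter_upwards [hi2.prod_left_ae] with x hi3
  simp only [Function.uncurry] at hi3
  simp only [Pi.zero_apply]
  rw [Measure.volume_eq_prod, integral_prod_symm _ hi3]
  refine integral_eq_zero_of_ae (Eventually.of_forall fun q => ?_)
  simp only [Pi.zero_apply, ten]
  have e2 : ∀ y, a y * b q.1 * c q.2 * F (x, ξ - q.1, η - q.2) * w (x + y) =
    (b q.1 * c q.2 * F (x, ξ - q.1, η - q.2)) * (a y * w (y + x)) := fun y => by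
      rw [add_comm x y]; ring
  simp_rw [e2]
  rw [integral_const_mul, haK _ (hw.comp_add_right x), mul_zero]
  intro ζ hζ
  have := fourier_comp_sub w (-x) ζ
  simp only [sub_neg_eq_add] at this
  rw [this, hw0 ζ hζ, mul_zero]

theorem measurePreserving_swap₁₂ : MeasurePreserving
    (fun w : Eu n × Eu n × Eu n => (w.2.1, w.1, w.2.2)) volume volume := by
  have h1 : MeasurePreserving (MeasurableEquiv.prodAssoc.symm : Eu n × Eu n × Eu n ≃ᵐ _)
      volume volume := (volume_preserving_prodAssoc).symm
  have h2 : MeasurePreserving (Prod.map Prod.swap id : (Eu n × Eu n) × Eu n → _) volume volume :=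
    Measure.measurePreserving_swap.prod (MeasurePreserving.id _)
  have h3 : MeasurePreserving (MeasurableEquiv.prodAssoc : (Eu n × Eu n) × Eu n ≃ᵐ _)
      volume volume := volume_preserving_prodAssoc
  exact h3.comp (h2.comp h1)

theorem measurePreserving_swap₂₃ : MeasurePreserving
    (fun w : Eu n × Eu n × Eu n => (w.1, w.2.2, w.2.1)) volume volume :=
  (MeasurePreserving.id volume).prod Measure.measurePreserving_swap

theorem conv₃_swap₁₂ (a b c : Eu n → ℂ) (F : Eu n × Eu n × Eu n → ℂ) (x ξ η : Eu n) :
    conv₃ a b c F (x, ξ, η) = conv₃ b a c (fun z => F (z.2.1, z.1, z.2.2)) (ξ, x, η) := by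
  have he : MeasurableEmbedding (fun w : Eu n × Eu n × Eu n => (w.2.1, w.1, w.2.2)) :=
    (MeasurableEquiv.mk ⟨fun w : Eu n × Eu n × Eu n => (w.2.1, w.1, w.2.2),
      fun w => (w.2.1, w.1, w.2.2), fun _ => rfl, fun _ => rfl⟩
      (by change Measurable fun w : Eu n × Eu n × Eu n => (w.2.1, w.1, w.2.2); fun_prop)
      (by change Measurable fun w : Eu n × Eu n × Eu n => (w.2.1, w.1, w.2.2); fun_prop)).measurableEmbedding
  rw [conv₃, conv₃, ← measurePreserving_swap₁₂.integral_comp he]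
  congr 1; ext w
  simp only [ten, Prod.fst_sub, Prod.snd_sub]
  ring_nf
  rfl

theorem conv₃_swap₂₃ (a b c : Eu n → ℂ) (F : Eu n × Eu n × Eu n → ℂ) (x ξ η : Eu n) :
    conv₃ a b c F (x, ξ, η) = conv₃ a c b (fun z => F (z.1, z.2.2, z.2.1)) (x, η, ξ) := by
  have he : MeasurableEmbedding (fun w : Eu n × Eu n × Eu n => (w.1, w.2.2, w.2.1)) :=
    (MeasurableEquiv.mk ⟨fun w : Eu n × Eu n × Eu n => (w.1, w.2.2, w.2.1),
      fun w => (w.1, w.2.2, w.2.1), fun _ => rfl, fun _ => rfl⟩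
      (by change Measurable fun w : Eu n × Eu n × Eu n => (w.1, w.2.2, w.2.1); fun_prop)
      (by change Measurable fun w : Eu n × Eu n × Eu n => (w.1, w.2.2, w.2.1); fun_prop)).measurableEmbedding
  rw [conv₃, conv₃, ← measurePreserving_swap₂₃.integral_comp he]
  congr 1; ext w
  simp only [ten, Prod.fst_sub, Prod.snd_sub]
  ring_nf
  rfl

theorem bandLimited_conv₃_snd {K : ℝ} (hbK : BandLimited b K) (ha : Integrable a)
    (hb : Integrable b) (hc : Integrable c)
    (hF : Measurable F) (hM : ∀ z, ‖F z‖ ≤ M) (x η : Eu n) :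
    BandLimited (fun ξ => conv₃ a b c F (x, ξ, η)) K := by
  simp_rw [conv₃_swap₁₂ a b c]
  exact bandLimited_conv₃_fst hbK hb ha hc (hF.comp (by fun_prop)) (fun _ => hM _) x η

theorem bandLimited_conv₃_thd {K : ℝ} (hcK : BandLimited c K) (ha : Integrable a)
    (hb : Integrable b) (hc : Integrable c)
    (hF : Measurable F) (hM : ∀ z, ‖F z‖ ≤ M) (x ξ : Eu n) :
    BandLimited (fun η => conv₃ a b c F (x, ξ, η)) K := by
  simp_rw [conv₃_swap₂₃ a b c]
  exact bandLimited_conv₃_snd hcK ha hc hb (hF.comp (by fun_prop)) (fun _ => hM _) x ξ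

end conv

/-- Functions with compactly supported Fourier transform are band-limited. -/
theorem bandLimited_fourierInv {D : 𝓢(Eu n, ℂ)} {K : ℝ} (hD : ∀ ζ, K < ‖ζ‖ → D ζ = 0) :
    BandLimited (𝓕⁻ D : 𝓢(Eu n, ℂ)) K := by
  intro w hw hw0
  have h1 : ∀ x, (𝓕⁻ D : 𝓢(Eu n, ℂ)) x = 𝓕 (fun ζ => D (-ζ)) x := fun x => by
    rw [schwartz_fourierInv_ee, fourier_ee, ← integral_neg_eq_self]
    simp
  simp_rw [h1]
  rw [integral_fourier_mul D.integrable.comp_neg hw]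
  refine integral_eq_zero_of_ae (Eventually.of_forall fun ζ => ?_)
  simp only [Pi.zero_apply]
  by_cases h : ‖ζ‖ ≤ K
  · rw [hw0 ζ h, mul_zero]
  · rw [hD (-ζ) (by rwa [norm_neg, ← not_le]), zero_mul]

theorem BandLimited.comp_smul {u : Eu n → ℂ} {K s : ℝ} (hs : 0 < s) (hu : BandLimited u K) :
    BandLimited (fun x => u (s • x)) (s * K) := by
  intro w hw hw0
  have h1 : ∫ x, u (s • x) * w x = ∫ x, (fun y => u y * w (s⁻¹ • y)) (s • x) := by
    congr 1; ext x
    simp only [inv_smul_smul₀ hs.ne']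
  rw [h1, Measure.integral_comp_smul volume (fun y => u y * w (s⁻¹ • y)) s, hu (fun y => w (s⁻¹ • y))
    (hw.comp_smul (inv_ne_zero hs.ne')), smul_zero]
  intro ζ hζ
  have h2 : 𝓕 (fun y => w (s⁻¹ • y)) ζ = ∫ y, (fun v => ee (-inner ℝ v (s • ζ)) * w v) (s⁻¹ • y) := by
    rw [fourier_ee]
    congr 1; ext y
    simp only [inner_smul_left, inner_smul_right]
    congr 3
    simp [hs.ne']
  rw [h2, Measure.integral_comp_smul volume (fun v => ee (-inner ℝ v (s • ζ)) * w v) s⁻¹, ← fourier_ee, hw0, smul_zero]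
  rw [norm_smul, Real.norm_of_nonneg hs.le]
  gcongr


/-! ### Littlewood-Paley blocks of bounded symbols -/

/-- The members of the Littlewood-Paley partition of unity as Schwartz functions. -/
def psiS (φ : 𝓢(Eu n, ℂ)) : ℕ → 𝓢(Eu n, ℂ)
  | 0 => φ
  | k + 1 => dilS (2 ^ (k + 1)) (by positivity) φ - dilS (2 ^ k) (by positivity) φ

theorem psiS_apply (φ : 𝓢(Eu n, ℂ)) (k : ℕ) (ξ : Eu n) : psiS φ k ξ = lpPiece φ k ξ := by
  cases k with
  | zero => rfl
  | succ k =>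
    simp only [psiS, lpPiece, _root_.sub_apply, dilS_apply, smul_smul]
    congr 3
    rw [pow_succ]
    field_simp

theorem sum_psiS_apply (φ : 𝓢(Eu n, ℂ)) (K : ℕ) (ξ : Eu n) :
    ∑ k ∈ Finset.range (K + 1), psiS φ k ξ = φ (((2 : ℝ) ^ K)⁻¹ • ξ) := by
  induction K with
  | zero => simp [psiS]
  | succ K ih =>
    rw [Finset.sum_range_succ, ih]
    simp [psiS]

theorem psiS_eq_zero {φ : 𝓢(Eu n, ℂ)} (hφ : IsLPGenerator φ) (k : ℕ) {ζ : Eu n}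
    (h : 2 ^ (k + 1) < ‖ζ‖) : psiS φ k ζ = 0 := by
  cases k with
  | zero => exact hφ.eq_zero (by simpa using h)
  | succ k =>
    rw [psiS, _root_.sub_apply, dilS_eq_zero hφ, dilS_eq_zero hφ, sub_zero]
    · rw [pow_succ, pow_succ] at h
      have : (0 : ℝ) < 2 ^ k := by positivity
      linarith
    · rw [pow_succ] at h; linarith

theorem two_pi_pos : (0 : ℝ) < 2 * Real.pi := by positivity

/-- The inverse Fourier transform in the normalization of `fourierCheck`. -/
def chk (ψ : 𝓢(Eu n, ℂ)) : 𝓢(Eu n, ℂ) := 𝓕⁻ (dilS (2 * Real.pi)⁻¹ (inv_pos.2 two_pi_pos) ψ)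

theorem fourierCheck_eq_chk (ψ : 𝓢(Eu n, ℂ)) (x : Eu n) : fourierCheck ψ x = chk ψ x := by
  have h := Measure.integral_comp_smul (volume : Measure (Eu n))
    (fun ξ => Complex.exp (Complex.I * (inner ℝ x ξ : ℝ)) * ψ ξ) (2 * Real.pi)
  rw [finrank_euclideanSpace_fin, abs_of_pos (by positivity)] at h
  rw [chk, schwartz_fourierInv_ee, fourierCheck]
  have e : ∀ v : Eu n, ee (inner ℝ v x) * dilS (2 * Real.pi)⁻¹ (inv_pos.2 two_pi_pos) ψ v =
      Complex.exp (Complex.I * (inner ℝ x ((2 * Real.pi) • v) : ℝ)) * ψ ((2 * Real.pi) • v) :=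
    fun v => by
      rw [dilS_apply, inv_inv, ee_eq_exp, inner_smul_right, real_inner_comm]
      congr 2
      push_cast; ring
  simp_rw [e]
  rw [h, Complex.real_smul]
  push_cast
  rw [inv_pow]

theorem lpBlock_eq_conv₃ (φ : 𝓢(Eu n, ℂ)) (k₀ k₁ k₂ : ℕ) (F : Eu n × Eu n × Eu n → ℂ) :
    lpBlock φ k₀ k₁ k₂ F = conv₃ (chk (psiS φ k₀)) (chk (psiS φ k₁)) (chk (psiS φ k₂)) F := by
  have h : ∀ k, lpPiece φ k = psiS φ k := fun k => funext fun ξ => (psiS_apply φ k ξ).symm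
  ext z
  rw [lpBlock, conv₃]
  simp_rw [h, fourierCheck_eq_chk]
  rfl

/-- ψ_k lives in the ball of radius 2^(k+1) in angular frequency; the factor (2π)⁻¹ converts to the
normalization e^{2πi⟨x,ξ⟩}. -/
theorem bandLimited_chk_psiS {φ : 𝓢(Eu n, ℂ)} (hφ : IsLPGenerator φ) (k : ℕ) :
    BandLimited (chk (psiS φ k)) ((2 * Real.pi)⁻¹ * 2 ^ (k + 1)) := by
  refine bandLimited_fourierInv fun ζ hζ => ?_
  rw [dilS_apply, inv_inv, psiS_eq_zero hφ]
  rw [norm_smul, Real.norm_of_nonneg two_pi_pos.le]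
  rwa [inv_mul_lt_iff₀ two_pi_pos] at hζ

theorem isLocalSymbol_conv₃ {W : Windows n} {a b c : Eu n → ℂ} (ha : Integrable a)
    (hb : Integrable b) (hc : Integrable c) {F : Eu n × Eu n × Eu n → ℂ} {M : ℝ}
    (hF : Measurable F) (hM : ∀ z, ‖F z‖ ≤ M) {K₀ K₁ K₂ : ℝ} (haK : BandLimited a K₀)
    (hbK : BandLimited b K₁) (hcK : BandLimited c K₂) {s : ℝ} (hs : 0 < s) {N : ℝ≥0∞}
    (hN : ∀ z₀, locN W (fun z => conv₃ a b c F (z.1, s • z.2.1, s • z.2.2)) z₀ ≤ N) :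
    IsLocalSymbol W (fun z => conv₃ a b c F (z.1, s • z.2.1, s • z.2.2)) K₀ (s * K₁) (s * K₂) N := by
  refine ⟨?_, ⟨_, fun z => norm_conv₃_le ha hb hc hM _⟩, fun ξ η =>
    bandLimited_conv₃_fst haK ha hb hc hF hM (s • ξ) (s • η), fun x η => ?_, fun x ξ => ?_, hN⟩
  · have h := continuous_conv₃ ha hb hc hF hM
    have h2 : Continuous fun z : Eu n × Eu n × Eu n => (z.1, s • z.2.1, s • z.2.2) := by fun_prop
    exact h.comp h2
  · have h := bandLimited_conv₃_snd hbK ha hb hc hF hM x (s • η)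
    exact h.comp_smul hs
  · have h := bandLimited_conv₃_thd hcK ha hb hc hF hM x (s • ξ)
    exact h.comp_smul hs

/-- The blocks of a bounded function are local symbols. -/
theorem exists_isLocalSymbol_lpBlock (W : Windows n) {φ : 𝓢(Eu n, ℂ)} (hφ : IsLPGenerator φ) :
    ∃ C : ℝ≥0∞, C ≠ ∞ ∧ ∀ (F : Eu n × Eu n × Eu n → ℂ) (M : ℝ), Measurable F → (∀ z, ‖F z‖ ≤ M) →
      ∀ k₀ k₁ k₂ : ℕ, IsLocalSymbol W
        (fun z => lpBlock φ k₀ k₁ k₂ F (z.1, (2 * Real.pi) • z.2.1, (2 * Real.pi) • z.2.2))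
        (2 ^ (k₀ + 1)) (2 ^ (k₁ + 1)) (2 ^ (k₂ + 1))
        (C * l2ulNorm (lpBlock φ k₀ k₁ k₂ F)) := by
  obtain ⟨C, hC, hN⟩ := exists_locN_le W
  refine ⟨C, hC, fun F M hF hM k₀ k₁ k₂ => ?_⟩
  have hi : ∀ k, Integrable (chk (psiS φ k)) := fun k => (chk (psiS φ k)).integrable
  have hc : Continuous (lpBlock φ k₀ k₁ k₂ F) := by
    rw [lpBlock_eq_conv₃]; exact continuous_conv₃ (hi _) (hi _) (hi _) hF hM
  have hN' := hN _ hc.measurable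
  rw [lpBlock_eq_conv₃] at hN' ⊢
  have h := isLocalSymbol_conv₃ (hi k₀) (hi k₁) (hi k₂) hF hM (bandLimited_chk_psiS hφ k₀)
    (bandLimited_chk_psiS hφ k₁) (bandLimited_chk_psiS hφ k₂) two_pi_pos hN'
  -- Rescaling ξ and η by 2π cancels the factor (2π)⁻¹. The variable x is not rescaled, and there
  -- the radius is simply enlarged.
  have hK : ∀ k : ℕ, (2 * Real.pi) * ((2 * Real.pi)⁻¹ * 2 ^ (k + 1)) = (2 : ℝ) ^ (k + 1) :=
    fun k => mul_inv_cancel_left₀ two_pi_pos.ne' _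
  rw [hK, hK] at h
  refine { h with band₀ := fun ξ η => (h.band₀ ξ η).mono ?_ }
  refine mul_le_of_le_one_left (by positivity) (inv_le_one_of_one_le₀ ?_)
  linarith [Real.pi_gt_three]

theorem fourierInv_dilS (s : ℝ) (hs : 0 < s) (D : 𝓢(Eu n, ℂ)) (x : Eu n) :
    (𝓕⁻ (dilS s hs D) : 𝓢(Eu n, ℂ)) x = (s : ℂ) ^ n * (𝓕⁻ D : 𝓢(Eu n, ℂ)) (s • x) := by
  have h := Measure.integral_comp_smul (volume : Measure (Eu n))
    (fun ξ => ee (inner ℝ ξ (s • x)) * D ξ) s⁻¹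
  rw [finrank_euclideanSpace_fin, abs_of_pos (by positivity)] at h
  rw [schwartz_fourierInv_ee, schwartz_fourierInv_ee]
  have e : ∀ v : Eu n, ee (inner ℝ v x) * dilS s hs D v =
      ee (inner ℝ (s⁻¹ • v) (s • x)) * D (s⁻¹ • v) := fun v => by
    rw [dilS_apply, inner_smul_left, inner_smul_right]
    simp [hs.ne']
  simp_rw [e]
  rw [h, Complex.real_smul]
  push_cast
  rw [inv_pow, inv_inv]

theorem chk_dilS (s : ℝ) (hs : 0 < s) (ψ : 𝓢(Eu n, ℂ)) (x : Eu n) :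
    chk (dilS s hs ψ) x = (s : ℂ) ^ n * chk ψ (s • x) := by
  rw [chk, chk, ← fourierInv_dilS s hs]
  congr 2
  ext ζ
  simp only [dilS_apply, smul_smul]
  rw [mul_comm]

theorem integral_chk (ψ : 𝓢(Eu n, ℂ)) : ∫ x, chk ψ x = ψ 0 := by
  have h : (𝓕 (chk ψ) : 𝓢(Eu n, ℂ)) 0 = ψ 0 := by
    simp [chk]
  rw [schwartz_fourier_ee] at h
  simpa [ee_zero] using h

theorem integral_ten (a b c : Eu n → ℂ) :
    ∫ w, ten a b c w = (∫ x, a x) * ((∫ x, b x) * ∫ x, c x) := by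
  rw [← integral_prod_mul b c, ← integral_prod_mul a]
  simp only [ten, mul_assoc]
  rfl

theorem conv₃_chk_dilS (ψ : 𝓢(Eu n, ℂ)) (s : ℝ) (hs : 0 < s) (F : Eu n × Eu n × Eu n → ℂ)
    (z : Eu n × Eu n × Eu n) :
    conv₃ (chk (dilS s hs ψ)) (chk (dilS s hs ψ)) (chk (dilS s hs ψ)) F z =
      ∫ w, ten (chk ψ) (chk ψ) (chk ψ) w * F (z - s⁻¹ • w) := by
  have h := Measure.integral_comp_smul (volume : Measure (Eu n × Eu n × Eu n))
    (fun w => ten (chk ψ) (chk ψ) (chk ψ) w * F (z - s⁻¹ • w)) s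
  have hd : Module.finrank ℝ (Eu n × Eu n × Eu n) = n + (n + n) := by
    simp
  rw [hd, abs_of_pos (by positivity), Complex.real_smul] at h
  have e : ∀ w : Eu n × Eu n × Eu n,
      ten (chk (dilS s hs ψ)) (chk (dilS s hs ψ)) (chk (dilS s hs ψ)) w * F (z - w) =
      (s : ℂ) ^ (n + (n + n)) * (ten (chk ψ) (chk ψ) (chk ψ) (s • w) * F (z - s⁻¹ • (s • w))) :=
    fun w => by
      simp only [ten, chk_dilS, Prod.smul_fst, Prod.smul_snd, inv_smul_smul₀ hs.ne']
      ring
  rw [conv₃]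
  simp_rw [e]
  rw [integral_const_mul, h]
  push_cast
  rw [mul_inv_cancel_left₀]
  exact pow_ne_zero _ (by exact_mod_cast hs.ne')

/-- The kernels form an approximate identity because ψ 0 = 1. As F is only bounded, the translations
are moved to the integrable G; L¹-continuity and dominated convergence give the weak limit. -/
theorem tendsto_integral_conv₃ {ψ : 𝓢(Eu n, ℂ)} (hψ : ψ 0 = 1) {F G : Eu n × Eu n × Eu n → ℂ}
    {M : ℝ} (hF : Measurable F) (hM : ∀ z, ‖F z‖ ≤ M) (hG : Integrable G) :
    Tendsto (fun K : ℕ => ∫ z, conv₃ (chk (dilS (2 ^ K) (by positivity) ψ))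
      (chk (dilS (2 ^ K) (by positivity) ψ)) (chk (dilS (2 ^ K) (by positivity) ψ)) F z * G z)
      atTop (𝓝 (∫ z, F z * G z)) := by
  have hM0 : 0 ≤ M := (norm_nonneg _).trans (hM 0)
  set T := ten (chk ψ) (chk ψ) (chk ψ) with hTd
  have hT : Integrable T :=
    integrable_ten (chk ψ).integrable (chk ψ).integrable (chk ψ).integrable
  have hT1 : ∫ w, T w = 1 := by rw [hTd, integral_ten, integral_chk, hψ]; simp
  have hFG : ∀ h : Eu n × Eu n × Eu n, Integrable fun z => F z * G (z + h) := fun h =>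
    (hG.comp_add_right h).bdd_mul hF.aestronglyMeasurable (Eventually.of_forall hM)
  have key : ∀ K : ℕ, ∫ z, conv₃ (chk (dilS (2 ^ K) (by positivity) ψ))
      (chk (dilS (2 ^ K) (by positivity) ψ)) (chk (dilS (2 ^ K) (by positivity) ψ)) F z * G z =
      ∫ w, T w * ∫ z, F z * G (z + ((2 : ℝ) ^ K)⁻¹ • w) := fun K => by
    simp_rw [conv₃_chk_dilS, ← integral_mul_const]
    have hmeas : Measurable fun q : (Eu n × Eu n × Eu n) × (Eu n × Eu n × Eu n) =>
        F (q.1 - ((2 : ℝ) ^ K)⁻¹ • q.2) := hF.comp (by fun_prop)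
    have hi : Integrable (Function.uncurry fun (z w : Eu n × Eu n × Eu n) =>
        T w * F (z - ((2 : ℝ) ^ K)⁻¹ • w) * G z) (volume.prod volume) := by
      refine ((hG.mul_prod hT).mul_bdd (c := M) hmeas.aestronglyMeasurable
        (Eventually.of_forall fun q => hM _)).congr (Eventually.of_forall fun q => ?_)
      simp only [Function.uncurry]; ring
    rw [integral_integral_swap hi]
    congr 1; ext w
    rw [← integral_const_mul, ← integral_add_right_eq_self _ (((2 : ℝ) ^ K)⁻¹ • w)]
    congr 1; ext z
    rw [add_sub_cancel_right, mul_assoc]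
  have lim : ∀ w, Tendsto (fun K : ℕ => ∫ z, F z * G (z + ((2 : ℝ) ^ K)⁻¹ • w)) atTop
      (𝓝 (∫ z, F z * G z)) := fun w => by
    have h1 : Tendsto (fun K : ℕ => ((2 : ℝ) ^ K)⁻¹ • w) atTop (𝓝 0) := by
      have : Tendsto (fun K : ℕ => ((2 : ℝ) ^ K)⁻¹) atTop (𝓝 0) :=
        (tendsto_pow_atTop_atTop_of_one_lt (by norm_num : (1 : ℝ) < 2)).inv_tendsto_atTop
      simpa using this.smul_const w
    have h2 := ENNReal.Tendsto.const_mul (a := ENNReal.ofReal M)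
      ((tendsto_lintegral_enorm_translate hG).comp h1) (Or.inr ENNReal.ofReal_ne_top)
    rw [mul_zero] at h2
    rw [tendsto_iff_edist_tendsto_0]
    refine tendsto_of_tendsto_of_tendsto_of_le_of_le tendsto_const_nhds h2 (fun _ => zero_le)
      fun K => ?_
    have hFG0 : Integrable fun z => F z * G z := by simpa using hFG 0
    simp only [Function.comp_apply]
    rw [edist_eq_enorm_sub, ← integral_sub (hFG _) hFG0, ← lintegral_const_mul' _ _ (by finiteness)]
    refine (enorm_integral_le_lintegral_enorm _).trans (lintegral_mono fun z => ?_)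
    rw [← mul_sub, enorm_mul]
    gcongr
    rw [← ofReal_norm]
    exact ENNReal.ofReal_le_ofReal (hM _)
  simp_rw [key]
  have hlim : ∫ z, F z * G z = ∫ w, T w * ∫ z, F z * G z := by
    rw [integral_mul_const, hT1, one_mul]
  rw [hlim]
  refine tendsto_integral_of_dominated_convergence (fun w => ‖T w‖ * (M * ∫ z, ‖G z‖)) ?_
    (hT.norm.mul_const _) ?_ ?_
  · intro K
    refine hT.aestronglyMeasurable.mul ?_
    have hq : Measure.QuasiMeasurePreserving
        (fun q : (Eu n × Eu n × Eu n) × (Eu n × Eu n × Eu n) => q.2 + ((2 : ℝ) ^ K)⁻¹ • q.1)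
        (volume.prod volume) volume := by
      refine QuasiMeasurePreserving.prod_of_right (by fun_prop) (Eventually.of_forall fun y => ?_)
      exact (measurePreserving_add_right volume (((2 : ℝ) ^ K)⁻¹ • y)).quasiMeasurePreserving
    have h1 : AEStronglyMeasurable (fun q : (Eu n × Eu n × Eu n) × (Eu n × Eu n × Eu n) =>
        F q.2 * G (q.2 + ((2 : ℝ) ^ K)⁻¹ • q.1)) (volume.prod volume) :=
      (hF.comp measurable_snd).aestronglyMeasurable.mul
        (hG.aestronglyMeasurable.comp_quasiMeasurePreserving hq)
    exact h1.integral_prod_right'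
  · refine fun K => Eventually.of_forall fun w => ?_
    rw [norm_mul]
    gcongr
    have h3 : ∫ z, ‖G z‖ = ∫ z, ‖G (z + ((2 : ℝ) ^ K)⁻¹ • w)‖ :=
      (integral_add_right_eq_self (fun z => ‖G z‖) _).symm
    rw [h3, ← integral_const_mul]
    refine norm_integral_le_of_norm_le ((hG.comp_add_right _).norm.const_mul _)
      (Eventually.of_forall fun z => ?_)
    rw [norm_mul]
    gcongr
    exact hM z
  · exact Eventually.of_forall fun w => (lim w).const_mul _

theorem sum_lpBlock (φ : 𝓢(Eu n, ℂ)) {F : Eu n × Eu n × Eu n → ℂ} {M : ℝ} (hF : Measurable F)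
    (hM : ∀ z, ‖F z‖ ≤ M) (K : ℕ) (z : Eu n × Eu n × Eu n) :
    ∑ k₀ ∈ Finset.range (K + 1), ∑ k ∈ Finset.range (K + 1) ×ˢ Finset.range (K + 1),
      lpBlock φ k₀ k.1 k.2 F z = conv₃ (chk (dilS (2 ^ K) (by positivity) φ))
      (chk (dilS (2 ^ K) (by positivity) φ)) (chk (dilS (2 ^ K) (by positivity) φ)) F z := by
  have hs : dilS (2 ^ K) (by positivity) φ = ∑ k ∈ Finset.range (K + 1), psiS φ k := by
    ext ξ
    rw [dilS_apply, ← sum_psiS_apply, _root_.sum_apply]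
  have hc : ∀ x, chk (dilS (2 ^ K) (by positivity) φ) x =
      ∑ k ∈ Finset.range (K + 1), chk (psiS φ k) x := by
    intro x
    rw [hs]
    have : chk (∑ k ∈ Finset.range (K + 1), psiS φ k) =
        ∑ k ∈ Finset.range (K + 1), chk (psiS φ k) := by
      have := map_sum ((FourierTransform.fourierInvCLM ℂ 𝓢(Eu n, ℂ)).comp
        (SchwartzMap.compCLMOfContinuousLinearEquiv ℂ (ContinuousLinearEquiv.smulLeft
          (Units.mk0 (2 * Real.pi)⁻¹⁻¹ (inv_ne_zero (inv_pos.2 two_pi_pos).ne')))))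
        (psiS φ) (Finset.range (K + 1))
      exact this
    rw [this, _root_.sum_apply]
  have hi : ∀ k, Integrable (chk (psiS φ k)) := fun k => (chk (psiS φ k)).integrable
  simp_rw [lpBlock_eq_conv₃, conv₃]
  have hint := fun k₀ k₁ k₂ => integrable_conv₃_integrand (hi k₀) (hi k₁) (hi k₂) hF hM z
  simp_rw [← integral_finsetSum (s := Finset.range (K + 1) ×ˢ Finset.range (K + 1))
    (fun k _ => hint _ k.1 k.2)]
  rw [← integral_finsetSum _ fun k₀ _ => integrable_finsetSum _ fun k _ => hint k₀ k.1 k.2]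
  congr 1; ext w
  simp only [ten, hc, Finset.sum_product]
  simp_rw [← Finset.sum_mul, ← Finset.mul_sum, ← Finset.sum_mul]
  congr 2
  rw [Finset.sum_mul_sum]

/-- The partial sums of the blocks telescope to the approximate identity above. Bounding them by the
full series of absolute values avoids any convergence claim for the block series itself. -/
theorem enorm_integral_mul_le_tsum {φ : 𝓢(Eu n, ℂ)} (hφ : IsLPGenerator φ)
    {F G : Eu n × Eu n × Eu n → ℂ} {M : ℝ} (hF : Measurable F) (hM : ∀ z, ‖F z‖ ≤ M)
    (hG : Integrable G) :
    ‖∫ z, F z * G z‖ₑ ≤ ∑' k₀ : ℕ, ∑' k : ℕ × ℕ, ‖∫ z, lpBlock φ k₀ k.1 k.2 F z * G z‖ₑ := by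
  have h := tendsto_integral_conv₃ (hφ.eq_one 0 (by simp)) hF hM hG
  refine le_of_tendsto h.enorm (Eventually.of_forall fun K => ?_)
  have hi : ∀ k, Integrable (chk (psiS φ k)) := fun k => (chk (psiS φ k)).integrable
  have hint : ∀ k₀ k₁ k₂, Integrable fun z => lpBlock φ k₀ k₁ k₂ F z * G z := fun k₀ k₁ k₂ => by
    rw [lpBlock_eq_conv₃]
    exact hG.bdd_mul (continuous_conv₃ (hi _) (hi _) (hi _) hF hM).aestronglyMeasurable
      (Eventually.of_forall (norm_conv₃_le (hi _) (hi _) (hi _) hM))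
  simp_rw [← sum_lpBlock φ hF hM, Finset.sum_mul]
  rw [integral_finsetSum _ fun k₀ _ => integrable_finsetSum _ fun k _ => hint k₀ k.1 k.2]
  simp_rw [integral_finsetSum (Finset.range (K + 1) ×ˢ Finset.range (K + 1))
    (fun k _ => hint _ k.1 k.2)]
  refine (enorm_sum_le _ _).trans ((Finset.sum_le_sum fun k₀ _ => ?_).trans
    (ENNReal.sum_le_tsum _))
  exact (enorm_sum_le _ _).trans (ENNReal.sum_le_tsum _)

/-! ### Littlewood-Paley pieces of functions in `bmo` -/

theorem volume_cube (x : Eu n) {R : ℝ} (_hR : 0 ≤ R) :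
    volume (cube x R) = ENNReal.ofReal (2 * R) ^ n := by
  have hs : MeasurableSet (Set.Icc (fun i : Fin n => x i - R) fun i => x i + R) := measurableSet_Icc
  have e : cube x R = (MeasurableEquiv.toLp 2 (Fin n → ℝ)).symm ⁻¹'
      (Set.Icc (fun i : Fin n => x i - R) fun i => x i + R) := by
    ext y
    simp only [cube, abs_le, Set.mem_ofPred_eq, Set.mem_preimage, Set.mem_Icc,
      Pi.le_def, ← forall_and]
    refine forall_congr' fun i => ?_
    change _ ↔ x i - R ≤ y i ∧ y i ≤ x i + R
    constructor <;> rintro ⟨h1, h2⟩ <;> constructor <;> linarith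
  rw [e, (EuclideanSpace.volume_preserving_symm_measurableEquiv_toLp (Fin n)).measure_preimage
    hs.nullMeasurableSet, Real.volume_Icc_pi]
  have : ∀ i, x i + R - (x i - R) = 2 * R := fun i => by ring
  simp [this]

theorem measurableSet_cube (x : Eu n) (R : ℝ) : MeasurableSet (cube x R) := by
  have : cube x R = ⋂ i, {y : Eu n | |y i - x i| ≤ R} := by ext y; simp [cube]
  rw [this]
  refine MeasurableSet.iInter fun i => measurableSet_le ?_ measurable_const
  have : Continuous fun y : Eu n => |y i - x i| := by fun_prop
  exact this.measurable

theorem cube_subset_cube (x : Eu n) {r R : ℝ} (h : r ≤ R) : cube x r ⊆ cube x R :=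
  fun _ hy i => (hy i).trans h

theorem volume_cube_ne_zero (x : Eu n) {R : ℝ} (hR : 0 < R) : volume (cube x R) ≠ 0 := by
  rw [volume_cube x hR.le]
  exact pow_ne_zero _ (by simpa using hR)

theorem volume_cube_ne_top (x : Eu n) {R : ℝ} (hR : 0 < R) : volume (cube x R) ≠ ∞ := by
  rw [volume_cube x hR.le]
  finiteness

theorem setLIntegral_cube_sub_mean_le (g : Eu n → ℂ) (x : Eu n) {R : ℝ} (hR : 0 < R)
    (h : volume (cube x R) ≤ 1) :
    ∫⁻ y in cube x R, ‖g y - cubeMean g (cube x R)‖ₑ ≤ volume (cube x R) * bmoNorm g := by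
  have h1 : (volume (cube x R))⁻¹ * ∫⁻ y in cube x R, ‖g y - cubeMean g (cube x R)‖ₑ ≤
      bmoNorm g := by
    refine le_trans ?_ le_self_add
    exact le_iSup₂_of_le x R (le_iSup₂_of_le hR h le_rfl)
  rwa [ENNReal.inv_mul_le_iff (volume_cube_ne_zero x hR) (volume_cube_ne_top x hR)] at h1

theorem setLIntegral_cube_le (g : Eu n → ℂ) (x : Eu n) {R : ℝ} (hR : 0 < R)
    (h : 1 ≤ volume (cube x R)) :
    ∫⁻ y in cube x R, ‖g y‖ₑ ≤ volume (cube x R) * bmoNorm g := by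
  have h1 : (volume (cube x R))⁻¹ * ∫⁻ y in cube x R, ‖g y‖ₑ ≤ bmoNorm g := by
    refine le_trans ?_ le_add_self
    exact le_iSup₂_of_le x R (le_iSup₂_of_le hR h le_rfl)
  rwa [ENNReal.inv_mul_le_iff (volume_cube_ne_zero x hR) (volume_cube_ne_top x hR)] at h1

theorem enorm_sub_cubeMean_le {g : Eu n → ℂ} (hg : Integrable g) (x : Eu n) {R : ℝ} (hR : 0 < R)
    (c : ℂ) : ‖c - cubeMean g (cube x R)‖ₑ ≤
      (volume (cube x R))⁻¹ * ∫⁻ y in cube x R, ‖g y - c‖ₑ := by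
  have h0 : volume.real (cube x R) ≠ 0 := by
    rw [measureReal_def, ENNReal.toReal_ne_zero]
    exact ⟨volume_cube_ne_zero x hR, volume_cube_ne_top x hR⟩
  have h1 : ∫ y in cube x R, (g y - c) = (∫ y in cube x R, g y) - (volume.real (cube x R) : ℂ) * c := by
    rw [integral_sub hg.integrableOn (integrableOn_const (volume_cube_ne_top x hR)),
      setIntegral_const, Complex.real_smul]
  have h2 : c - cubeMean g (cube x R) =
      -(((volume.real (cube x R) : ℝ) : ℂ)⁻¹ * ∫ y in cube x R, (g y - c)) := by
    rw [h1, cubeMean]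
    have : ((volume.real (cube x R) : ℝ) : ℂ) ≠ 0 := by exact_mod_cast h0
    field_simp
    ring
  rw [h2, enorm_neg, enorm_mul, enorm_inv (by exact_mod_cast h0)]
  have h3 : ‖((volume.real (cube x R) : ℝ) : ℂ)‖ₑ = volume (cube x R) := by
    rw [← ofReal_norm, Complex.norm_real, Real.norm_of_nonneg measureReal_nonneg,
      ofReal_measureReal (volume_cube_ne_top x hR)]
  rw [h3]
  gcongr
  exact enorm_integral_le_lintegral_enorm _

/-- On the large cube g is compared with its own mean if the volume is at most 1, and with 0
otherwise; both are controlled by the bmo norm. Passing to the mean over the small cube costs the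
ratio of the volumes, with no need for a chain of intermediate cubes. -/
theorem setLIntegral_sub_cubeMean_le {g : Eu n → ℂ} (hg : Integrable g) (x : Eu n) {r R : ℝ}
    (hr : 0 < r) (hrR : r ≤ R) :
    ∫⁻ y in cube x R, ‖g y - cubeMean g (cube x r)‖ₑ ≤
      2 * (volume (cube x R) * (volume (cube x R) * (volume (cube x r))⁻¹)) * bmoNorm g := by
  have hR : 0 < R := hr.trans_le hrR
  have hsub := cube_subset_cube x hrR
  have hq : 1 ≤ volume (cube x R) * (volume (cube x r))⁻¹ := by
    rw [← div_eq_mul_inv, ENNReal.le_div_iff_mul_le (Or.inl (volume_cube_ne_zero x hr))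
      (Or.inl (volume_cube_ne_top x hr)), one_mul]
    exact measure_mono hsub
  set V := volume (cube x R) with hV
  set q := (volume (cube x r))⁻¹ with hq'
  have main : ∀ c : ℂ, (∫⁻ y in cube x R, ‖g y - c‖ₑ ≤ V * bmoNorm g) →
      ∫⁻ y in cube x R, ‖g y - cubeMean g (cube x r)‖ₑ ≤ 2 * (V * (V * q)) * bmoNorm g := by
    intro c hc
    have h1 : ‖c - cubeMean g (cube x r)‖ₑ ≤ q * (V * bmoNorm g) := by
      refine (enorm_sub_cubeMean_le hg x hr c).trans ?_
      gcongr
      exact (lintegral_mono_set hsub).trans hc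
    calc ∫⁻ y in cube x R, ‖g y - cubeMean g (cube x r)‖ₑ
        ≤ ∫⁻ y in cube x R, (‖g y - c‖ₑ + ‖c - cubeMean g (cube x r)‖ₑ) := by
          refine lintegral_mono fun y => ?_
          have : g y - cubeMean g (cube x r) = (g y - c) + (c - cubeMean g (cube x r)) := by ring
          simp only [this]
          exact enorm_add_le _ _
      _ = (∫⁻ y in cube x R, ‖g y - c‖ₑ) + ‖c - cubeMean g (cube x r)‖ₑ * V := by
          rw [lintegral_add_right _ measurable_const, setLIntegral_const]
      _ ≤ V * bmoNorm g + (q * (V * bmoNorm g)) * V := by gcongr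
      _ ≤ (V * (V * q)) * bmoNorm g + (q * (V * bmoNorm g)) * V := by
          gcongr
          exact le_mul_of_one_le_right' hq
      _ = _ := by ring
  rcases le_total V 1 with h | h
  · exact main _ (setLIntegral_cube_sub_mean_le g x hR h)
  · refine main 0 ?_
    simpa using setLIntegral_cube_le g x hR h

/-- Decomposition of a radially decaying weight into dyadic cubes. -/
theorem lintegral_decay_mul_le (N : ℕ) {s : ℝ} (hs : 0 < s) (x : Eu n) {G : Eu n → ℝ≥0∞}
    (hG : Measurable G) :
    ∫⁻ y, ENNReal.ofReal ((1 + s * ‖x - y‖) ^ N)⁻¹ * G y ≤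
      ∑' i : ℕ, ENNReal.ofReal (4 ^ N * (2 ^ (i * N))⁻¹) * ∫⁻ y in cube x (2 ^ i / (2 * s)), G y := by
  have h1 : ∀ y, ENNReal.ofReal ((1 + s * ‖x - y‖) ^ N)⁻¹ * G y ≤
      ∑' i : ℕ, ENNReal.ofReal (4 ^ N * (2 ^ (i * N))⁻¹) *
        (cube x (2 ^ i / (2 * s))).indicator G y := by
    intro y
    have hex : ∃ i : ℕ, y ∈ cube x (2 ^ i / (2 * s)) := by
      obtain ⟨i, hi⟩ := pow_unbounded_of_one_lt (2 * s * ‖y - x‖) (by norm_num : (1 : ℝ) < 2)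
      refine ⟨i, fun k => ?_⟩
      rw [le_div_iff₀ (by positivity)]
      have : |y k - x k| ≤ ‖y - x‖ := by
        simpa using PiLp.norm_apply_le (y - x) k
      nlinarith
    classical
    -- Only the smallest dyadic cube containing y is needed.
    set i := Nat.find hex with hi
    have hmem := Nat.find_spec hex
    refine le_trans ?_ (ENNReal.le_tsum i)
    rw [Set.indicator_of_mem hmem]
    gcongr
    rw [← inv_pow, pow_mul, ← inv_pow, ← mul_pow]
    refine pow_le_pow_left₀ (by positivity) ?_ _
    -- If i > 0, minimality puts y outside the previous cube, so 2^(i-1) < 2s‖x - y‖; if i = 0 the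
    -- bound is trivial.
    have h2 : (2 : ℝ) ^ i ≤ 4 * (1 + s * ‖x - y‖) := by
      rcases Nat.eq_zero_or_pos i with h0 | h0
      · rw [h0, pow_zero]
        nlinarith [mul_nonneg hs.le (norm_nonneg (x - y))]
      · have hnot := Nat.find_min hex (m := i - 1) (by omega)
        simp only [cube, Set.mem_ofPred_eq, not_forall, not_le] at hnot
        obtain ⟨k, hk⟩ := hnot
        have : |y k - x k| ≤ ‖x - y‖ := by
          rw [norm_sub_rev]
          simpa using PiLp.norm_apply_le (y - x) k
        have h3 := hk.trans_le this
        rw [div_lt_iff₀ (by positivity)] at h3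
        have h4 : (2 : ℝ) ^ i = 2 * 2 ^ (i - 1) := by
          rw [← pow_succ']; congr 1; omega
        rw [h4]
        linarith
    have h5 : 0 ≤ s * ‖x - y‖ := by positivity
    rw [← div_eq_mul_inv, inv_eq_one_div, div_le_div_iff₀ (by positivity) (by positivity)]
    linarith
  refine (lintegral_mono h1).trans ?_
  rw [lintegral_tsum]
  · refine ENNReal.tsum_le_tsum fun i => ?_
    rw [lintegral_const_mul' _ _ (by finiteness),
      lintegral_indicator (measurableSet_cube _ _)]
  · intro i
    exact ((hG.indicator (measurableSet_cube _ _)).const_mul _).aemeasurable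

/-- The Littlewood-Paley piece `ψ_l(D) g`. -/
def lpS (φ : 𝓢(Eu n, ℂ)) (l : ℕ) (g : 𝓢(Eu n, ℂ)) : 𝓢(Eu n, ℂ) := 𝓕⁻ (mulS (psiS φ l) (𝓕 g))

/-- The low frequency part `φ(D / s) g`. -/
def lowS (φ : 𝓢(Eu n, ℂ)) (s : ℝ) (hs : 0 < s) (g : 𝓢(Eu n, ℂ)) : 𝓢(Eu n, ℂ) :=
  𝓕⁻ (mulS (dilS s hs φ) (𝓕 g))

theorem fourierInv_mulS_apply (D g : 𝓢(Eu n, ℂ)) (x : Eu n) :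
    (𝓕⁻ (mulS D (𝓕 g)) : 𝓢(Eu n, ℂ)) x = ∫ y, (𝓕⁻ D : 𝓢(Eu n, ℂ)) (x - y) * g y := by
  have h := integral_fourier_mul (f := g) (g := fun ξ => ee (inner ℝ ξ x) * D ξ) g.integrable
    (integrable_ee_mul D.integrable (by fun_prop))
  rw [schwartz_fourierInv_ee]
  calc _ = ∫ ξ, 𝓕 (g : Eu n → ℂ) ξ * (ee (inner ℝ ξ x) * D ξ) := by
        congr 1; ext ξ
        rw [mulS_apply, ← SchwartzMap.fourier_coe]; ring
    _ = _ := h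
    _ = _ := by
        congr 1; ext y
        rw [fourier_ee_mul, mul_comm, SchwartzMap.fourierInv_coe, Real.fourierInv_eq_fourier_neg,
          neg_sub]

theorem lowS_apply (φ : 𝓢(Eu n, ℂ)) (s : ℝ) (hs : 0 < s) (g : 𝓢(Eu n, ℂ)) (x : Eu n) :
    lowS φ s hs g x = ∫ y, ((s : ℂ) ^ n * (𝓕⁻ φ : 𝓢(Eu n, ℂ)) (s • (x - y))) * g y := by
  rw [lowS, fourierInv_mulS_apply]
  simp_rw [fourierInv_dilS]

theorem integrable_kernel (k : 𝓢(Eu n, ℂ)) {s : ℝ} (hs : 0 < s) (x : Eu n) :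
    Integrable fun y => (s : ℂ) ^ n * k (s • (x - y)) :=
  ((k.integrable.comp_smul hs.ne').comp_sub_left x).const_mul _

theorem integral_kernel (k : 𝓢(Eu n, ℂ)) {s : ℝ} (hs : 0 < s) (x : Eu n) :
    ∫ y, (s : ℂ) ^ n * k (s • (x - y)) = ∫ y, k y := by
  rw [integral_const_mul, integral_sub_left_eq_self (fun y => k (s • y)),
    Measure.integral_comp_smul, finrank_euclideanSpace_fin, abs_of_pos (by positivity),
    Complex.real_smul]
  push_cast
  rw [mul_inv_cancel_left₀]
  exact pow_ne_zero _ (by exact_mod_cast hs.ne')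

theorem enorm_kernel_le {k : 𝓢(Eu n, ℂ)} {N : ℕ} {C : ℝ} (hC0 : 0 ≤ C)
    (hC : ∀ x, (1 + ‖x‖) ^ N * ‖k x‖ ≤ C) {s : ℝ} (hs : 0 < s) (z : Eu n) :
    ‖(s : ℂ) ^ n * k (s • z)‖ₑ ≤ ENNReal.ofReal C * ENNReal.ofReal s ^ n *
      ENNReal.ofReal ((1 + s * ‖z‖) ^ N)⁻¹ := by
  rw [← ofReal_norm, ← ENNReal.ofReal_pow hs.le, ← ENNReal.ofReal_mul hC0,
    ← ENNReal.ofReal_mul (by positivity)]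
  refine ENNReal.ofReal_le_ofReal ?_
  have h := hC (s • z)
  rw [norm_smul, Real.norm_of_nonneg hs.le] at h
  rw [norm_mul, norm_pow, Complex.norm_real, Real.norm_of_nonneg hs.le, mul_comm C, mul_assoc,
    ← div_eq_mul_inv]
  gcongr
  rw [le_div_iff₀ (by positivity)]
  linarith

/-- One power of decay beyond the growth 2^(iN) leaves the series ∑ 2^(-i) = 2. -/
theorem tsum_dyadic (N : ℕ) : ∑' i : ℕ, ENNReal.ofReal (4 ^ (N + 1) * (2 ^ (i * (N + 1)))⁻¹) *
    (2 : ℝ≥0∞) ^ (i * N) ≤ 2 * ENNReal.ofReal (4 ^ (N + 1)) := by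
  have h : ∀ i : ℕ, ENNReal.ofReal (4 ^ (N + 1) * (2 ^ (i * (N + 1)))⁻¹) *
      (2 : ℝ≥0∞) ^ (i * N) = ENNReal.ofReal (4 ^ (N + 1)) * (2⁻¹) ^ i := fun i => by
    have : ((2 : ℝ≥0∞)⁻¹) ^ i = ENNReal.ofReal ((2 ^ i)⁻¹) := by
      rw [ENNReal.ofReal_inv_of_pos (by positivity), ENNReal.ofReal_pow (by norm_num), ENNReal.inv_pow]
      simp
    have h2 : (2 : ℝ≥0∞) ^ (i * N) = ENNReal.ofReal (2 ^ (i * N)) := by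
      rw [ENNReal.ofReal_pow (by norm_num)]; simp
    rw [this, h2, ← ENNReal.ofReal_mul (by positivity), ← ENNReal.ofReal_mul (by positivity)]
    congr 1
    rw [mul_add, pow_add, mul_one]
    have : (2 : ℝ) ^ (i * N) ≠ 0 := by positivity
    field_simp
    ring
  simp_rw [h]
  rw [ENNReal.tsum_mul_left, ENNReal.tsum_geometric, mul_comm]
  rw [ENNReal.one_sub_inv_two, inv_inv]

theorem volume_cube_dyadic (x : Eu n) {s : ℝ} (hs : 0 < s) (i : ℕ) :
    volume (cube x (2 ^ i / (2 * s))) = 2 ^ (i * n) * (ENNReal.ofReal s ^ n)⁻¹ := by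
  rw [volume_cube x (by positivity)]
  have : 2 * ((2 : ℝ) ^ i / (2 * s)) = 2 ^ i * s⁻¹ := by field_simp
  rw [this, ENNReal.ofReal_mul (by positivity), mul_pow, ENNReal.ofReal_pow (by norm_num),
    ENNReal.ofReal_inv_of_pos hs, ENNReal.inv_pow, pow_mul]
  simp

theorem ofReal_pow_ne_zero {s : ℝ} (hs : 0 < s) (n : ℕ) : ENNReal.ofReal s ^ n ≠ 0 :=
  pow_ne_zero _ (by simpa using hs)

/-- At unit scale the dyadic cubes around x have side 2^i ≥ 1, so the averages of |g| over large
cubes bound everything. -/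
theorem exists_enorm_lowS_one_le (φ : 𝓢(Eu n, ℂ)) : ∃ C : ℝ≥0∞, C ≠ ∞ ∧
    ∀ (g : 𝓢(Eu n, ℂ)) (x : Eu n), ‖lowS φ 1 one_pos g x‖ₑ ≤ C * bmoNorm g := by
  obtain ⟨C, hC0, hC⟩ := schwartz_decay (𝓕⁻ φ : 𝓢(Eu n, ℂ)) (n + 1)
  refine ⟨ENNReal.ofReal C * (2 * ENNReal.ofReal (4 ^ (n + 1))), by finiteness, fun g x => ?_⟩
  rw [lowS_apply]
  refine (enorm_integral_le_lintegral_enorm _).trans ?_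
  calc _ ≤ ∫⁻ y, ENNReal.ofReal C * (ENNReal.ofReal ((1 + 1 * ‖x - y‖) ^ (n + 1))⁻¹ * ‖g y‖ₑ) := by
        refine lintegral_mono fun y => ?_
        rw [enorm_mul, ← mul_assoc]
        gcongr
        simpa using enorm_kernel_le hC0 hC one_pos (x - y)
    _ ≤ ENNReal.ofReal C * ∑' i : ℕ, ENNReal.ofReal (4 ^ (n + 1) * (2 ^ (i * (n + 1)))⁻¹) *
          ∫⁻ y in cube x (2 ^ i / (2 * 1)), ‖g y‖ₑ := by
        rw [lintegral_const_mul' _ _ (by finiteness)]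
        gcongr
        exact lintegral_decay_mul_le (n + 1) one_pos x g.continuous.enorm.measurable
    _ ≤ ENNReal.ofReal C * ∑' i : ℕ, (ENNReal.ofReal (4 ^ (n + 1) * (2 ^ (i * (n + 1)))⁻¹) *
          2 ^ (i * n)) * bmoNorm g := by
        refine mul_le_mul_right (ENNReal.tsum_le_tsum fun i => ?_) _
        rw [mul_assoc]
        refine mul_le_mul_right ?_ _
        have hv := volume_cube_dyadic x one_pos i
        simp only [ENNReal.ofReal_one, one_pow, inv_one, mul_one] at hv ⊢
        rw [← hv]
        exact setLIntegral_cube_le g x (by positivity) (by rw [hv]; exact one_le_pow₀ (by norm_num))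
    _ ≤ _ := by
        rw [ENNReal.tsum_mul_right, mul_assoc]
        gcongr
        exact tsum_dyadic n

/-- The difference of the two kernels has integral zero, so the mean of g over the cube of side 1/s
may be subtracted. The volume of the i-th cube and its ratio to that cube each contribute 2^(in),
hence the decay exponent 2n + 1. -/
theorem exists_enorm_lowS_sub_le (φ : 𝓢(Eu n, ℂ)) : ∃ C : ℝ≥0∞, C ≠ ∞ ∧
    ∀ (g : 𝓢(Eu n, ℂ)) (s : ℝ) (hs : 1 ≤ s) (x : Eu n),
      ‖lowS φ (2 * s) (by positivity) g x - lowS φ s (by positivity) g x‖ₑ ≤ C * bmoNorm g := by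
  set k : 𝓢(Eu n, ℂ) := 𝓕⁻ φ with hk
  obtain ⟨C, hC0, hC⟩ := schwartz_decay k (2 * n + 1)
  refine ⟨(ENNReal.ofReal C * (2 ^ n + 1)) * (2 * (2 * ENNReal.ofReal (4 ^ (2 * n + 1)))),
    by finiteness, fun g s hs1 x => ?_⟩
  have hs : 0 < s := by linarith
  have h2s : 0 < 2 * s := by linarith
  set c := cubeMean g (cube x (1 / (2 * s))) with hc
  have hi : ∀ t : ℝ, 0 < t → Integrable fun y => ((t : ℂ) ^ n * k (t • (x - y))) * g y :=
    fun t ht => by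
      obtain ⟨Mg, hMg⟩ := schwartz_bdd g
      exact (integrable_kernel k ht x).mul_bdd (c := Mg) g.continuous.aestronglyMeasurable
        (Filter.Eventually.of_forall hMg)
  have hkey : lowS φ (2 * s) h2s g x - lowS φ s hs g x =
      ∫ y, ((((2 * s : ℝ) : ℂ) ^ n * k ((2 * s) • (x - y))) - ((s : ℂ) ^ n * k (s • (x - y)))) *
        (g y - c) := by
    have hic : ∀ t : ℝ, 0 < t → Integrable fun y => ((t : ℂ) ^ n * k (t • (x - y))) * c :=
      fun t ht => (integrable_kernel k ht x).mul_const c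
    have e : ∀ y, ((((2 * s : ℝ) : ℂ) ^ n * k ((2 * s) • (x - y))) - ((s : ℂ) ^ n * k (s • (x - y)))) *
        (g y - c) = ((((2 * s : ℝ) : ℂ) ^ n * k ((2 * s) • (x - y))) * g y -
          ((s : ℂ) ^ n * k (s • (x - y))) * g y) - ((((2 * s : ℝ) : ℂ) ^ n * k ((2 * s) • (x - y))) * c
          - ((s : ℂ) ^ n * k (s • (x - y))) * c) := fun y => by ring
    simp_rw [e]
    have i1 : Integrable fun y => (((2 * s : ℝ) : ℂ) ^ n * k ((2 * s) • (x - y))) * g y -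
        ((s : ℂ) ^ n * k (s • (x - y))) * g y := (hi _ h2s).sub (hi _ hs)
    have i2 : Integrable fun y => (((2 * s : ℝ) : ℂ) ^ n * k ((2 * s) • (x - y))) * c -
        ((s : ℂ) ^ n * k (s • (x - y))) * c := (hic _ h2s).sub (hic _ hs)
    rw [integral_sub i1 i2,
      integral_sub (hi _ h2s) (hi _ hs), integral_sub (hic _ h2s) (hic _ hs), integral_mul_const,
      integral_mul_const, integral_kernel k h2s, integral_kernel k hs, sub_self, sub_zero,
      lowS_apply, lowS_apply]
  rw [hkey]
  refine (enorm_integral_le_lintegral_enorm _).trans ?_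
  set A := ENNReal.ofReal C * (2 ^ n + 1) with hA
  set S := ENNReal.ofReal s ^ n with hS
  have hS0 : S ≠ 0 := ofReal_pow_ne_zero hs n
  have hSt : S ≠ ∞ := by finiteness
  have hker : ∀ y, ‖(((2 * s : ℝ) : ℂ) ^ n * k ((2 * s) • (x - y))) -
      ((s : ℂ) ^ n * k (s • (x - y)))‖ₑ ≤
      (A * S) * ENNReal.ofReal ((1 + s * ‖x - y‖) ^ (2 * n + 1))⁻¹ := fun y => by
    refine (enorm_sub_le).trans ?_
    have b1 := enorm_kernel_le hC0 hC h2s (x - y)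
    have b2 := enorm_kernel_le hC0 hC hs (x - y)
    have b3 : ENNReal.ofReal ((1 + 2 * s * ‖x - y‖) ^ (2 * n + 1))⁻¹ ≤
        ENNReal.ofReal ((1 + s * ‖x - y‖) ^ (2 * n + 1))⁻¹ := by
      gcongr
      linarith
    calc _ ≤ ENNReal.ofReal C * ENNReal.ofReal (2 * s) ^ n *
          ENNReal.ofReal ((1 + s * ‖x - y‖) ^ (2 * n + 1))⁻¹ + _ :=
          add_le_add (b1.trans (mul_le_mul_right b3 _)) b2
      _ = _ := by
          rw [ENNReal.ofReal_mul (by norm_num), mul_pow, hA, hS]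
          simp only [ENNReal.ofReal_ofNat]
          ring
  have hgc : Measurable fun y => ‖g y - c‖ₑ := by
    have : Continuous fun y => g y - c := g.continuous.sub continuous_const
    exact this.enorm.measurable
  calc _ ≤ ∫⁻ y, (A * S) * (ENNReal.ofReal ((1 + s * ‖x - y‖) ^ (2 * n + 1))⁻¹ * ‖g y - c‖ₑ) := by
        refine lintegral_mono fun y => ?_
        rw [enorm_mul, ← mul_assoc]
        gcongr
        exact hker y
    _ ≤ (A * S) * ∑' i : ℕ, ENNReal.ofReal (4 ^ (2 * n + 1) * (2 ^ (i * (2 * n + 1)))⁻¹) *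
          ∫⁻ y in cube x (2 ^ i / (2 * s)), ‖g y - c‖ₑ := by
        rw [lintegral_const_mul' _ _ (by finiteness)]
        gcongr
        exact lintegral_decay_mul_le (2 * n + 1) hs x hgc
    _ ≤ (A * S) * ∑' i : ℕ, (ENNReal.ofReal (4 ^ (2 * n + 1) * (2 ^ (i * (2 * n + 1)))⁻¹) *
          2 ^ (i * (2 * n))) * (2 * S⁻¹ * bmoNorm g) := by
        refine mul_le_mul_right (ENNReal.tsum_le_tsum fun i => ?_) _
        rw [mul_assoc]
        refine mul_le_mul_right ?_ _
        have h1 : 1 / (2 * s) ≤ 2 ^ i / (2 * s) := by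
          gcongr
          exact one_le_pow₀ (by norm_num)
        refine (setLIntegral_sub_cubeMean_le g.integrable x (by positivity) h1).trans (le_of_eq ?_)
        have v0 := volume_cube_dyadic x hs 0
        rw [pow_zero, zero_mul, pow_zero, one_mul] at v0
        rw [volume_cube_dyadic x hs, v0, inv_inv, ← hS]
        have : i * (2 * n) = i * n + i * n := by ring
        rw [this, pow_add]
        calc _ = 2 ^ (i * n) * 2 ^ (i * n) * (2 * S⁻¹ * (S⁻¹ * S) * bmoNorm g) := by ring
          _ = _ := by rw [ENNReal.inv_mul_cancel hS0 hSt, mul_one]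
    _ ≤ (A * S) * ((2 * ENNReal.ofReal (4 ^ (2 * n + 1))) * (2 * S⁻¹ * bmoNorm g)) := by
        rw [ENNReal.tsum_mul_right]
        gcongr
        exact tsum_dyadic (2 * n)
    _ = A * (2 * (2 * ENNReal.ofReal (4 ^ (2 * n + 1)))) * bmoNorm g * (S⁻¹ * S) := by ring
    _ = _ := by rw [ENNReal.inv_mul_cancel hS0 hSt, mul_one]

theorem lpS_zero (φ g : 𝓢(Eu n, ℂ)) : lpS φ 0 g = lowS φ 1 one_pos g := by
  rw [lpS, lowS]
  congr 2
  ext ξ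
  simp [psiS]

theorem lpS_succ (φ g : 𝓢(Eu n, ℂ)) (l : ℕ) : lpS φ (l + 1) g =
    lowS φ (2 ^ (l + 1)) (by positivity) g - lowS φ (2 ^ l) (by positivity) g := by
  rw [lpS, lowS, lowS, ← schwartz_fourierInv_sub]
  congr 1
  ext ξ
  simp only [psiS, mulS_apply, _root_.sub_apply]
  ring

/-- The Littlewood-Paley pieces of a function in `bmo` are bounded. -/
theorem exists_enorm_lpS_le (φ : 𝓢(Eu n, ℂ)) : ∃ C : ℝ≥0∞, C ≠ ∞ ∧
    ∀ (g : 𝓢(Eu n, ℂ)) (l : ℕ) (x : Eu n), ‖lpS φ l g x‖ₑ ≤ C * bmoNorm g := by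
  obtain ⟨C₁, hC₁, h₁⟩ := exists_enorm_lowS_one_le φ
  obtain ⟨C₂, hC₂, h₂⟩ := exists_enorm_lowS_sub_le φ
  refine ⟨C₁ + C₂, by finiteness, fun g l x => ?_⟩
  rw [add_mul]
  cases l with
  | zero => rw [lpS_zero]; exact (h₁ g x).trans le_self_add
  | succ l =>
    rw [lpS_succ, _root_.sub_apply]
    have := h₂ g (2 ^ l) (one_le_pow₀ (by norm_num)) x
    simp_rw [pow_succ']
    exact this.trans le_add_self

/-! ### Linearity and scaling of the trilinear form -/

theorem integral_comp_smul₃ (F : Eu n × Eu n × Eu n → ℂ) {a b : ℝ} (ha : 0 < a) (hb : 0 < b) :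
    ∫ z : Eu n × Eu n × Eu n, F (a⁻¹ • z.1, b⁻¹ • z.2.1, b⁻¹ • z.2.2) =
      ((a ^ n * (b ^ n * b ^ n) : ℝ) : ℂ) * ∫ z, F z := by
  let T : Eu n × Eu n × Eu n → Eu n × Eu n × Eu n :=
    fun z => (a⁻¹ • z.1, b⁻¹ • z.2.1, b⁻¹ • z.2.2)
  have hTm : Measurable T := by fun_prop
  have hTe : MeasurableEmbedding T := by
    refine (MeasurableEquiv.mk ⟨T, fun z => (a • z.1, b • z.2.1, b • z.2.2), fun z => ?_,
      fun z => ?_⟩ ?_ ?_).measurableEmbedding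
    · simp [T, smul_smul, ha.ne', hb.ne']
    · simp [T, smul_smul, ha.ne', hb.ne']
    · exact hTm
    · change Measurable fun z : Eu n × Eu n × Eu n => (a • z.1, b • z.2.1, b • z.2.2)
      fun_prop
  have hmap : Measure.map T volume =
      (ENNReal.ofReal (a ^ n * (b ^ n * b ^ n))) • (volume : Measure (Eu n × Eu n × Eu n)) := by
    ext s hs
    rw [Measure.map_apply hTm hs, Measure.smul_apply, smul_eq_mul,
      ← lintegral_indicator_one (hTm hs), ← lintegral_indicator_one hs]
    set f : Eu n × Eu n × Eu n → ℝ≥0∞ := s.indicator 1 with hf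
    have hfm : Measurable f := measurable_one.indicator hs
    have e : ∀ z, (T ⁻¹' s).indicator (1 : Eu n × Eu n × Eu n → ℝ≥0∞) z = f (T z) := fun z => rfl
    simp_rw [e]
    have h1 := lintegral_comp_smul_right (F := fun z => f (a⁻¹ • z.1, z.2.1, z.2.2))
      (hfm.comp (by fun_prop)) hb
    simp only at h1
    rw [h1]
    have h2 : ∫⁻ z : Eu n × Eu n × Eu n, f (a⁻¹ • z.1, z.2.1, z.2.2) =
        ENNReal.ofReal a ^ n * ∫⁻ z, f z := by
      have hm : Measurable fun z : Eu n × Eu n × Eu n => f (a⁻¹ • z.1, z.2.1, z.2.2) :=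
        hfm.comp (by fun_prop)
      rw [lintegral_prod₃ hfm, lintegral_prod₃ hm, ← lintegral_comp_inv_smul _ ha]
    rw [h2, ENNReal.ofReal_mul (by positivity), ENNReal.ofReal_mul (by positivity),
      ENNReal.ofReal_pow ha.le, ENNReal.ofReal_pow hb.le]
    ring
  have h := hTe.integral_map (μ := volume) F
  rw [hmap, integral_smul_measure, ENNReal.toReal_ofReal (by positivity), Complex.real_smul] at h
  exact h.symm

theorem integrable_wave_comp_smul (f g h : 𝓢(Eu n, ℂ)) {c : ℝ} (hc : 0 < c) :
    Integrable fun z : Eu n × Eu n × Eu n => wave f g h (z.1, c • z.2.1, c • z.2.2) := by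
  have hd : ∀ k : 𝓢(Eu n, ℂ), Integrable fun x => k (c • x) := fun k =>
    k.integrable.comp_smul hc.ne'
  have h1 : Integrable (fun z : Eu n × Eu n × Eu n =>
      h z.1 * (𝓕 f (c • z.2.1) * 𝓕 g (c • z.2.2))) :=
    h.integrable.mul_prod ((hd (𝓕 f)).mul_prod (hd (𝓕 g)))
  have h2 : Continuous (fun z : Eu n × Eu n × Eu n =>
      (ee (inner ℝ (c • z.2.1) z.1) * ee (inner ℝ (c • z.2.2) z.1))) := by
    have := continuous_ee
    fun_prop
  refine (h1.bdd_mul (c := 1) h2.aestronglyMeasurable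
    (Filter.Eventually.of_forall fun z => ?_)).congr (Filter.Eventually.of_forall fun z => ?_)
  · simp [norm_ee]
  · simp only [wave]; ring

theorem lam_comp_smul (u : Eu n × Eu n × Eu n → ℂ) (f g h : 𝓢(Eu n, ℂ)) {c : ℝ} (hc : 0 < c) :
    lam (fun z => u (z.1, c • z.2.1, c • z.2.2)) f g h =
      (((c ^ n * c ^ n)⁻¹ : ℝ) : ℂ) *
        ∫ z, u z * wave f g h (z.1, c⁻¹ • z.2.1, c⁻¹ • z.2.2) := by
  have h1 := integral_comp_smul₃ (fun z => u z * wave f g h (z.1, c⁻¹ • z.2.1, c⁻¹ • z.2.2))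
    one_pos (inv_pos.2 hc)
  simp only [inv_one, one_smul, inv_inv, one_pow, one_mul, smul_smul, inv_mul_cancel₀ hc.ne'] at h1
  rw [lam]
  convert h1 using 2
  rw [mul_inv, inv_pow]

theorem fourier_dilS (s : ℝ) (hs : 0 < s) (f : 𝓢(Eu n, ℂ)) (ξ : Eu n) :
    (𝓕 (dilS s hs f) : 𝓢(Eu n, ℂ)) ξ = (s : ℂ) ^ n * (𝓕 f : 𝓢(Eu n, ℂ)) (s • ξ) := by
  have h : ∀ (k : 𝓢(Eu n, ℂ)) (x : Eu n), (𝓕 k : 𝓢(Eu n, ℂ)) x = (𝓕⁻ k : 𝓢(Eu n, ℂ)) (-x) :=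
    fun k x => by rw [schwartz_fourier_ee, schwartz_fourierInv_ee]; simp
  rw [h, h, fourierInv_dilS, smul_neg]

theorem fourier_dilS_eq_zero {s : ℝ} (hs : 0 < s) {f : 𝓢(Eu n, ℂ)} {r : ℝ}
    (hf : ∀ ξ, r < ‖ξ‖ → 𝓕 f ξ = 0) {ξ : Eu n} (hξ : s⁻¹ * r < ‖ξ‖) : 𝓕 (dilS s hs f) ξ = 0 := by
  rw [fourier_dilS, hf, mul_zero]
  rw [norm_smul, Real.norm_of_nonneg hs.le]
  rwa [inv_mul_lt_iff₀ hs] at hξ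

/-- Opposite dilations of position and frequency preserve the phase. The two transforms contribute
s^(2n) and the Jacobian s^(-n). -/
theorem lam_dilS (v : Eu n × Eu n × Eu n → ℂ) (f g h : 𝓢(Eu n, ℂ)) {s : ℝ} (hs : 0 < s) :
    lam (fun z => v (s⁻¹ • z.1, s • z.2.1, s • z.2.2)) (dilS s hs f) (dilS s hs g) (dilS s hs h) =
      (s : ℂ) ^ n * lam v f g h := by
  have h1 := integral_comp_smul₃ (fun z => v z * wave f g h z) hs (inv_pos.2 hs)
  simp only [inv_inv] at h1
  have e : ∀ z : Eu n × Eu n × Eu n, v (s⁻¹ • z.1, s • z.2.1, s • z.2.2) *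
      wave (dilS s hs f) (dilS s hs g) (dilS s hs h) z = ((s : ℂ) ^ n * (s : ℂ) ^ n) *
      (v (s⁻¹ • z.1, s • z.2.1, s • z.2.2) *
        wave f g h (s⁻¹ • z.1, s • z.2.1, s • z.2.2)) := fun z => by
    have hin : ∀ ξ x : Eu n, inner ℝ (s • ξ) (s⁻¹ • x) = inner ℝ ξ x := fun ξ x => by
      rw [inner_smul_left, inner_smul_right]; simp [hs.ne']
    simp only [wave, dilS_apply, fourier_dilS, hin]
    ring
  rw [lam, lam]
  simp_rw [e]
  rw [integral_const_mul, h1, ← mul_assoc]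
  congr 1
  have : (s : ℂ) ≠ 0 := by exact_mod_cast hs.ne'
  push_cast
  rw [inv_pow]
  field_simp

section linear

variable {v : Eu n × Eu n × Eu n → ℂ} {M : ℝ}

theorem schwartz_fourier_sum_apply {ι : Type*} (s : Finset ι) (f : ι → 𝓢(Eu n, ℂ)) (ξ : Eu n) :
    (𝓕 (∑ i ∈ s, f i) : 𝓢(Eu n, ℂ)) ξ = ∑ i ∈ s, (𝓕 (f i) : 𝓢(Eu n, ℂ)) ξ := by
  have h := map_sum (FourierTransform.fourierCLM ℂ 𝓢(Eu n, ℂ)) f s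
  have h' : (𝓕 (∑ i ∈ s, f i) : 𝓢(Eu n, ℂ)) = ∑ i ∈ s, (𝓕 (f i) : 𝓢(Eu n, ℂ)) := h
  rw [h', _root_.sum_apply]

theorem lam_sum_left (hvm : AEStronglyMeasurable v) (hvb : ∀ z, ‖v z‖ ≤ M) {ι : Type*}
    (s : Finset ι) (f : ι → 𝓢(Eu n, ℂ)) (g h : 𝓢(Eu n, ℂ)) :
    lam v (∑ i ∈ s, f i) g h = ∑ i ∈ s, lam v (f i) g h := by
  simp only [lam]
  rw [← integral_finsetSum _ fun i _ => integrable_lam_integrand hvm hvb (f i) g h]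
  congr 1; ext z
  simp only [wave, schwartz_fourier_sum_apply, Finset.mul_sum, Finset.sum_mul]

theorem lam_sum_middle (hvm : AEStronglyMeasurable v) (hvb : ∀ z, ‖v z‖ ≤ M) {ι : Type*}
    (s : Finset ι) (f : 𝓢(Eu n, ℂ)) (g : ι → 𝓢(Eu n, ℂ)) (h : 𝓢(Eu n, ℂ)) :
    lam v f (∑ i ∈ s, g i) h = ∑ i ∈ s, lam v f (g i) h := by
  simp only [lam]
  rw [← integral_finsetSum _ fun i _ => integrable_lam_integrand hvm hvb f (g i) h]
  congr 1; ext z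
  simp only [wave, schwartz_fourier_sum_apply, Finset.mul_sum]

theorem lam_sum_right (hvm : AEStronglyMeasurable v) (hvb : ∀ z, ‖v z‖ ≤ M) {ι : Type*}
    (s : Finset ι) (f g : 𝓢(Eu n, ℂ)) (h : ι → 𝓢(Eu n, ℂ)) :
    lam v f g (∑ i ∈ s, h i : 𝓢(Eu n, ℂ)) = ∑ i ∈ s, lam v f g (h i) := by
  simp only [lam]
  rw [← integral_finsetSum _ fun i _ => integrable_lam_integrand hvm hvb f g (h i)]
  congr 1; ext z
  simp only [wave, _root_.sum_apply, Finset.mul_sum, Finset.sum_mul]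

theorem lam_sub_right (hvm : AEStronglyMeasurable v) (hvb : ∀ z, ‖v z‖ ≤ M)
    (f g h k : 𝓢(Eu n, ℂ)) :
    lam v f g (h - k : 𝓢(Eu n, ℂ)) = lam v f g h - lam v f g k := by
  simp only [lam]
  rw [← integral_sub (integrable_lam_integrand hvm hvb f g h)
    (integrable_lam_integrand hvm hvb f g k)]
  congr 1; ext z
  simp only [wave, _root_.sub_apply]; ring

theorem dilS_sum {ι : Type*} (s : Finset ι) (f : ι → 𝓢(Eu n, ℂ)) {r : ℝ} (hr : 0 < r) :
    dilS r hr (∑ i ∈ s, f i) = ∑ i ∈ s, dilS r hr (f i) := by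
  ext x
  simp only [dilS_apply, _root_.sum_apply]

end linear

/-! ### Dyadic blocks above a given scale -/

/-- Multipliers of the dyadic blocks: everything below frequency `2 ^ J` is collected in the block
with index `J`. -/
def blkMul (φ : 𝓢(Eu n, ℂ)) (J i : ℕ) : 𝓢(Eu n, ℂ) :=
  if i < J then 0 else if i = J then dilS (2 ^ J) (by positivity) φ else psiS φ i

/-- The dyadic blocks of `f`. -/
def blk (φ : 𝓢(Eu n, ℂ)) (J i : ℕ) (f : 𝓢(Eu n, ℂ)) : 𝓢(Eu n, ℂ) :=
  𝓕⁻ (mulS (blkMul φ J i) (𝓕 f))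

theorem fourier_blk_apply (φ : 𝓢(Eu n, ℂ)) (J i : ℕ) (f : 𝓢(Eu n, ℂ)) (ξ : Eu n) :
    𝓕 (blk φ J i f) ξ = blkMul φ J i ξ * 𝓕 f ξ := by
  simp [blk]

theorem fourier_lowS_apply (φ : 𝓢(Eu n, ℂ)) (s : ℝ) (hs : 0 < s) (f : 𝓢(Eu n, ℂ)) (ξ : Eu n) :
    𝓕 (lowS φ s hs f) ξ = dilS s hs φ ξ * 𝓕 f ξ := by
  simp [lowS]

theorem blk_zero (φ : 𝓢(Eu n, ℂ)) (l : ℕ) (g : 𝓢(Eu n, ℂ)) : blk φ 0 l g = lpS φ l g := by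
  rw [blk, lpS]
  congr 2
  rw [blkMul]
  cases l with
  | zero => ext; simp [psiS]
  | succ l => simp

theorem sum_blkMul (φ : 𝓢(Eu n, ℂ)) {J j : ℕ} (h : J ≤ j) (ξ : Eu n) :
    ∑ i ∈ Finset.range (j + 1), blkMul φ J i ξ = dilS (2 ^ j) (by positivity) φ ξ := by
  induction j, h using Nat.le_induction with
  | base =>
    rw [Finset.sum_range_succ, Finset.sum_eq_zero]
    · simp [blkMul]
    · intro i hi
      simp [blkMul, Finset.mem_range.1 hi]
  | succ j hj ih =>
    rw [Finset.sum_range_succ, ih, blkMul, if_neg (by omega), if_neg (by omega)]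
    simp [psiS]

theorem schwartz_fourier_injective {f g : 𝓢(Eu n, ℂ)}
    (h : ∀ ξ, (𝓕 f : 𝓢(Eu n, ℂ)) ξ = (𝓕 g : 𝓢(Eu n, ℂ)) ξ) : f = g := by
  have h1 : (𝓕 f : 𝓢(Eu n, ℂ)) = 𝓕 g := by ext ξ; exact h ξ
  have h2 := congrArg (fun k : 𝓢(Eu n, ℂ) => (𝓕⁻ k : 𝓢(Eu n, ℂ))) h1
  simpa using h2

theorem sum_blk (φ : 𝓢(Eu n, ℂ)) {J j : ℕ} (h : J ≤ j) (f : 𝓢(Eu n, ℂ)) :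
    ∑ i ∈ Finset.range (j + 1), blk φ J i f = lowS φ (2 ^ j) (by positivity) f := by
  refine schwartz_fourier_injective fun ξ => ?_
  rw [schwartz_fourier_sum_apply, fourier_lowS_apply, ← sum_blkMul φ h, Finset.sum_mul]
  exact Finset.sum_congr rfl fun i _ => fourier_blk_apply φ J i f ξ

theorem blkMul_eq_zero_of_lt {φ : 𝓢(Eu n, ℂ)} (hφ : IsLPGenerator φ) (J i : ℕ) {ξ : Eu n}
    (h : 2 ^ (i + 1) < ‖ξ‖) : blkMul φ J i ξ = 0 := by
  rw [blkMul]
  split_ifs with h1 h2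
  · rfl
  · subst h2
    exact dilS_eq_zero hφ _ (by rwa [← pow_succ'])
  · exact psiS_eq_zero hφ i h

theorem blkMul_eq_zero_of_le {φ : 𝓢(Eu n, ℂ)} (hφ : IsLPGenerator φ) {J i : ℕ} {ξ : Eu n}
    (hi : J < i + 1) (h : ‖ξ‖ ≤ 2 ^ i) : blkMul φ J (i + 1) ξ = 0 := by
  rw [blkMul, if_neg (by omega), if_neg (by omega), psiS, _root_.sub_apply,
    dilS_eq_one hφ _ h, dilS_eq_one hφ, sub_self]
  exact h.trans (pow_le_pow_right₀ (by norm_num) (by omega))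

theorem fourier_blk_eq_zero {φ : 𝓢(Eu n, ℂ)} (hφ : IsLPGenerator φ) (J i : ℕ) (f : 𝓢(Eu n, ℂ))
    {ξ : Eu n} (h : 2 ^ (i + 1) < ‖ξ‖) : 𝓕 (blk φ J i f) ξ = 0 := by
  rw [fourier_blk_apply, blkMul_eq_zero_of_lt hφ J i h, zero_mul]

theorem fourier_lowS_eq_zero {φ : 𝓢(Eu n, ℂ)} (hφ : IsLPGenerator φ) {s : ℝ} (hs : 0 < s)
    (f : 𝓢(Eu n, ℂ)) {ξ : Eu n} (h : 2 * s < ‖ξ‖) : 𝓕 (lowS φ s hs f) ξ = 0 := by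
  rw [fourier_lowS_apply, dilS_eq_zero hφ hs h, zero_mul]

theorem blk_eq_zero (φ : 𝓢(Eu n, ℂ)) {J i : ℕ} (h : i < J) (f : 𝓢(Eu n, ℂ)) :
    blk φ J i f = 0 := by
  refine schwartz_fourier_injective fun ξ => ?_
  rw [fourier_blk_apply, blkMul, if_pos h]
  have : (𝓕 (0 : 𝓢(Eu n, ℂ)) : 𝓢(Eu n, ℂ)) = 0 :=
    map_zero (FourierTransform.fourierCLM ℂ 𝓢(Eu n, ℂ))
  rw [this]; simp

theorem nrm2_sq_eq_fourier (f : 𝓢(Eu n, ℂ)) : nrm2 f ^ 2 = ∫⁻ ξ, ‖𝓕 f ξ‖ₑ ^ 2 := by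
  rw [nrm2_sq, integral_enorm_sq_fourier]

theorem exists_nrm2_lowS_le (φ : 𝓢(Eu n, ℂ)) : ∃ C : ℝ≥0∞, C ≠ ∞ ∧
    ∀ (s : ℝ) (hs : 0 < s) (f : 𝓢(Eu n, ℂ)), nrm2 (lowS φ s hs f) ≤ C * nrm2 f := by
  obtain ⟨c, hc⟩ := schwartz_bdd φ
  refine ⟨ENNReal.ofReal c, by finiteness, fun s hs f => ?_⟩
  rw [← sq_sqrt_ennreal (nrm2 (lowS φ s hs f)), ← sq_sqrt_ennreal (_ * _)]
  refine sqrt_le_sqrt_ennreal ?_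
  rw [mul_pow, nrm2_sq_eq_fourier, nrm2_sq_eq_fourier, ← lintegral_const_mul' _ _ (by finiteness)]
  refine lintegral_mono fun ξ => ?_
  rw [fourier_lowS_apply, enorm_mul, mul_pow]
  gcongr
  rw [← ofReal_norm]
  exact ENNReal.ofReal_le_ofReal (hc _)

/-- At most two terms are nonzero, and they are consecutive. Applied pointwise in frequency, where
only neighbouring multipliers overlap. -/
theorem tsum_le_two_mul {u : ℕ → ℝ≥0∞} {D : ℝ≥0∞} (hD : ∀ i, u i ≤ D)
    (h : ∀ i k, i + 2 ≤ k → u i = 0 ∨ u k = 0) : ∑' i, u i ≤ 2 * D := by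
  classical
  by_cases h0 : ∃ i, u i ≠ 0
  · set p := Nat.find h0
    have hp : u p ≠ 0 := Nat.find_spec h0
    have hlt : ∀ i < p, u i = 0 := fun i hi => not_not.1 (Nat.find_min h0 hi)
    rw [tsum_eq_sum (s := {p, p + 1})]
    · rw [Finset.sum_pair (by omega), two_mul]
      exact add_le_add (hD _) (hD _)
    · intro k hk
      simp only [Finset.mem_insert, Finset.mem_singleton, not_or] at hk
      rcases lt_or_ge k p with h1 | h1
      · exact hlt k h1
      · exact (h p k (by omega)).resolve_left hp
  · push Not at h0
    simp [h0]

/-- Almost orthogonality of the dyadic blocks. -/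
theorem exists_tsum_nrm2_blk_le {φ : 𝓢(Eu n, ℂ)} (hφ : IsLPGenerator φ) : ∃ C : ℝ≥0∞, C ≠ ∞ ∧
    ∀ (J : ℕ) (f : 𝓢(Eu n, ℂ)), ∑' i, nrm2 (blk φ J i f) ^ 2 ≤ C * nrm2 f ^ 2 := by
  obtain ⟨c, hc⟩ := schwartz_bdd φ
  have hc0 : 0 ≤ c := (norm_nonneg _).trans (hc 0)
  refine ⟨2 * ENNReal.ofReal (2 * c) ^ 2, by finiteness, fun J f => ?_⟩
  have hb : ∀ i ξ, ‖blkMul φ J i ξ‖ₑ ≤ ENNReal.ofReal (2 * c) := fun i ξ => by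
    rw [← ofReal_norm]
    refine ENNReal.ofReal_le_ofReal ?_
    rw [blkMul]
    split_ifs with h1 h2
    · simpa using hc0
    · exact (hc _).trans (by linarith)
    · cases i with
      | zero => exact (hc _).trans (by linarith)
      | succ i =>
        rw [psiS, _root_.sub_apply]
        refine (norm_sub_le _ _).trans ?_
        have a1 := hc (((2 : ℝ) ^ (i + 1))⁻¹ • ξ)
        have a2 := hc (((2 : ℝ) ^ i)⁻¹ • ξ)
        simp only [dilS_apply]
        linarith
  simp_rw [nrm2_sq_eq_fourier, fourier_blk_apply, enorm_mul, mul_pow]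
  rw [← lintegral_tsum, ← lintegral_const_mul' _ _ (by finiteness)]
  · refine lintegral_mono fun ξ => ?_
    rw [ENNReal.tsum_mul_right]
    refine mul_le_mul_left (tsum_le_two_mul (fun i => pow_le_pow_left' (hb i ξ) 2)
      fun i k hik => ?_) _
    obtain ⟨k, rfl⟩ : ∃ k', k = k' + 1 := ⟨k - 1, by omega⟩
    by_cases hJ : J < k + 1
    -- The multiplier of index k + 1 vanishes up to 2^k, and that of index i vanishes beyond 2^(i+1)
    -- ≤ 2^k.
    · rcases le_or_gt ‖ξ‖ (2 ^ k) with h1 | h1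
      · right
        simp [blkMul_eq_zero_of_le hφ hJ h1]
      · left
        rw [blkMul_eq_zero_of_lt hφ]
        · simp
        · exact (pow_le_pow_right₀ (by norm_num) (by omega)).trans_lt h1
    · left
      rw [blkMul, if_pos (by omega)]
      simp
  · intro i
    exact (((blkMul φ J i).continuous.enorm.measurable.pow_const _).mul
      ((𝓕 f).continuous.enorm.measurable.pow_const _)).aemeasurable

/-! ### Summation over the scales -/

/-- `(2 ^ ((1 - ρ) i))`, the relative frequency of the `i`-th dyadic block. -/
def rad (ρ : ℝ) (i : ℕ) : ℝ := 2 ^ ((1 - ρ) * i)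

/-- The growth factor of the estimates at a single scale. -/
def gro (n : ℕ) (ρ : ℝ) : ℝ≥0∞ := ENNReal.ofReal (2 ^ ((1 - ρ) * n / 6))

/-- The square root of the volume of a frequency ball of radius `2 ^ (k + 1)`. -/
def sqv (n k : ℕ) : ℝ≥0∞ := (ENNReal.ofReal (2 ^ (k + 1)) ^ n) ^ (1 / 2 : ℝ)

/-- The scaling factor `2 ^ (j ρ)`. -/
def dil (ρ : ℝ) (j : ℕ) : ℝ := 2 ^ ((j : ℝ) * ρ)

theorem dil_pos (ρ : ℝ) (j : ℕ) : 0 < dil ρ j := by unfold dil; positivity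

theorem rad_pos (ρ : ℝ) (i : ℕ) : 0 < rad ρ i := by unfold rad; positivity

theorem one_le_rad {ρ : ℝ} (hρ : ρ < 1) (i : ℕ) : 1 ≤ rad ρ i := by
  unfold rad
  exact Real.one_le_rpow (by norm_num) (mul_nonneg (by linarith) (by positivity))

theorem rad_le_rad {ρ : ℝ} (hρ : ρ < 1) {i j : ℕ} (h : i ≤ j) : rad ρ i ≤ rad ρ j := by
  unfold rad
  refine Real.rpow_le_rpow_of_exponent_le (by norm_num) ?_
  have : (i : ℝ) ≤ j := by exact_mod_cast h
  have : 0 ≤ 1 - ρ := by linarith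
  gcongr

/-- Dilation at scale j lowers the frequency 2^i to 2^(i-jρ), and i ≤ j gives i - jρ ≤ (1-ρ)i. The
resulting bound no longer depends on j. -/
theorem inv_dil_mul_le {ρ : ℝ} (hρ : 0 ≤ ρ) {i j : ℕ} (h : i ≤ j) :
    (dil ρ j)⁻¹ * 2 ^ i ≤ rad ρ i := by
  rw [inv_mul_le_iff₀ (dil_pos ρ j), dil, rad, ← Real.rpow_natCast, ← Real.rpow_add (by norm_num)]
  refine Real.rpow_le_rpow_of_exponent_le (by norm_num) ?_
  have : (i : ℝ) ≤ j := by exact_mod_cast h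
  nlinarith

theorem gro_ne_top (ρ : ℝ) : gro n ρ ≠ ∞ := ENNReal.ofReal_ne_top

theorem gro_ne_zero (ρ : ℝ) : gro n ρ ≠ 0 := by
  unfold gro; simp; positivity

theorem one_lt_gro {ρ : ℝ} (hn : 0 < n) (hρ : ρ < 1) : 1 < gro n ρ := by
  unfold gro
  rw [← ENNReal.ofReal_one]
  refine (ENNReal.ofReal_lt_ofReal_iff (by positivity)).2 ?_
  refine Real.one_lt_rpow (by norm_num) ?_
  have : (0 : ℝ) < n := by exact_mod_cast hn
  have : 0 < 1 - ρ := by linarith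
  positivity

/-- With the sixth root as unit all exponents are integers: square roots of `rad ρ i` to the power n
give `gro` to the power 3i, sixth roots give power i, and the order m contributes 3j. -/
theorem ofReal_rad_pow (ρ : ℝ) (i : ℕ) : ENNReal.ofReal (rad ρ i) ^ n = gro n ρ ^ (6 * i) := by
  rw [gro, rad, ← ENNReal.ofReal_pow (by positivity), ← ENNReal.ofReal_pow (by positivity),
    ← Real.rpow_natCast, ← Real.rpow_natCast, ← Real.rpow_mul (by norm_num),
    ← Real.rpow_mul (by norm_num)]
  congr 2
  push_cast
  ring

theorem ofReal_mul_rad_pow {c : ℝ} (hc : 0 ≤ c) (ρ : ℝ) (i : ℕ) :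
    ENNReal.ofReal (c * rad ρ i) ^ n = ENNReal.ofReal c ^ n * gro n ρ ^ (6 * i) := by
  rw [ENNReal.ofReal_mul hc, mul_pow, ofReal_rad_pow]

theorem pow_six_half (a : ℝ≥0∞) (i : ℕ) : (a ^ (6 * i)) ^ (1 / 2 : ℝ) = a ^ (3 * i) := by
  rw [show 6 * i = 3 * i * 2 by ring, pow_mul, sq_sqrt_ennreal]

theorem pow_six_sixth (a : ℝ≥0∞) (i : ℕ) : (a ^ (6 * i)) ^ (1 / 6 : ℝ) = a ^ i := by
  rw [show 6 * i = i * 6 by ring, pow_mul, ← ENNReal.rpow_natCast (a ^ i) 6, ← ENNReal.rpow_mul]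
  norm_num

theorem nrm2_dilS' (s : ℝ) (hs : 0 < s) (f : 𝓢(Eu n, ℂ)) :
    nrm2 (dilS s hs f) = (ENNReal.ofReal s ^ n) ^ (1 / 2 : ℝ) * nrm2 f := by
  rw [← sq_sqrt_ennreal (nrm2 (dilS s hs f)), nrm2_dilS, sqrt_mul_ennreal, sq_sqrt_ennreal]

/-- Reversing the order of summation factors out the last term and leaves part of the geometric
series in t⁻¹. -/
theorem sum_pow_le {t : ℝ≥0∞} (ht0 : t ≠ 0) (ht : t ≠ ∞) (j : ℕ) :
    ∑ l ∈ Finset.range (j + 1), t ^ l ≤ t ^ j * ∑' l : ℕ, t⁻¹ ^ l := by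
  rw [← Finset.sum_range_reflect]
  refine le_trans (le_of_eq ?_) (mul_le_mul_right
    (ENNReal.sum_le_tsum (f := fun l => t⁻¹ ^ l) (Finset.range (j + 1))) _)
  rw [Finset.mul_sum]
  refine Finset.sum_congr rfl fun l hl => ?_
  have hl' : l ≤ j := Nat.lt_succ_iff.1 (Finset.mem_range.1 hl)
  have h1 : j + 1 - 1 - l = j - l := by omega
  rw [h1]
  conv_rhs => rw [← Nat.sub_add_cancel hl', pow_add, mul_assoc, ← mul_pow,
    ENNReal.mul_inv_cancel ht0 ht, one_pow, mul_one]

theorem tsum_inv_pow_ne_top {t : ℝ≥0∞} (ht : 1 < t) : ∑' l : ℕ, t⁻¹ ^ l ≠ ∞ := by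
  rw [ENNReal.tsum_geometric]
  refine ENNReal.inv_ne_top.2 (tsub_pos_of_lt ?_).ne'
  exact ENNReal.inv_lt_one.2 ht

theorem fourier_dilS_blk_eq_zero {φ : 𝓢(Eu n, ℂ)} (hφ : IsLPGenerator φ) {ρ : ℝ} (hρ : 0 ≤ ρ)
    {J i j : ℕ} (h : i ≤ j) (f : 𝓢(Eu n, ℂ)) {ξ : Eu n} (hξ : 2 * rad ρ i < ‖ξ‖) :
    𝓕 (dilS (dil ρ j) (dil_pos ρ j) (blk φ J i f)) ξ = 0 := by
  refine fourier_dilS_eq_zero (dil_pos ρ j) (r := 2 ^ (i + 1))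
    (fun ζ hζ => fourier_blk_eq_zero hφ J i f hζ) ?_
  have := inv_dil_mul_le hρ h
  rw [pow_succ]
  linarith

theorem fourier_dilS_lowS_eq_zero {φ : 𝓢(Eu n, ℂ)} (hφ : IsLPGenerator φ) {ρ : ℝ} (hρ : 0 ≤ ρ)
    (j : ℕ) (f : 𝓢(Eu n, ℂ)) {ξ : Eu n} (hξ : 2 * rad ρ j < ‖ξ‖) :
    𝓕 (dilS (dil ρ j) (dil_pos ρ j) (lowS φ (2 ^ j) (by positivity) f)) ξ = 0 := by
  refine fourier_dilS_eq_zero (dil_pos ρ j) (r := 2 * 2 ^ j)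
    (fun ζ hζ => fourier_lowS_eq_zero hφ _ f hζ) ?_
  have := inv_dil_mul_le hρ (le_refl j)
  linarith

theorem one_le_two_pow_succ (k : ℕ) : (1 : ℝ) ≤ 2 ^ (k + 1) := one_le_pow₀ (by norm_num)

/-- Meant for scales at which K₀ exceeds the relative frequencies, so that localizing h would not
pay. Both frequency supports are paid for: f contributes `gro` to the power 3j, and the pieces of g
contribute powers 3l whose sum over l ≤ j is again of order 3j. There is no factor `sqv n k₀`. -/
theorem exists_low_bound (W : Windows n) {φ : 𝓢(Eu n, ℂ)} (hφ : IsLPGenerator φ) {ρ : ℝ}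
    (hn : 0 < n) (hρ₀ : 0 ≤ ρ) (hρ₁ : ρ < 1) : ∃ C : ℝ≥0∞, C ≠ ∞ ∧
    ∀ (j k₀ k₁ k₂ : ℕ) (v : Eu n × Eu n × Eu n → ℂ) (N : ℝ≥0∞),
      IsLocalSymbol W v (2 ^ (k₀ + 1)) (2 ^ (k₁ + 1)) (2 ^ (k₂ + 1)) N → ∀ f g h : 𝓢(Eu n, ℂ),
      ‖lam v (dilS (dil ρ j) (dil_pos ρ j) (lowS φ (2 ^ j) (by positivity) f))
        (dilS (dil ρ j) (dil_pos ρ j) (lowS φ (2 ^ j) (by positivity) g))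
        (dilS (dil ρ j) (dil_pos ρ j) h)‖ₑ ≤
      C * (N * (sqv n k₁ * sqv n k₂)) * gro n ρ ^ (6 * j) *
        (ENNReal.ofReal (dil ρ j) ^ n * (nrm2 f * bmoNorm g * nrm2 h)) := by
  obtain ⟨C₁, hC₁, hl⟩ := exists_enorm_lam_le W hφ
  obtain ⟨C₂, hC₂, hb⟩ := exists_enorm_lpS_le φ
  obtain ⟨C₃, hC₃, hf2⟩ := exists_nrm2_lowS_le φ
  set a := gro n ρ with ha
  have ha0 : a ≠ 0 := gro_ne_zero ρ
  have hat : a ≠ ∞ := gro_ne_top ρ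
  have ha1 : 1 < a := one_lt_gro hn hρ₁
  set A := ∑' l : ℕ, (a ^ 3)⁻¹ ^ l with hA
  have hAt : A ≠ ∞ := tsum_inv_pow_ne_top (one_lt_pow₀ ha1 (by norm_num))
  set D := (ENNReal.ofReal 2 ^ n) ^ (1 / 2 : ℝ) with hD
  have hDt : D ≠ ∞ := ENNReal.rpow_ne_top_of_nonneg (by norm_num) (by finiteness)
  refine ⟨C₁ * (D * D) * A * C₃ * C₂, by finiteness, fun j k₀ k₁ k₂ v N S f g h => ?_⟩
  obtain ⟨M, hM⟩ := S.bounded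
  set s := dil ρ j with hs
  have hs0 : 0 < s := dil_pos ρ j
  set F := dilS s hs0 (lowS φ (2 ^ j) (by positivity) f) with hF
  rw [← sum_blk φ (Nat.zero_le j) g, dilS_sum,
    lam_sum_middle S.continuous.aestronglyMeasurable hM]
  refine (enorm_sum_le _ _).trans ?_
  have hterm : ∀ l ∈ Finset.range (j + 1), ‖lam v F (dilS s hs0 (blk φ 0 l g)) (dilS s hs0 h)‖ₑ ≤
      (C₁ * (N * (sqv n k₁ * sqv n k₂)) * (D * D) * a ^ (3 * j) *
        (nrm2 F * (C₂ * bmoNorm g) * nrm2 (dilS s hs0 h))) * (a ^ 3) ^ l := by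
    intro l hlj
    have hlj' : l ≤ j := Nat.lt_succ_iff.1 (Finset.mem_range.1 hlj)
    refine (hl v _ _ _ (2 * rad ρ j) (2 * rad ρ l) N (C₂ * bmoNorm g) F _ _ S
      (one_le_two_pow_succ _) (one_le_two_pow_succ _) (by linarith [one_le_rad hρ₁ j])
      (by linarith [one_le_rad hρ₁ l]) (fun ξ hξ => fourier_dilS_lowS_eq_zero hφ hρ₀ j f hξ)
      (fun ξ hξ => fourier_dilS_blk_eq_zero hφ hρ₀ hlj' g hξ) (fun x => ?_)).trans (le_of_eq ?_)
    · rw [dilS_apply, blk_zero]; exact hb g l _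
    · rw [ofReal_mul_rad_pow (by norm_num), ofReal_mul_rad_pow (by norm_num), sqrt_mul_ennreal,
        sqrt_mul_ennreal, pow_six_half, pow_six_half, ← hD, ← ha, ← pow_mul]
      simp only [sqv]
      ring
  refine (Finset.sum_le_sum hterm).trans ?_
  rw [← Finset.mul_sum]
  refine (mul_le_mul_right (sum_pow_le (pow_ne_zero 3 ha0) (by finiteness) j) _).trans ?_
  rw [hF, nrm2_dilS', nrm2_dilS', ← hA]
  calc _ ≤ (C₁ * (N * (sqv n k₁ * sqv n k₂)) * (D * D) * a ^ (3 * j) *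
        ((ENNReal.ofReal s ^ n) ^ (1 / 2 : ℝ) * (C₃ * nrm2 f) * (C₂ * bmoNorm g) *
          ((ENNReal.ofReal s ^ n) ^ (1 / 2 : ℝ) * nrm2 h))) * ((a ^ 3) ^ j * A) := by
        gcongr
        exact hf2 _ _ f
    _ = (C₁ * (D * D) * A * C₃ * C₂) * (N * (sqv n k₁ * sqv n k₂)) * (a ^ (3 * j) * (a ^ 3) ^ j) *
        (((ENNReal.ofReal s ^ n) ^ (1 / 2 : ℝ) * (ENNReal.ofReal s ^ n) ^ (1 / 2 : ℝ)) *
          (nrm2 f * bmoNorm g * nrm2 h)) := by ring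
    _ = _ := by
        rw [sqrt_mul_self_ennreal (ENNReal.ofReal s ^ n), ← pow_mul, ← pow_add,
          show 3 * j + 3 * j = 6 * j by ring]

theorem lam_zero_right (v : Eu n × Eu n × Eu n → ℂ) (f g : 𝓢(Eu n, ℂ)) :
    lam v f g (0 : 𝓢(Eu n, ℂ)) = 0 := by
  simp [lam, wave]

/-- Frequencies of h up to 2^(j+3) matter; the shift by 3 gives f and h the same index range. The
three omitted blocks lie below the starting index and vanish. -/
theorem sum_blk_shift (φ : 𝓢(Eu n, ℂ)) {J j : ℕ} (h : J ≤ j) (f : 𝓢(Eu n, ℂ)) :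
    ∑ i ∈ Finset.range (j + 1), blk φ (J + 3) (i + 3) f =
      lowS φ (2 ^ (j + 3)) (by positivity) f := by
  rw [← sum_blk φ (by omega : J + 3 ≤ j + 3), Finset.sum_range_succ' _ (j + 3),
    Finset.sum_range_succ' _ (j + 2), Finset.sum_range_succ' _ (j + 1),
    blk_eq_zero φ (by omega : 0 < J + 3), blk_eq_zero φ (by omega : 0 + 1 < J + 3),
    blk_eq_zero φ (by omega : 0 + 1 + 1 < J + 3)]
  simp

theorem sixth_mul_pow_ennreal (x y z a : ℝ≥0∞) (i l m : ℕ) :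
    ((x * a ^ (6 * i)) * (y * a ^ (6 * l)) * (z * a ^ (6 * m))) ^ (1 / 6 : ℝ) =
      (x * y * z) ^ (1 / 6 : ℝ) * (a ^ i * a ^ l * a ^ m) := by
  have e : (x * a ^ (6 * i)) * (y * a ^ (6 * l)) * (z * a ^ (6 * m)) =
      (x * y * z) * (a ^ (6 * i) * a ^ (6 * l) * a ^ (6 * m)) := by ring
  have h0 : (0 : ℝ) ≤ 1 / 6 := by norm_num
  rw [e, ENNReal.mul_rpow_of_nonneg _ _ h0,
    ENNReal.mul_rpow_of_nonneg (a ^ (6 * i) * a ^ (6 * l)) _ h0,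
    ENNReal.mul_rpow_of_nonneg (a ^ (6 * i)) _ h0, pow_six_sixth, pow_six_sixth, pow_six_sixth]

/-- All three functions are split into dyadic blocks, and a triple (i, l, m) costs `gro` to the
power i + l + m. The sum over l is of order `gro` to the power j, while the weighted sums for f and
h are kept. Collecting all frequencies below index J in one block ensures that no block of h is
narrower than the spectrum of the symbol in x. -/
theorem exists_high_bound (W : Windows n) {φ : 𝓢(Eu n, ℂ)} (hφ : IsLPGenerator φ) {ρ : ℝ}
    (hn : 0 < n) (hρ₀ : 0 ≤ ρ) (hρ₁ : ρ < 1) : ∃ C : ℝ≥0∞, C ≠ ∞ ∧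
    ∀ (j J k₀ k₁ k₂ : ℕ) (v : Eu n × Eu n × Eu n → ℂ) (N : ℝ≥0∞),
      IsLocalSymbol W v (2 ^ (k₀ + 1)) (2 ^ (k₁ + 1)) (2 ^ (k₂ + 1)) N → J ≤ j →
      (k₀ : ℝ) ≤ (1 - ρ) * J → ∀ f g h : 𝓢(Eu n, ℂ),
      ‖lam v (dilS (dil ρ j) (dil_pos ρ j) (lowS φ (2 ^ j) (by positivity) f))
        (dilS (dil ρ j) (dil_pos ρ j) (lowS φ (2 ^ j) (by positivity) g))
        (dilS (dil ρ j) (dil_pos ρ j) h)‖ₑ ≤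
      C * (N * (sqv n k₁ * sqv n k₂)) * sqv n k₀ * gro n ρ ^ j *
        (ENNReal.ofReal (dil ρ j) ^ n *
          ((∑ i ∈ Finset.range (j + 1), gro n ρ ^ i * nrm2 (blk φ J i f)) * bmoNorm g *
          ∑ i ∈ Finset.range (j + 1), gro n ρ ^ i * nrm2 (blk φ (J + 3) (i + 3) h))) := by
  obtain ⟨C₁, hC₁, hl⟩ := exists_enorm_lam_le_of_support W hφ
  obtain ⟨C₂, hC₂, hb⟩ := exists_enorm_lpS_le φ
  set a := gro n ρ with ha
  have ha0 : a ≠ 0 := gro_ne_zero ρ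
  have hat : a ≠ ∞ := gro_ne_top ρ
  have ha1 : 1 < a := one_lt_gro hn hρ₁
  set A := ∑' l : ℕ, a⁻¹ ^ l with hA
  have hAt : A ≠ ∞ := tsum_inv_pow_ne_top ha1
  set D := (ENNReal.ofReal 2 ^ n * ENNReal.ofReal 2 ^ n * ENNReal.ofReal 16 ^ n) ^ (1 / 6 : ℝ)
    with hD
  have hDt : D ≠ ∞ := ENNReal.rpow_ne_top_of_nonneg (by norm_num) (by finiteness)
  refine ⟨C₁ * D * A * C₂, by finiteness, fun j J k₀ k₁ k₂ v N S hJ hk f g h => ?_⟩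
  obtain ⟨M, hM⟩ := S.bounded
  have hvm := S.continuous.aestronglyMeasurable (μ := volume)
  set s := dil ρ j with hs
  have hs0 : 0 < s := dil_pos ρ j
  -- The assumption on k₀ gives 2^k₀ ≤ `rad ρ J`, and `rad` is monotone.
  have hK₀ : ∀ m, J ≤ m → (2 : ℝ) ^ (k₀ + 1) ≤ 2 * rad ρ m := fun m hm => by
    rw [pow_succ']
    refine mul_le_mul_of_nonneg_left ((?_ : _ ≤ rad ρ J).trans (rad_le_rad hρ₁ hm)) (by norm_num)
    rw [rad, ← Real.rpow_natCast]
    exact Real.rpow_le_rpow_of_exponent_le (by norm_num) hk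
  -- After dilation f and g have frequencies at most 2·rad(j), and the symbol in x at most 2·rad(j).
  -- So h matters only up to 6·rad(j), that is 6·2^j ≤ 2^(j+3) before dilation.
  have hcut : lam v (dilS s hs0 (lowS φ (2 ^ j) (by positivity) f))
        (dilS s hs0 (lowS φ (2 ^ j) (by positivity) g)) (dilS s hs0 h) =
      lam v (dilS s hs0 (lowS φ (2 ^ j) (by positivity) f))
        (dilS s hs0 (lowS φ (2 ^ j) (by positivity) g))
        (dilS s hs0 (lowS φ (2 ^ (j + 3)) (by positivity) h)) := by
    rw [← sub_eq_zero, ← lam_sub_right hvm hM]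
    refine lam_eq_zero (K₀ := 2 ^ (k₀ + 1)) (r₁ := 2 * rad ρ j) (r₂ := 2 * rad ρ j) hvm hM S.band₀
      (fun ξ hξ => fourier_dilS_lowS_eq_zero hφ hρ₀ j f hξ)
      (fun ξ hξ => fourier_dilS_lowS_eq_zero hφ hρ₀ j g hξ) fun ξ hξ => ?_
    have e : dilS s hs0 h - dilS s hs0 (lowS φ (2 ^ (j + 3)) (by positivity) h) =
        dilS s hs0 (h - lowS φ (2 ^ (j + 3)) (by positivity) h) := by
      ext x; simp
    have e2 : (𝓕 (h - lowS φ (2 ^ (j + 3)) (by positivity) h) : 𝓢(Eu n, ℂ)) =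
        𝓕 h - 𝓕 (lowS φ (2 ^ (j + 3)) (by positivity) h) :=
      map_sub (FourierTransform.fourierCLM ℂ 𝓢(Eu n, ℂ)) _ _
    rw [e, fourier_dilS, e2, _root_.sub_apply, fourier_lowS_apply, dilS_eq_one hφ, one_mul,
      sub_self, mul_zero]
    rw [norm_smul, Real.norm_of_nonneg hs0.le]
    have h1 := hK₀ j hJ
    have h2 : s * rad ρ j = 2 ^ j := by
      rw [hs, dil, rad, ← Real.rpow_natCast, ← Real.rpow_add (by norm_num)]
      congr 1; ring
    have h3 : s * ‖ξ‖ ≤ s * (6 * rad ρ j) := by gcongr; linarith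
    have h4 : s * (6 * rad ρ j) = 6 * 2 ^ j := by rw [← h2]; ring
    rw [pow_add]
    have : (0 : ℝ) < 2 ^ j := by positivity
    linarith
  rw [hcut, ← sum_blk φ (Nat.zero_le j) g, ← sum_blk φ hJ f, ← sum_blk_shift φ hJ h, dilS_sum,
    dilS_sum, dilS_sum, lam_sum_left hvm hM]
  have hterm : ∀ i ∈ Finset.range (j + 1), ∀ m ∈ Finset.range (j + 1), ∀ l ∈ Finset.range (j + 1),
      ‖lam v (dilS s hs0 (blk φ J i f)) (dilS s hs0 (blk φ 0 l g))
        (dilS s hs0 (blk φ (J + 3) (m + 3) h))‖ₑ ≤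
      (C₁ * (N * (sqv n k₁ * sqv n k₂)) * sqv n k₀ * D * (ENNReal.ofReal s ^ n *
        ((a ^ i * nrm2 (blk φ J i f)) * (C₂ * bmoNorm g) *
          (a ^ m * nrm2 (blk φ (J + 3) (m + 3) h))))) * a ^ l := by
    intro i hi m hm l hlj
    rw [Finset.mem_range, Nat.lt_succ_iff] at hi hm hlj
    by_cases hmJ : m < J
    · have : dilS s hs0 (0 : 𝓢(Eu n, ℂ)) = 0 := by ext; simp
      rw [blk_eq_zero φ (by omega : m + 3 < J + 3), this, lam_zero_right]
      simp
    -- The block m + 3 of h has frequencies up to 2^(m+4) = 16·2^m, hence r₀ = 16·rad(m).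
    refine (hl v (2 ^ (k₀ + 1)) (2 ^ (k₁ + 1)) (2 ^ (k₂ + 1)) (16 * rad ρ m) (2 * rad ρ i)
      (2 * rad ρ l) N (C₂ * bmoNorm g) _ _ _ S
      (one_le_two_pow_succ _) (one_le_two_pow_succ _) (one_le_two_pow_succ _)
      (by linarith [one_le_rad hρ₁ i])
      (by linarith [one_le_rad hρ₁ l]) (by linarith [hK₀ m (not_lt.1 hmJ), rad_pos ρ m])
      (fun ξ hξ => fourier_dilS_blk_eq_zero hφ hρ₀ hi f hξ)
      (fun ξ hξ => fourier_dilS_blk_eq_zero hφ hρ₀ hlj g hξ)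
      (fun ξ hξ => ?_) (fun x => ?_)).trans (le_of_eq ?_)
    · refine fourier_dilS_eq_zero hs0 (r := 2 ^ (m + 3 + 1))
        (fun ζ hζ => fourier_blk_eq_zero hφ _ _ h hζ) ?_
      have := inv_dil_mul_le hρ₀ hm
      have e : (2 : ℝ) ^ (m + 3 + 1) = 16 * 2 ^ m := by rw [pow_add, pow_add]; ring
      rw [e]
      linarith
    · rw [dilS_apply, blk_zero]; exact hb g l _
    · rw [ofReal_mul_rad_pow (by norm_num), ofReal_mul_rad_pow (by norm_num),
        ofReal_mul_rad_pow (by norm_num), sixth_mul_pow_ennreal, ← hD, ← ha, nrm2_dilS',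
        nrm2_dilS']
      simp only [sqv]
      have hq := sqrt_mul_self_ennreal (ENNReal.ofReal s ^ n)
      generalize (ENNReal.ofReal s ^ n) ^ (1 / 2 : ℝ) = q at hq ⊢
      rw [← hq]
      ring
  set Z := C₁ * (N * (sqv n k₁ * sqv n k₂)) * sqv n k₀ * D with hZ
  calc _ ≤ ∑ i ∈ Finset.range (j + 1), ∑ m ∈ Finset.range (j + 1), ∑ l ∈ Finset.range (j + 1),
        ‖lam v (dilS s hs0 (blk φ J i f)) (dilS s hs0 (blk φ 0 l g))
        (dilS s hs0 (blk φ (J + 3) (m + 3) h))‖ₑ := by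
        refine (enorm_sum_le _ _).trans (Finset.sum_le_sum fun i _ => ?_)
        rw [lam_sum_right hvm hM]
        refine (enorm_sum_le _ _).trans (Finset.sum_le_sum fun m _ => ?_)
        rw [lam_sum_middle hvm hM]
        exact enorm_sum_le _ _
    _ ≤ ∑ i ∈ Finset.range (j + 1), ∑ m ∈ Finset.range (j + 1), ∑ l ∈ Finset.range (j + 1),
        (Z * (ENNReal.ofReal s ^ n *
        ((a ^ i * nrm2 (blk φ J i f)) * (C₂ * bmoNorm g) *
          (a ^ m * nrm2 (blk φ (J + 3) (m + 3) h))))) * a ^ l :=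
        Finset.sum_le_sum fun i hi => Finset.sum_le_sum fun m hm => Finset.sum_le_sum fun l hlj =>
          hterm i hi m hm l hlj
    _ = (Z * (ENNReal.ofReal s ^ n * ((∑ i ∈ Finset.range (j + 1), a ^ i * nrm2 (blk φ J i f)) *
          (C₂ * bmoNorm g) *
          ∑ m ∈ Finset.range (j + 1), a ^ m * nrm2 (blk φ (J + 3) (m + 3) h)))) *
          ∑ l ∈ Finset.range (j + 1), a ^ l := by
        simp_rw [← Finset.mul_sum, ← Finset.sum_mul, ← Finset.mul_sum, ← Finset.sum_mul]
    _ ≤ (Z * (ENNReal.ofReal s ^ n * ((∑ i ∈ Finset.range (j + 1), a ^ i * nrm2 (blk φ J i f)) *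
          (C₂ * bmoNorm g) *
          ∑ m ∈ Finset.range (j + 1), a ^ m * nrm2 (blk φ (J + 3) (m + 3) h)))) * (a ^ j * A) := by
        gcongr
        exact sum_pow_le ha0 hat j
    _ = _ := by rw [hZ]; ring

theorem sq_weighted_sum_le (s : Finset ℕ) (w x : ℕ → ℝ≥0∞) :
    (∑ i ∈ s, w i * x i) ^ 2 ≤ (∑ i ∈ s, w i) * ∑ i ∈ s, w i * x i ^ 2 := by
  have h := ENNReal.inner_le_weight_mul_Lp_of_nonneg s (p := 2) (by norm_num) w x
  have e : (1 : ℝ) - 2⁻¹ = 1 / 2 := by norm_num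
  have e' : (2 : ℝ)⁻¹ = 1 / 2 := by norm_num
  rw [e, e'] at h
  calc _ ≤ ((∑ i ∈ s, w i) ^ (1 / 2 : ℝ) * (∑ i ∈ s, w i * x i ^ (2 : ℝ)) ^ (1 / 2 : ℝ)) ^ 2 := by
        gcongr
    _ = _ := by
        rw [mul_pow, sqrt_sq_ennreal, sqrt_sq_ennreal]
        simp

theorem tsum_mul_le_sqrt_mul_sqrt (x y : ℕ → ℝ≥0∞) :
    ∑' i, x i * y i ≤ (∑' i, x i ^ 2) ^ (1 / 2 : ℝ) * (∑' i, y i ^ 2) ^ (1 / 2 : ℝ) := by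
  have := lintegral_mul_le_sqrt_mul_sqrt (m := Measure.count) (f := x) (g := y)
    (measurable_from_top).aemeasurable (measurable_from_top).aemeasurable
  simpa only [lintegral_count] using this

/-- Cauchy-Schwarz with weights a^i, of total mass about a^j, leaves the kernel a^(-(j-i)). Its sums
over j ≥ i are a convergent geometric series, as in Schur's test. -/
theorem tsum_sq_geometric_average_le {a : ℝ≥0∞} (ha : 1 < a) (hat : a ≠ ∞) (x : ℕ → ℝ≥0∞) :
    ∑' j, (a⁻¹ ^ j * ∑ i ∈ Finset.range (j + 1), a ^ i * x i) ^ 2 ≤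
      (∑' l : ℕ, a⁻¹ ^ l) ^ 2 * ∑' i, x i ^ 2 := by
  have ha0 : a ≠ 0 := (zero_lt_one.trans ha).ne'
  set A := ∑' l : ℕ, a⁻¹ ^ l with hA
  have hinv : ∀ j, a⁻¹ ^ j * a ^ j = 1 := fun j => by
    rw [← mul_pow, ENNReal.inv_mul_cancel ha0 hat, one_pow]
  have h1 : ∀ j, (a⁻¹ ^ j * ∑ i ∈ Finset.range (j + 1), a ^ i * x i) ^ 2 ≤
      A * ∑' i, if i ≤ j then a⁻¹ ^ (j - i) * x i ^ 2 else 0 := fun j => by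
    calc _ ≤ a⁻¹ ^ j * a⁻¹ ^ j * ((a ^ j * A) *
          ∑ i ∈ Finset.range (j + 1), a ^ i * x i ^ 2) := by
          rw [mul_pow, sq (a⁻¹ ^ j)]
          gcongr
          refine (sq_weighted_sum_le _ _ _).trans ?_
          gcongr
          exact sum_pow_le ha0 hat j
      _ = (a⁻¹ ^ j * a ^ j) * A * ∑ i ∈ Finset.range (j + 1), a⁻¹ ^ j * (a ^ i * x i ^ 2) := by
          rw [← Finset.mul_sum]; ring
      _ = A * ∑ i ∈ Finset.range (j + 1), if i ≤ j then a⁻¹ ^ (j - i) * x i ^ 2 else 0 := by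
          rw [hinv, one_mul]
          congr 1
          refine Finset.sum_congr rfl fun i hi => ?_
          have hi' : i ≤ j := Nat.lt_succ_iff.1 (Finset.mem_range.1 hi)
          rw [if_pos hi']
          conv_lhs => rw [← Nat.sub_add_cancel hi', pow_add, mul_assoc, ← mul_assoc (a⁻¹ ^ i), hinv,
            one_mul]
      _ ≤ _ := by
          gcongr
          exact ENNReal.sum_le_tsum _
  calc _ ≤ ∑' j, A * ∑' i, (if i ≤ j then a⁻¹ ^ (j - i) * x i ^ 2 else 0) :=
        ENNReal.tsum_le_tsum h1
    _ = A * ∑' i, ∑' j, (if i ≤ j then a⁻¹ ^ (j - i) * x i ^ 2 else 0) := by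
        rw [ENNReal.tsum_mul_left, ENNReal.tsum_comm]
    _ ≤ A * ∑' i, A * x i ^ 2 := by
        refine mul_le_mul_right (ENNReal.tsum_le_tsum fun i => ?_) _
        rw [← Summable.sum_add_tsum_nat_add' (k := i) ENNReal.summable]
        · rw [Finset.sum_eq_zero, zero_add]
          · simp [ENNReal.tsum_mul_right, hA]
          · intro j hj
            rw [if_neg (not_le.2 (Finset.mem_range.1 hj))]
    _ = _ := by rw [ENNReal.tsum_mul_left]; ring

theorem gro_pow_le_sqv {ρ : ℝ} {j k : ℕ} (h : (1 - ρ) * j ≤ k) : gro n ρ ^ (3 * j) ≤ sqv n k := by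
  rw [← pow_six_half, ← ofReal_rad_pow, sqv]
  gcongr
  rw [rad, ← Real.rpow_natCast]
  refine Real.rpow_le_rpow_of_exponent_le (by norm_num) ?_
  push_cast
  linarith

theorem sqv_ne_zero (k : ℕ) : sqv n k ≠ 0 := by
  unfold sqv
  rw [Ne, ENNReal.rpow_eq_zero_iff]
  simp

theorem sqv_ne_top (k : ℕ) : sqv n k ≠ ∞ :=
  ENNReal.rpow_ne_top_of_nonneg (by norm_num) (by finiteness)

/-- The low bound is used below the scale where 2^((1-ρ)j) reaches 2^k₀, the high bound from there
on. The constant does not depend on k₀; this carries the critical case s₀ = n/2. -/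
theorem exists_scale_sum_le (W : Windows n) {φ : 𝓢(Eu n, ℂ)} (hφ : IsLPGenerator φ) {ρ : ℝ}
    (hn : 0 < n) (hρ₀ : 0 ≤ ρ) (hρ₁ : ρ < 1) : ∃ C : ℝ≥0∞, C ≠ ∞ ∧
    ∀ (k₀ : ℕ) (v : ℕ → ℕ × ℕ → Eu n × Eu n × Eu n → ℂ) (N : ℕ → ℕ × ℕ → ℝ≥0∞) (β : ℝ≥0∞),
      (∀ j k, IsLocalSymbol W (v j k) (2 ^ (k₀ + 1)) (2 ^ (k.1 + 1)) (2 ^ (k.2 + 1)) (N j k)) →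
      (∀ j, (∑' k, N j k * (sqv n k.1 * sqv n k.2)) * sqv n k₀ * gro n ρ ^ (3 * j) ≤ β) →
      ∀ f g h : 𝓢(Eu n, ℂ),
      ∑' j, ∑' k, ‖lam (v j k) (dilS (dil ρ j) (dil_pos ρ j) (lowS φ (2 ^ j) (by positivity) f))
        (dilS (dil ρ j) (dil_pos ρ j) (lowS φ (2 ^ j) (by positivity) g))
        (dilS (dil ρ j) (dil_pos ρ j) h)‖ₑ * (ENNReal.ofReal (dil ρ j) ^ n)⁻¹ ≤
      C * β * (nrm2 f * bmoNorm g * nrm2 h) := by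
  obtain ⟨C₁, hC₁, hl⟩ := exists_low_bound W hφ hn hρ₀ hρ₁
  obtain ⟨C₂, hC₂, hh⟩ := exists_high_bound W hφ hn hρ₀ hρ₁
  obtain ⟨C₃, hC₃, hx⟩ := exists_tsum_nrm2_blk_le hφ
  set a := gro n ρ with ha
  have ha0 : a ≠ 0 := gro_ne_zero ρ
  have hat : a ≠ ∞ := gro_ne_top ρ
  have ha1 : 1 < a := one_lt_gro hn hρ₁
  set A := ∑' l : ℕ, (a ^ 3)⁻¹ ^ l with hA
  have hAt : A ≠ ∞ := tsum_inv_pow_ne_top (one_lt_pow₀ ha1 (by norm_num))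
  set B := ∑' l : ℕ, a⁻¹ ^ l with hB
  have hBt : B ≠ ∞ := tsum_inv_pow_ne_top ha1
  refine ⟨C₁ * A + C₂ * (B ^ 2 * C₃), by finiteness, fun k₀ v N β S hβ f g h => ?_⟩
  -- The first scale with (1-ρ)J ≥ k₀.
  set J := ⌈(k₀ : ℝ) / (1 - ρ)⌉₊ with hJ
  have hρ' : 0 < 1 - ρ := by linarith
  set Z := nrm2 f * bmoNorm g * nrm2 h with hZ
  set T := fun j => ∑' k, ‖lam (v j k)
    (dilS (dil ρ j) (dil_pos ρ j) (lowS φ (2 ^ j) (by positivity) f))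
    (dilS (dil ρ j) (dil_pos ρ j) (lowS φ (2 ^ j) (by positivity) g))
    (dilS (dil ρ j) (dil_pos ρ j) h)‖ₑ * (ENNReal.ofReal (dil ρ j) ^ n)⁻¹ with hT
  have hd : ∀ j (P : ℝ≥0∞), ENNReal.ofReal (dil ρ j) ^ n * P * (ENNReal.ofReal (dil ρ j) ^ n)⁻¹ = P :=
    fun j P => by
      rw [mul_right_comm, ENNReal.mul_inv_cancel, one_mul]
      · have := dil_pos ρ j
        positivity
      · finiteness
  have hsum : ∀ j (c P : ℝ≥0∞), ∑' k, c * (N j k * (sqv n k.1 * sqv n k.2)) * P =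
      c * (∑' k, N j k * (sqv n k.1 * sqv n k.2)) * P := fun j c P => by
    rw [ENNReal.tsum_mul_right, ENNReal.tsum_mul_left]
  set X := fun j => a⁻¹ ^ j * ∑ i ∈ Finset.range (j + 1), a ^ i * nrm2 (blk φ J i f) with hX
  set Y := fun j => a⁻¹ ^ j * ∑ i ∈ Finset.range (j + 1),
    a ^ i * nrm2 (blk φ (J + 3) (i + 3) h) with hY
  have hinv : ∀ j, a ^ j * a⁻¹ ^ j = 1 := fun j => by
    rw [← mul_pow, ENNReal.mul_inv_cancel ha0 hat, one_pow]
  -- Of the cost a^(6j), the factor a^(3j) together with `sqv n k₀` is covered by β. The excess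
  -- a^(3j) / `sqv n k₀` is summed below.
  have hlow : ∀ j, T j ≤ C₁ * β * Z * ((sqv n k₀)⁻¹ * (a ^ 3) ^ j) := fun j => by
    calc T j ≤ ∑' k, C₁ * (N j k * (sqv n k.1 * sqv n k.2)) * (a ^ (6 * j) * Z) := by
          refine ENNReal.tsum_le_tsum fun k => ?_
          refine (mul_le_mul_left (hl j k₀ k.1 k.2 (v j k) _ (S j k) f g h) _).trans (le_of_eq ?_)
          rw [← hZ, ← mul_assoc _ (ENNReal.ofReal (dil ρ j) ^ n),
            mul_comm _ (ENNReal.ofReal (dil ρ j) ^ n), mul_assoc (ENNReal.ofReal (dil ρ j) ^ n), hd]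
          ring
      _ = C₁ * (((∑' k, N j k * (sqv n k.1 * sqv n k.2)) * sqv n k₀ * a ^ (3 * j)) *
            ((sqv n k₀)⁻¹ * a ^ (3 * j)) * Z) := by
          rw [hsum]
          have e : sqv n k₀ * (sqv n k₀)⁻¹ = 1 :=
            ENNReal.mul_inv_cancel (sqv_ne_zero k₀) (sqv_ne_top k₀)
          calc _ = C₁ * (∑' k, N j k * (sqv n k.1 * sqv n k.2)) * (a ^ (6 * j) * Z) *
                (sqv n k₀ * (sqv n k₀)⁻¹) := by rw [e, mul_one]
            _ = _ := by ring
      _ ≤ C₁ * (β * ((sqv n k₀)⁻¹ * a ^ (3 * j)) * Z) := by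
          gcongr
          exact hβ j
      _ = _ := by rw [pow_mul]; ring
  -- Writing the weighted sums as a^j X j and a^j Y j turns the cost into `sqv n k₀` times a^(3j),
  -- which is exactly what β covers.
  have hhigh : ∀ j, J ≤ j → T j ≤ C₂ * β * bmoNorm g * (X j * Y j) := fun j hj => by
    have hk : (k₀ : ℝ) ≤ (1 - ρ) * J := by
      rw [mul_comm, ← div_le_iff₀ hρ']
      exact Nat.le_ceil _
    set F := ∑ i ∈ Finset.range (j + 1), a ^ i * nrm2 (blk φ J i f) with hF
    set H := ∑ i ∈ Finset.range (j + 1), a ^ i * nrm2 (blk φ (J + 3) (i + 3) h) with hH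
    calc T j ≤ ∑' k, C₂ * (N j k * (sqv n k.1 * sqv n k.2)) *
          (sqv n k₀ * a ^ j * (F * bmoNorm g * H)) := by
          refine ENNReal.tsum_le_tsum fun k => ?_
          refine (mul_le_mul_left (hh j J k₀ k.1 k.2 (v j k) _ (S j k) hj hk f g h) _).trans
            (le_of_eq ?_)
          rw [← hF, ← hH, ← mul_assoc _ (ENNReal.ofReal (dil ρ j) ^ n),
            mul_comm _ (ENNReal.ofReal (dil ρ j) ^ n), mul_assoc (ENNReal.ofReal (dil ρ j) ^ n), hd]
          ring
      _ = C₂ * (((∑' k, N j k * (sqv n k.1 * sqv n k.2)) * sqv n k₀ * a ^ (3 * j)) *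
            bmoNorm g * (X j * Y j)) := by
          rw [hsum]
          calc _ = C₂ * (∑' k, N j k * (sqv n k.1 * sqv n k.2)) *
              (sqv n k₀ * a ^ j * (F * bmoNorm g * H)) * ((a ^ j * a⁻¹ ^ j) * (a ^ j * a⁻¹ ^ j)) := by
                rw [hinv, mul_one, mul_one]
            _ = _ := by simp only [hX, hY, ← hF, ← hH]; ring
      _ ≤ C₂ * (β * bmoNorm g * (X j * Y j)) := by
          gcongr
          exact hβ j
      _ = _ := by ring
  -- The geometric sum is dominated by its last term J - 1, and (1-ρ)(J-1) ≤ k₀ makes that term at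
  -- most `sqv n k₀`.
  have hlowsum : ∑ j ∈ Finset.range J, (sqv n k₀)⁻¹ * (a ^ 3) ^ j ≤ A := by
    rcases Nat.eq_zero_or_pos J with h0 | h0
    · simp [h0]
    obtain ⟨J', hJ'⟩ := Nat.exists_eq_succ_of_ne_zero h0.ne'
    rw [hJ', Nat.succ_eq_add_one, ← Finset.mul_sum]
    have hlt : (1 - ρ) * J' ≤ k₀ := by
      rw [mul_comm, ← le_div_iff₀ hρ']
      exact (Nat.lt_ceil.1 (by rw [← hJ]; omega : J' < ⌈(k₀ : ℝ) / (1 - ρ)⌉₊)).le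
    calc _ ≤ (sqv n k₀)⁻¹ * ((a ^ 3) ^ J' * A) := by
          gcongr
          exact sum_pow_le (pow_ne_zero 3 ha0) (by finiteness) J'
      _ ≤ (sqv n k₀)⁻¹ * (sqv n k₀ * A) := by
          rw [← pow_mul]
          gcongr
          exact gro_pow_le_sqv hlt
      _ = A := by
          rw [← mul_assoc, ENNReal.inv_mul_cancel (sqv_ne_zero k₀) (sqv_ne_top k₀), one_mul]
  have hXY : ∑' j, X j * Y j ≤ B ^ 2 * C₃ * (nrm2 f * nrm2 h) := by
    have e : ∀ b : ℝ≥0∞, (B ^ 2 * (C₃ * b ^ 2)) ^ (1 / 2 : ℝ) = B * C₃ ^ (1 / 2 : ℝ) * b :=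
      fun b => by
        rw [sqrt_mul_ennreal, sqrt_mul_ennreal, sq_sqrt_ennreal, sq_sqrt_ennreal, mul_assoc]
    have h3 : ∑' i, nrm2 (blk φ (J + 3) (i + 3) h) ^ 2 ≤ C₃ * nrm2 h ^ 2 := by
      refine le_trans ?_ (hx (J + 3) h)
      exact ENNReal.tsum_comp_le_tsum_of_injective (add_left_injective 3)
        (fun i => nrm2 (blk φ (J + 3) i h) ^ 2)
    calc _ ≤ (∑' j, X j ^ 2) ^ (1 / 2 : ℝ) * (∑' j, Y j ^ 2) ^ (1 / 2 : ℝ) :=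
          tsum_mul_le_sqrt_mul_sqrt X Y
      _ ≤ (B ^ 2 * (C₃ * nrm2 f ^ 2)) ^ (1 / 2 : ℝ) * (B ^ 2 * (C₃ * nrm2 h ^ 2)) ^ (1 / 2 : ℝ) := by
          gcongr
          · exact (tsum_sq_geometric_average_le ha1 hat _).trans (mul_le_mul_right (hx J f) _)
          · exact (tsum_sq_geometric_average_le ha1 hat _).trans (mul_le_mul_right h3 _)
      _ = B ^ 2 * (C₃ ^ (1 / 2 : ℝ) * C₃ ^ (1 / 2 : ℝ)) * (nrm2 f * nrm2 h) := by
          rw [e, e]; ring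
      _ = _ := by rw [sqrt_mul_self_ennreal]
  calc ∑' j, T j = ∑ j ∈ Finset.range J, T j + ∑' j, T (j + J) :=
        (Summable.sum_add_tsum_nat_add' (k := J) ENNReal.summable).symm
    _ ≤ C₁ * β * Z * A + C₂ * β * bmoNorm g * (B ^ 2 * C₃ * (nrm2 f * nrm2 h)) := by
        refine add_le_add ?_ ?_
        · refine (Finset.sum_le_sum fun j _ => hlow j).trans ?_
          rw [← Finset.mul_sum]
          exact mul_le_mul_right hlowsum _
        · refine (ENNReal.tsum_le_tsum fun j => hhigh (j + J) (by omega)).trans ?_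
          rw [ENNReal.tsum_mul_left]
          refine mul_le_mul_right (le_trans ?_ hXY) _
          exact ENNReal.tsum_comp_le_tsum_of_injective (add_left_injective J)
            (fun j => X j * Y j)
    _ = _ := by rw [hZ]; ring


/-! ### Reduction of the operator to localized blocks -/

theorem fourierHat_eq (f : 𝓢(Eu n, ℂ)) (ξ : Eu n) :
    fourierHat f ξ = (𝓕 f : 𝓢(Eu n, ℂ)) ((2 * Real.pi)⁻¹ • ξ) := by
  rw [schwartz_fourier_ee, fourierHat]
  congr 1; ext x
  rw [ee_eq_exp]
  congr 2
  rw [inner_smul_right]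
  push_cast
  have : (Real.pi : ℂ) ≠ 0 := by exact_mod_cast Real.pi_ne_zero
  field_simp

theorem bilinOp_mul_eq (σ : Eu n × Eu n × Eu n → ℂ) (f g : 𝓢(Eu n, ℂ)) (h : Eu n → ℂ) (x : Eu n) :
    bilinOp σ f g x * h x = ((2 * Real.pi : ℝ) : ℂ)⁻¹ ^ (2 * n) * ∫ p : Eu n × Eu n,
      σ (x, p) * wave f g h (x, (2 * Real.pi)⁻¹ • p.1, (2 * Real.pi)⁻¹ • p.2) := by
  rw [bilinOp, mul_assoc, ← integral_mul_const]
  congr 2; ext p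
  rw [fourierHat_eq, fourierHat_eq, wave, inner_add_right]
  have e : Complex.exp (Complex.I * ((inner ℝ x p.1 + inner ℝ x p.2 : ℝ) : ℂ)) =
      ee (inner ℝ ((2 * Real.pi)⁻¹ • p.1) x) * ee (inner ℝ ((2 * Real.pi)⁻¹ • p.2) x) := by
    rw [← ee_add, ee_eq_exp, inner_smul_left, inner_smul_left, real_inner_comm x,
      real_inner_comm x]
    congr 1
    have : (Real.pi : ℂ) ≠ 0 := by exact_mod_cast Real.pi_ne_zero
    simp
    field_simp
  rw [e]
  ring

theorem integrable_mul_wave_comp_smul {σ : Eu n × Eu n × Eu n → ℂ} {M : ℝ} (hσ : Measurable σ)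
    (hM : ∀ z, ‖σ z‖ ≤ M) (f g h : 𝓢(Eu n, ℂ)) {c : ℝ} (hc : 0 < c) :
    Integrable fun z : Eu n × Eu n × Eu n => σ z * wave f g h (z.1, c • z.2.1, c • z.2.2) :=
  (integrable_wave_comp_smul f g h hc).bdd_mul hσ.aestronglyMeasurable
    (Eventually.of_forall hM)

/-- Fubini and the change of variables ξ ↦ 2πξ, η ↦ 2πη, which absorbs the factor (2π)^(-2n) and
passes to the normalization of 𝓕. -/
theorem integral_bilinOp_mul {σ : Eu n × Eu n × Eu n → ℂ} {M : ℝ} (hσ : Measurable σ)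
    (hM : ∀ z, ‖σ z‖ ≤ M) (f g h : 𝓢(Eu n, ℂ)) :
    ∫ x, bilinOp σ f g x * h x =
      lam (fun z => σ (z.1, (2 * Real.pi) • z.2.1, (2 * Real.pi) • z.2.2)) f g h := by
  have hi := integrable_mul_wave_comp_smul hσ hM f g h (inv_pos.2 two_pi_pos)
  rw [lam_comp_smul σ f g h two_pi_pos]
  rw [Measure.volume_eq_prod] at hi ⊢
  rw [integral_prod _ hi]
  simp_rw [bilinOp_mul_eq]
  rw [integral_const_mul]
  congr 1
  push_cast
  rw [← pow_add, inv_pow, two_mul n]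

section pieces

variable {F : Type*} [NormedAddCommGroup F] [NormedSpace ℝ F]

theorem sum_lpPiece (Φ : SchwartzMap F ℂ) (J : ℕ) (ζ : F) :
    ∑ j ∈ Finset.range (J + 1), lpPiece Φ j ζ = Φ (((2 : ℝ) ^ J)⁻¹ • ζ) := by
  induction J with
  | zero => simp [lpPiece]
  | succ J ih =>
    rw [Finset.sum_range_succ, ih, lpPiece]
    have e : (2 : ℝ) • ((2 : ℝ) ^ (J + 1))⁻¹ • ζ = ((2 : ℝ) ^ J)⁻¹ • ζ := by
      rw [smul_smul, pow_succ]
      congr 1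
      field_simp
    rw [e]
    ring

theorem continuous_lpPiece (Φ : SchwartzMap F ℂ) (j : ℕ) : Continuous (lpPiece Φ j) := by
  have := Φ.continuous
  cases j with
  | zero => exact this
  | succ j =>
    change Continuous fun ζ => Φ (((2 : ℝ) ^ (j + 1))⁻¹ • ζ) -
      Φ ((2 : ℝ) • ((2 : ℝ) ^ (j + 1))⁻¹ • ζ)
    fun_prop

theorem exists_norm_lpPiece_le (Φ : SchwartzMap F ℂ) (j : ℕ) : ∃ C, ∀ ζ, ‖lpPiece Φ j ζ‖ ≤ C := by
  have hC := Φ.norm_le_seminorm ℝ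
  cases j with
  | zero => exact ⟨_, hC⟩
  | succ j => exact ⟨_, fun ζ => (norm_sub_le _ _).trans (add_le_add (hC _) (hC _))⟩

theorem lpPiece_eq_zero {Φ : SchwartzMap F ℂ} (hΦ : IsLPGenerator Φ) (j : ℕ) {ζ : F}
    (h : 2 ^ (j + 1) < ‖ζ‖) : lpPiece Φ j ζ = 0 := by
  cases j with
  | zero => exact hΦ.eq_zero (by simpa using h)
  | succ j =>
    have h1 : 2 < ‖((2 : ℝ) ^ (j + 1))⁻¹ • ζ‖ := by
      rw [norm_smul, norm_inv, Real.norm_of_nonneg (by positivity),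
        lt_inv_mul_iff₀ (by positivity)]
      rwa [pow_succ] at h
    rw [lpPiece, hΦ.eq_zero h1, hΦ.eq_zero, sub_zero]
    rw [norm_smul, Real.norm_of_nonneg (by norm_num)]
    linarith

end pieces

/-- The frequency cut-off in the symbol variables. -/
def freqCut (Φ : SchwartzMap (WithLp 2 (Eu n × Eu n)) ℂ) (j : ℕ) (z : Eu n × Eu n × Eu n) : ℂ :=
  lpPiece Φ j (WithLp.toLp 2 ((2 * Real.pi) • z.2.1, (2 * Real.pi) • z.2.2))

theorem continuous_freqCut (Φ : SchwartzMap (WithLp 2 (Eu n × Eu n)) ℂ) (j : ℕ) :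
    Continuous (freqCut Φ j) := by
  have h1 := continuous_lpPiece Φ j
  have h2 := WithLp.prod_continuous_toLp 2 (Eu n) (Eu n)
  exact h1.comp (h2.comp (by fun_prop))

/-- The cut-offs telescope to Φ(·/2^J), which tends to 1 boundedly, so dominated convergence
recovers the form. -/
theorem enorm_lam_le_tsum_freqCut {Φ : SchwartzMap (WithLp 2 (Eu n × Eu n)) ℂ}
    (hΦ : IsLPGenerator Φ) {v : Eu n × Eu n × Eu n → ℂ} {M : ℝ} (hv : Measurable v)
    (hM : ∀ z, ‖v z‖ ≤ M) (f g h : 𝓢(Eu n, ℂ)) :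
    ‖lam v f g h‖ₑ ≤ ∑' j, ‖lam (fun z => v z * freqCut Φ j z) f g h‖ₑ := by
  have hM0 : 0 ≤ M := (norm_nonneg _).trans (hM 0)
  have hint := integrable_lam_integrand hv.aestronglyMeasurable hM f g h
  have hj : ∀ j, Integrable fun z => v z * freqCut Φ j z * wave f g h z := fun j => by
    obtain ⟨C, hC⟩ := exists_norm_lpPiece_le Φ j
    refine integrable_lam_integrand (M := M * C)
      (hv.mul (continuous_freqCut Φ j).measurable).aestronglyMeasurable (fun z => ?_) f g h
    rw [Pi.mul_apply, norm_mul]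
    exact mul_le_mul (hM z) (hC _) (norm_nonneg _) hM0
  have hs : ∀ J, ∑ j ∈ Finset.range (J + 1), lam (fun z => v z * freqCut Φ j z) f g h =
      ∫ z : Eu n × Eu n × Eu n, Φ (((2 : ℝ) ^ J)⁻¹ •
        WithLp.toLp 2 ((2 * Real.pi) • z.2.1, (2 * Real.pi) • z.2.2)) * (v z * wave f g h z) :=
    fun J => by
      simp only [lam]
      rw [← integral_finsetSum _ fun j _ => hj j]
      congr 1; ext z
      rw [← sum_lpPiece, Finset.sum_mul]
      exact Finset.sum_congr rfl fun j _ => by rw [freqCut]; ring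
  have hpow : Tendsto (fun J : ℕ => ((2 : ℝ) ^ J)⁻¹) atTop (𝓝 0) := by
    simp_rw [← inv_pow]
    exact tendsto_pow_atTop_nhds_zero_of_lt_one (by norm_num) (by norm_num)
  have hlim : Tendsto (fun J : ℕ => ∫ z : Eu n × Eu n × Eu n, Φ (((2 : ℝ) ^ J)⁻¹ •
      WithLp.toLp 2 ((2 * Real.pi) • z.2.1, (2 * Real.pi) • z.2.2)) * (v z * wave f g h z)) atTop
      (𝓝 (lam v f g h)) := by
    rw [lam]
    have hC := Φ.norm_le_seminorm ℝ
    have h2 : Continuous fun z : Eu n × Eu n × Eu n =>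
        WithLp.toLp 2 ((2 * Real.pi) • z.2.1, (2 * Real.pi) • z.2.2) :=
      (WithLp.prod_continuous_toLp 2 (Eu n) (Eu n)).comp (by fun_prop)
    refine tendsto_integral_of_dominated_convergence
      (fun z => SchwartzMap.seminorm ℝ 0 0 Φ * ‖v z * wave f g h z‖) (fun J => ?_)
      (hint.norm.const_mul _) (fun J => Eventually.of_forall fun z => ?_)
      (Eventually.of_forall fun z => ?_)
    · refine AEStronglyMeasurable.mul ?_ hint.1
      exact (Φ.continuous.comp (h2.const_smul ((2 : ℝ) ^ J)⁻¹)).aestronglyMeasurable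
    · rw [norm_mul]
      exact mul_le_mul_of_nonneg_right (hC _) (norm_nonneg _)
    · have h0 : Φ 0 = 1 := hΦ.eq_one 0 (by simp)
      have h3 := (Φ.continuous.tendsto 0).comp (by
        simpa using hpow.smul_const (WithLp.toLp 2 ((2 * Real.pi) • z.2.1, (2 * Real.pi) • z.2.2)) :
        Tendsto (fun J : ℕ => ((2 : ℝ) ^ J)⁻¹ •
          WithLp.toLp 2 ((2 * Real.pi) • z.2.1, (2 * Real.pi) • z.2.2)) atTop (𝓝 0))
      rw [h0] at h3
      simpa using h3.mul_const (v z * wave f g h z)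
  refine le_of_tendsto hlim.enorm (Eventually.of_forall fun J => ?_)
  rw [← hs]
  exact (enorm_sum_le _ _).trans (ENNReal.sum_le_tsum _)

/-- On the support of the cut-off 2π‖ξ‖ ≤ 2^(j+1), hence ‖ξ‖ ≤ 2^j because 2π ≥ 2, and there
φ(·/2^j) equals 1. The same holds for η. -/
theorem lam_freqCut_eq {φ : 𝓢(Eu n, ℂ)} (hφ : IsLPGenerator φ)
    {Φ : SchwartzMap (WithLp 2 (Eu n × Eu n)) ℂ} (hΦ : IsLPGenerator Φ)
    (v : Eu n × Eu n × Eu n → ℂ) (j : ℕ) (f g h : 𝓢(Eu n, ℂ)) :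
    lam (fun z => v z * freqCut Φ j z) f g h =
      lam (fun z => v z * freqCut Φ j z) (lowS φ (2 ^ j) (by positivity) f)
        (lowS φ (2 ^ j) (by positivity) g) h := by
  simp only [lam]
  congr 1; ext z
  by_cases h0 : freqCut Φ j z = 0
  · simp [h0]
  have hz : ‖WithLp.toLp 2 ((2 * Real.pi) • z.2.1, (2 * Real.pi) • z.2.2)‖ ≤ 2 ^ (j + 1) := by
    by_contra hc
    exact h0 (lpPiece_eq_zero hΦ j (not_le.1 hc))
  have hpi : 2 ≤ 2 * Real.pi := by linarith [Real.pi_gt_three]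
  have key : ∀ ξ : Eu n, ‖(2 * Real.pi) • ξ‖ ≤ 2 ^ (j + 1) → ‖ξ‖ ≤ 2 ^ j := fun ξ hξ => by
    rw [norm_smul, Real.norm_of_nonneg (by positivity), pow_succ'] at hξ
    have := mul_le_mul_of_nonneg_right hpi (norm_nonneg ξ)
    linarith
  have h1 := key z.2.1 ((WithLp.norm_fst_le _
    (WithLp.toLp 2 ((2 * Real.pi) • z.2.1, (2 * Real.pi) • z.2.2))).trans hz)
  have h2 := key z.2.2 ((WithLp.norm_snd_le _
    (WithLp.toLp 2 ((2 * Real.pi) • z.2.1, (2 * Real.pi) • z.2.2))).trans hz)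
  simp only [wave, fourier_lowS_apply, dilS_eq_one hφ _ h1, dilS_eq_one hφ _ h2, one_mul]

theorem lam_scaledSymbol (Φ : SchwartzMap (WithLp 2 (Eu n × Eu n)) ℂ) (ρ : ℝ) (j : ℕ)
    (σ : Eu n × Eu n × Eu n → ℂ) (f g h : 𝓢(Eu n, ℂ)) :
    lam (fun z => scaledSymbol Φ ρ j σ (z.1, (2 * Real.pi) • z.2.1, (2 * Real.pi) • z.2.2))
        (dilS (dil ρ j) (dil_pos ρ j) f) (dilS (dil ρ j) (dil_pos ρ j) g)
        (dilS (dil ρ j) (dil_pos ρ j) h) =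
      (dil ρ j : ℂ) ^ n *
        lam (fun z => σ (z.1, (2 * Real.pi) • z.2.1, (2 * Real.pi) • z.2.2) * freqCut Φ j z) f g h := by
  rw [← lam_dilS _ f g h (dil_pos ρ j)]
  congr 1; ext z
  have e : (2 : ℝ) ^ (-((j : ℝ) * ρ)) = (dil ρ j)⁻¹ := Real.rpow_neg (by norm_num) _
  have e' : (2 : ℝ) ^ ((j : ℝ) * ρ) = dil ρ j := rfl
  simp only [scaledSymbol, freqCut, e, e', smul_comm (dil ρ j)]

theorem measurable_scaledSymbol (Φ : SchwartzMap (WithLp 2 (Eu n × Eu n)) ℂ) (ρ : ℝ) (j : ℕ)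
    {σ : Eu n × Eu n × Eu n → ℂ} (hσ : Measurable σ) : Measurable (scaledSymbol Φ ρ j σ) := by
  have h1 := continuous_lpPiece Φ j
  have h2 := WithLp.prod_continuous_toLp 2 (Eu n) (Eu n)
  refine Measurable.mul (hσ.comp (by fun_prop)) ?_
  exact (h1.comp (h2.comp (by fun_prop))).measurable

theorem exists_norm_scaledSymbol_le (Φ : SchwartzMap (WithLp 2 (Eu n × Eu n)) ℂ) (ρ : ℝ) (j : ℕ)
    {σ : Eu n × Eu n × Eu n → ℂ} {M : ℝ} (hM : ∀ z, ‖σ z‖ ≤ M) :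
    ∃ C, ∀ z, ‖scaledSymbol Φ ρ j σ z‖ ≤ C := by
  obtain ⟨C, hC⟩ := exists_norm_lpPiece_le Φ j
  refine ⟨M * C, fun z => ?_⟩
  rw [scaledSymbol, norm_mul]
  exact mul_le_mul (hM _) (hC _) (norm_nonneg _) ((norm_nonneg _).trans (hM 0))

theorem enorm_lam_le_tsum_lpBlock {φ : 𝓢(Eu n, ℂ)} (hφ : IsLPGenerator φ)
    {τ : Eu n × Eu n × Eu n → ℂ} {M : ℝ} (hτ : Measurable τ) (hM : ∀ z, ‖τ z‖ ≤ M)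
    (f g h : 𝓢(Eu n, ℂ)) :
    ‖lam (fun z => τ (z.1, (2 * Real.pi) • z.2.1, (2 * Real.pi) • z.2.2)) f g h‖ₑ ≤
      ∑' k₀ : ℕ, ∑' k : ℕ × ℕ, ‖lam (fun z => lpBlock φ k₀ k.1 k.2 τ
        (z.1, (2 * Real.pi) • z.2.1, (2 * Real.pi) • z.2.2)) f g h‖ₑ := by
  simp_rw [lam_comp_smul _ f g h two_pi_pos, enorm_mul, ENNReal.tsum_mul_left]
  exact mul_le_mul_right (enorm_integral_mul_le_tsum hφ hτ hM
    (integrable_wave_comp_smul f g h (inv_pos.2 two_pi_pos))) _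

theorem sqv_eq_ofReal (k : ℕ) : sqv n k = ENNReal.ofReal (2 ^ (((k : ℝ) + 1) * n / 2)) := by
  rw [sqv, ← ENNReal.ofReal_pow (by positivity), ENNReal.ofReal_rpow_of_pos (by positivity),
    ← Real.rpow_natCast, ← Real.rpow_natCast, ← Real.rpow_mul (by positivity),
    ← Real.rpow_mul (by positivity)]
  congr 2
  push_cast
  ring

/-- The product on the left is 2 to the power (k₀+k₁+k₂+3)n/2 + j(1-ρ)n/2. The hypotheses s_i ≥ n/2
compare it with the weight of the class, and the three shifts by one give the constant 2^(3n/2). -/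
theorem weight_le {ρ s₀ s₁ s₂ : ℝ} (hs₀ : (n : ℝ) / 2 ≤ s₀) (hs₁ : (n : ℝ) / 2 ≤ s₁)
    (hs₂ : (n : ℝ) / 2 ≤ s₂) (j k₀ k₁ k₂ : ℕ) :
    sqv n k₁ * sqv n k₂ * sqv n k₀ * gro n ρ ^ (3 * j) ≤ ENNReal.ofReal (2 ^ (3 * (n : ℝ) / 2)) *
      ENNReal.ofReal ((2 : ℝ) ^ (-((j : ℝ) * (-(1 - ρ) * (n : ℝ) / 2)) +
        ((k₀ : ℝ) * s₀ + (k₁ : ℝ) * s₁ + (k₂ : ℝ) * s₂))) := by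
  rw [sqv_eq_ofReal, sqv_eq_ofReal, sqv_eq_ofReal, gro, ← ENNReal.ofReal_pow (by positivity),
    ← ENNReal.ofReal_mul (by positivity), ← ENNReal.ofReal_mul (by positivity),
    ← ENNReal.ofReal_mul (by positivity), ← ENNReal.ofReal_mul (by positivity),
    ← Real.rpow_natCast, ← Real.rpow_mul (by norm_num), ← Real.rpow_add (by norm_num),
    ← Real.rpow_add (by norm_num), ← Real.rpow_add (by norm_num), ← Real.rpow_add (by norm_num)]
  refine ENNReal.ofReal_le_ofReal (Real.rpow_le_rpow_of_exponent_le (by norm_num) ?_)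
  have h0 := mul_le_mul_of_nonneg_left hs₀ (Nat.cast_nonneg (α := ℝ) k₀)
  have h1 := mul_le_mul_of_nonneg_left hs₁ (Nat.cast_nonneg (α := ℝ) k₁)
  have h2 := mul_le_mul_of_nonneg_left hs₂ (Nat.cast_nonneg (α := ℝ) k₂)
  push_cast
  linarith

/-- The form is split over j, dilated, and split over k₀, k₁, k₂. The scale estimate for each k₀
takes β to be a multiple of the k₀-th term of the norm of the class, so these bounds add up to that
norm. -/
theorem exists_enorm_integral_bilinOp_le {φ : 𝓢(Eu n, ℂ)} (hφ : IsLPGenerator φ)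
    {Φ : SchwartzMap (WithLp 2 (Eu n × Eu n)) ℂ} (hΦ : IsLPGenerator Φ) {ρ s₀ s₁ s₂ : ℝ}
    (hn : 0 < n) (hρ₀ : 0 ≤ ρ) (hρ₁ : ρ < 1) (hs₀ : (n : ℝ) / 2 ≤ s₀) (hs₁ : (n : ℝ) / 2 ≤ s₁)
    (hs₂ : (n : ℝ) / 2 ≤ s₂) : ∃ C : ℝ≥0∞, C ≠ ∞ ∧
    ∀ (σ : Eu n × Eu n × Eu n → ℂ) (M : ℝ), Measurable σ → (∀ z, ‖σ z‖ ≤ M) →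
      ∀ f g h : 𝓢(Eu n, ℂ), ‖∫ x, bilinOp σ f g x * h x‖ₑ ≤
        C * bsStarNorm φ Φ ρ (-(1 - ρ) * (n : ℝ) / 2) s₀ s₁ s₂ σ *
          (nrm2 f * bmoNorm g * nrm2 h) := by
  obtain ⟨W⟩ := exists_windows n
  obtain ⟨C₁, hC₁, hloc⟩ := exists_isLocalSymbol_lpBlock W hφ
  obtain ⟨C₂, hC₂, hsum⟩ := exists_scale_sum_le W hφ hn hρ₀ hρ₁
  set E := ENNReal.ofReal (2 ^ (3 * (n : ℝ) / 2)) with hE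
  refine ⟨C₂ * (C₁ * E), by finiteness, fun σ M hσ hM f g h => ?_⟩
  have hσm : Measurable fun z : Eu n × Eu n × Eu n =>
      σ (z.1, (2 * Real.pi) • z.2.1, (2 * Real.pi) • z.2.2) := hσ.comp (by fun_prop)
  set F := fun j => dilS (dil ρ j) (dil_pos ρ j) (lowS φ (2 ^ j) (by positivity) f) with hF
  set G := fun j => dilS (dil ρ j) (dil_pos ρ j) (lowS φ (2 ^ j) (by positivity) g) with hG
  set H := fun j => dilS (dil ρ j) (dil_pos ρ j) h with hH
  set v := fun (k₀ j : ℕ) (k : ℕ × ℕ) (z : Eu n × Eu n × Eu n) =>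
    lpBlock φ k₀ k.1 k.2 (scaledSymbol Φ ρ j σ)
      (z.1, (2 * Real.pi) • z.2.1, (2 * Real.pi) • z.2.2) with hv
  set N := fun (k₀ j : ℕ) (k : ℕ × ℕ) =>
    C₁ * l2ulNorm (lpBlock φ k₀ k.1 k.2 (scaledSymbol Φ ρ j σ)) with hN
  set β := fun k₀ : ℕ => C₁ * E * ⨆ j : ℕ, ∑' k : ℕ × ℕ, ENNReal.ofReal ((2 : ℝ) ^
    (-((j : ℝ) * (-(1 - ρ) * (n : ℝ) / 2)) + ((k₀ : ℝ) * s₀ + (k.1 : ℝ) * s₁ + (k.2 : ℝ) * s₂))) *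
      l2ulNorm (lpBlock φ k₀ k.1 k.2 (scaledSymbol Φ ρ j σ)) with hβ
  have hS : ∀ k₀ j k, IsLocalSymbol W (v k₀ j k) (2 ^ (k₀ + 1)) (2 ^ (k.1 + 1)) (2 ^ (k.2 + 1))
      (N k₀ j k) := fun k₀ j k => by
    obtain ⟨M', hM'⟩ := exists_norm_scaledSymbol_le Φ ρ j hM
    exact hloc _ M' (measurable_scaledSymbol Φ ρ j hσ) hM' k₀ k.1 k.2
  have hNβ : ∀ k₀ j, (∑' k, N k₀ j k * (sqv n k.1 * sqv n k.2)) * sqv n k₀ * gro n ρ ^ (3 * j) ≤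
      β k₀ := fun k₀ j => by
    simp only [hβ]
    refine le_trans ?_ (mul_le_mul_right (le_iSup _ j) _)
    rw [mul_assoc, ← ENNReal.tsum_mul_right, ← ENNReal.tsum_mul_left]
    refine ENNReal.tsum_le_tsum fun k => ?_
    calc _ = C₁ * (sqv n k.1 * sqv n k.2 * sqv n k₀ * gro n ρ ^ (3 * j)) *
          l2ulNorm (lpBlock φ k₀ k.1 k.2 (scaledSymbol Φ ρ j σ)) := by simp only [hN]; ring
      _ ≤ _ := mul_le_mul_left (mul_le_mul_right (weight_le hs₀ hs₁ hs₂ j k₀ k.1 k.2) _) _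
      _ = _ := by ring
  have hterm : ∀ j, ‖lam (fun z => σ (z.1, (2 * Real.pi) • z.2.1, (2 * Real.pi) • z.2.2) *
      freqCut Φ j z) f g h‖ₑ ≤ ∑' k₀ : ℕ, ∑' k : ℕ × ℕ, ‖lam (v k₀ j k) (F j) (G j) (H j)‖ₑ *
        (ENNReal.ofReal (dil ρ j) ^ n)⁻¹ := fun j => by
    obtain ⟨M', hM'⟩ := exists_norm_scaledSymbol_le Φ ρ j hM
    have h1 := enorm_lam_le_tsum_lpBlock hφ (measurable_scaledSymbol Φ ρ j hσ) hM' (F j) (G j) (H j)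
    simp only [hF, hG, hH] at h1
    rw [lam_scaledSymbol, ← lam_freqCut_eq hφ hΦ, enorm_mul] at h1
    have hd : ‖(dil ρ j : ℂ) ^ n‖ₑ = ENNReal.ofReal (dil ρ j) ^ n := by
      rw [enorm_pow, ← ofReal_norm, Complex.norm_real, Real.norm_of_nonneg (dil_pos ρ j).le]
    have hd0 : ENNReal.ofReal (dil ρ j) ^ n ≠ 0 := by
      have := dil_pos ρ j
      positivity
    rw [hd] at h1
    simp_rw [ENNReal.tsum_mul_right]
    rw [← div_eq_mul_inv, ENNReal.le_div_iff_mul_le (Or.inl hd0) (Or.inl (by finiteness)), mul_comm]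
    exact h1
  rw [integral_bilinOp_mul hσ hM]
  calc _ ≤ ∑' j, ∑' k₀ : ℕ, ∑' k : ℕ × ℕ, ‖lam (v k₀ j k) (F j) (G j) (H j)‖ₑ *
        (ENNReal.ofReal (dil ρ j) ^ n)⁻¹ :=
        (enorm_lam_le_tsum_freqCut hΦ hσm (fun z => hM _) f g h).trans (ENNReal.tsum_le_tsum hterm)
    -- The interchange puts k₀ outermost, as in the norm of the class; the sum over j must be
    -- carried out at fixed k₀.
    _ = ∑' k₀ : ℕ, ∑' j, ∑' k : ℕ × ℕ, ‖lam (v k₀ j k) (F j) (G j) (H j)‖ₑ *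
        (ENNReal.ofReal (dil ρ j) ^ n)⁻¹ := ENNReal.tsum_comm
    _ ≤ ∑' k₀, C₂ * β k₀ * (nrm2 f * bmoNorm g * nrm2 h) :=
        ENNReal.tsum_le_tsum fun k₀ => hsum k₀ (v k₀) (N k₀) (β k₀) (hS k₀) (hNβ k₀) f g h
    _ = _ := by
        rw [ENNReal.tsum_mul_right, ENNReal.tsum_mul_left]
        simp only [hβ]
        rw [ENNReal.tsum_mul_left, bsStarNorm]
        ring


/-! ### Duality -/

/-- Schwartz functions are dense in L², so the bound extends to all of L² and may be tested on the
conjugate of u itself. -/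
theorem nrm2_le_of_forall_schwartz_of_memLp {u : Eu n → ℂ} (hu : MemLp u 2 volume) {D : ℝ≥0∞}
    (hD : D ≠ ∞) (h : ∀ k : 𝓢(Eu n, ℂ), ‖∫ x, u x * k x‖ₑ ≤ D * nrm2 k) : nrm2 u ≤ D := by
  set w : Lp ℂ 2 (volume : Measure (Eu n)) := hu.star.toLp _ with hw
  have key : ∀ v : Lp ℂ 2 (volume : Measure (Eu n)), ‖inner ℂ w v‖ ≤ D.toReal * ‖v‖ := by
    intro v
    refine (SchwartzMap.denseRange_toLpCLM (F := ℂ) (E := Eu n) (μ := volume)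
      (ENNReal.ofNat_ne_top : (2 : ℝ≥0∞) ≠ ∞)).induction_on
      (p := fun v => ‖inner ℂ w v‖ ≤ D.toReal * ‖v‖) v ?_ ?_
    · exact isClosed_le (by fun_prop) (by fun_prop)
    · intro k
      have e : inner ℂ w (SchwartzMap.toLpCLM ℝ ℂ 2 volume k) = ∫ x, u x * k x := by
        rw [L2.inner_def]
        refine integral_congr_ae ?_
        filter_upwards [hu.star.coeFn_toLp, k.coeFn_toLp 2 volume] with x h1 h2
        rw [SchwartzMap.toLpCLM_apply, h2, hw, h1]
        simp [mul_comm]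
      have h1 := ENNReal.toReal_mono (by have := nrm2_schwartz_ne_top k; finiteness) (h k)
      rw [e, SchwartzMap.toLpCLM_apply, SchwartzMap.norm_toLp, ← nrm2_eq_eLpNorm]
      rwa [ENNReal.toReal_mul, toReal_enorm] at h1
  have h2 := key w
  rw [inner_self_eq_norm_sq_to_K] at h2
  have h3 : ‖w‖ ≤ D.toReal := by
    rcases (norm_nonneg w).eq_or_lt with h0 | h0
    · rw [← h0]; exact ENNReal.toReal_nonneg
    · refine le_of_mul_le_mul_right ?_ h0
      simpa [sq] using h2
  have h4 : nrm2 u = ‖w‖ₑ := by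
    rw [hw, Lp.enorm_toLp, nrm2_eq_eLpNorm]
    exact eLpNorm_congr_norm_ae (Eventually.of_forall fun x => by simp)
  rw [h4, ← ofReal_norm, ← ENNReal.ofReal_toReal hD]
  exact ENNReal.ofReal_le_ofReal h3

theorem nrm2_mono {u v : Eu n → ℂ} (h : ∀ x, ‖u x‖ₑ ≤ ‖v x‖ₑ) : nrm2 u ≤ nrm2 v := by
  unfold nrm2
  gcongr with x
  exact h x

theorem nrm2_mulS_le {k : 𝓢(Eu n, ℂ)} {c : ℝ} (hc : ∀ x, ‖k x‖ ≤ c) (h : 𝓢(Eu n, ℂ)) :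
    nrm2 (mulS k h) ≤ ENNReal.ofReal c * nrm2 h := by
  have hc0 : 0 ≤ c := (norm_nonneg _).trans (hc 0)
  have e : ENNReal.ofReal c * nrm2 h = nrm2 (fun x => (c : ℂ) * h x) := by
    simp only [nrm2]
    simp_rw [enorm_mul, mul_pow]
    rw [lintegral_const_mul _ (by have := h.continuous.measurable; fun_prop), sqrt_mul_ennreal,
      sq_sqrt_ennreal, ← ofReal_norm, Complex.norm_real, Real.norm_of_nonneg hc0]
  rw [e]
  refine nrm2_mono fun x => ?_
  rw [mulS_apply, enorm_mul, enorm_mul, ← ofReal_norm (c : ℂ), Complex.norm_real,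
    Real.norm_of_nonneg hc0, ← ofReal_norm (k x)]
  gcongr
  exact hc x

/-- T is a priori only bounded, so it is first multiplied by a dilate of φ, which puts it in L². The
cut-off is moved to the test function at the cost of c, and the balls then exhaust the space. -/
theorem nrm2_le_of_forall_schwartz {φ : 𝓢(Eu n, ℂ)} (hφ : IsLPGenerator φ) {c : ℝ}
    (hc : ∀ x, ‖φ x‖ ≤ c) {T : Eu n → ℂ} (hT : Measurable T) {B : ℝ} (hB : ∀ x, ‖T x‖ ≤ B)
    {D : ℝ≥0∞} (hD : D ≠ ∞) (h : ∀ k : 𝓢(Eu n, ℂ), ‖∫ x, T x * k x‖ₑ ≤ D * nrm2 k) :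
    nrm2 T ≤ ENNReal.ofReal c * D := by
  have hR : ∀ R : ℕ, ∫⁻ x in Metric.closedBall (0 : Eu n) R, ‖T x‖ₑ ^ 2 ≤
      (ENNReal.ofReal c * D) ^ 2 := fun R => by
    -- R + 1 instead of R keeps the dilation factor positive when R = 0.
    set χ := dilS ((R : ℝ) + 1) (by positivity) φ with hχ
    have h1 : nrm2 (fun x => T x * χ x) ≤ ENNReal.ofReal c * D := by
      refine nrm2_le_of_forall_schwartz_of_memLp ?_ (by finiteness) fun k => ?_
      · have hχ2 : MemLp (χ : Eu n → ℂ) 2 volume := χ.memLp 2 volume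
        refine hχ2.of_le_mul (c := B) (hT.aestronglyMeasurable.mul hχ2.1)
          (Eventually.of_forall fun x => ?_)
        rw [norm_mul]
        exact mul_le_mul_of_nonneg_right (hB x) (norm_nonneg _)
      · have e : ∀ x, T x * χ x * k x = T x * mulS χ k x := fun x => by rw [mulS_apply]; ring
        simp_rw [e]
        refine (h _).trans ?_
        rw [mul_comm (ENNReal.ofReal c), mul_assoc]
        gcongr
        exact nrm2_mulS_le (fun x => by rw [hχ, dilS_apply]; exact hc _) k
    calc _ ≤ ∫⁻ x in Metric.closedBall (0 : Eu n) R, ‖T x * χ x‖ₑ ^ 2 := by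
          refine setLIntegral_mono' measurableSet_closedBall fun x hx => ?_
          rw [mem_closedBall_zero_iff] at hx
          rw [hχ, dilS_eq_one hφ _ (by linarith), mul_one]
      _ ≤ ∫⁻ x, ‖T x * χ x‖ₑ ^ 2 := setLIntegral_le_lintegral _ _
      _ = nrm2 (fun x => T x * χ x) ^ 2 := (nrm2_sq _).symm
      _ ≤ _ := by gcongr
  have hU : (⋃ R : ℕ, Metric.closedBall (0 : Eu n) R) = Set.univ := Metric.iUnion_closedBall_nat 0
  have h2 : nrm2 T ^ 2 ≤ (ENNReal.ofReal c * D) ^ 2 := by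
    rw [nrm2_sq, ← setLIntegral_univ, ← hU, setLIntegral_iUnion_of_directed]
    · exact iSup_le hR
    · refine directed_of_isDirected_le fun i j hij => Metric.closedBall_subset_closedBall ?_
      exact_mod_cast hij
  exact (ENNReal.pow_le_pow_left_iff two_ne_zero).1 h2

/-! ### Measurable representatives of the symbol -/

theorem exists_norm_bilinOp_le {σ : Eu n × Eu n × Eu n → ℂ} {M : ℝ} (hM : ∀ z, ‖σ z‖ ≤ M)
    (f g : 𝓢(Eu n, ℂ)) : ∃ B, ∀ x, ‖bilinOp σ f g x‖ ≤ B := by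
  have hd : ∀ k : 𝓢(Eu n, ℂ), Integrable fun x => ‖(𝓕 k : 𝓢(Eu n, ℂ)) ((2 * Real.pi)⁻¹ • x)‖ :=
    fun k => ((𝓕 k).integrable.comp_smul (inv_pos.2 two_pi_pos).ne').norm
  refine ⟨‖((2 * Real.pi : ℝ) : ℂ)⁻¹ ^ (2 * n)‖ * ∫ p : Eu n × Eu n,
    M * (‖(𝓕 f : 𝓢(Eu n, ℂ)) ((2 * Real.pi)⁻¹ • p.1)‖ *
      ‖(𝓕 g : 𝓢(Eu n, ℂ)) ((2 * Real.pi)⁻¹ • p.2)‖), fun x => ?_⟩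
  have e := bilinOp_mul_eq σ f g (fun _ => 1) x
  rw [mul_one] at e
  rw [e, norm_mul]
  refine mul_le_mul_of_nonneg_left (norm_integral_le_of_norm_le
    (((hd f).mul_prod (hd g)).const_mul M) (Eventually.of_forall fun p => ?_)) (norm_nonneg _)
  rw [norm_mul, wave]
  refine mul_le_mul (hM _) (le_of_eq ?_) (norm_nonneg _) ((norm_nonneg _).trans (hM 0))
  simp [norm_ee]

theorem measurable_bilinOp {σ : Eu n × Eu n × Eu n → ℂ} (hσ : Measurable σ) (f g : 𝓢(Eu n, ℂ)) :
    Measurable (bilinOp σ f g) := by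
  have e : bilinOp σ f g = fun x => ((2 * Real.pi : ℝ) : ℂ)⁻¹ ^ (2 * n) * ∫ p : Eu n × Eu n,
      σ (x, p) * wave f g (fun _ => 1) (x, (2 * Real.pi)⁻¹ • p.1, (2 * Real.pi)⁻¹ • p.2) := by
    ext x
    rw [← bilinOp_mul_eq, mul_one]
  rw [e]
  have hw : Measurable fun z : Eu n × Eu n × Eu n =>
      wave f g (fun _ => 1) (z.1, (2 * Real.pi)⁻¹ • z.2.1, (2 * Real.pi)⁻¹ • z.2.2) := by
    have h1 := continuous_ee
    have h2 := (𝓕 f).continuous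
    have h3 := (𝓕 g).continuous
    refine Continuous.measurable ?_
    simp only [wave]
    fun_prop
  have h := (hσ.mul hw).stronglyMeasurable.integral_prod_right' (ν := (volume : Measure (Eu n × Eu n)))
  exact h.measurable.const_mul _

theorem bilinOp_congr_ae {σ σ' : Eu n × Eu n × Eu n → ℂ} (h : σ =ᵐ[volume] σ')
    (f g : 𝓢(Eu n, ℂ)) : bilinOp σ f g =ᵐ[volume] bilinOp σ' f g := by
  rw [Measure.volume_eq_prod] at h
  filter_upwards [Measure.ae_ae_of_ae_prod h] with x hx
  rw [bilinOp, bilinOp]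
  congr 1
  refine integral_congr_ae ?_
  filter_upwards [hx] with p hp
  rw [show σ (x, p.1, p.2) = σ' (x, p.1, p.2) from hp]

theorem quasiMeasurePreserving_smul {r : ℝ} (hr : r ≠ 0) :
    Measure.QuasiMeasurePreserving (fun x : Eu n => r • x) volume volume := by
  refine ⟨by fun_prop, ?_⟩
  rw [Measure.map_addHaar_smul _ hr]
  exact Measure.smul_absolutelyContinuous

theorem scaledSymbol_congr_ae (Φ : SchwartzMap (WithLp 2 (Eu n × Eu n)) ℂ) (ρ : ℝ) (j : ℕ)
    {σ σ' : Eu n × Eu n × Eu n → ℂ} (h : σ =ᵐ[volume] σ') :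
    scaledSymbol Φ ρ j σ =ᵐ[volume] scaledSymbol Φ ρ j σ' := by
  have hq : ∀ a b : ℝ, a ≠ 0 → b ≠ 0 → Measure.QuasiMeasurePreserving
      (fun z : Eu n × Eu n × Eu n => (a • z.1, b • z.2.1, b • z.2.2)) volume volume :=
    fun a b ha hb => QuasiMeasurePreserving.prodMap (quasiMeasurePreserving_smul ha)
      (QuasiMeasurePreserving.prodMap (quasiMeasurePreserving_smul hb)
        (quasiMeasurePreserving_smul hb))
  filter_upwards [(hq ((2 : ℝ) ^ (-((j : ℝ) * ρ))) ((2 : ℝ) ^ ((j : ℝ) * ρ)) (by positivity)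
    (by positivity)).ae_eq_comp h] with z hz
  simp only [Function.comp_apply] at hz
  rw [scaledSymbol, scaledSymbol, hz]

/-- A convolution integral does not see null sets, so the blocks agree everywhere and not merely
almost everywhere. -/
theorem lpBlock_congr_ae (φ : 𝓢(Eu n, ℂ)) (k₀ k₁ k₂ : ℕ) {F G : Eu n × Eu n × Eu n → ℂ}
    (h : F =ᵐ[volume] G) : lpBlock φ k₀ k₁ k₂ F = lpBlock φ k₀ k₁ k₂ G := by
  ext z
  refine integral_congr_ae ?_
  filter_upwards [(quasiMeasurePreserving_sub_left_of_right_invariant volume z).ae_eq_comp h]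
    with w hw
  simp only [Function.comp_apply] at hw
  rw [hw]

theorem bsStarNorm_congr_ae (φ : 𝓢(Eu n, ℂ)) (Φ : SchwartzMap (WithLp 2 (Eu n × Eu n)) ℂ)
    (ρ m s₀ s₁ s₂ : ℝ) {σ σ' : Eu n × Eu n × Eu n → ℂ} (h : σ =ᵐ[volume] σ') :
    bsStarNorm φ Φ ρ m s₀ s₁ s₂ σ = bsStarNorm φ Φ ρ m s₀ s₁ s₂ σ' := by
  simp only [bsStarNorm, lpBlock_congr_ae φ _ _ _ (scaledSymbol_congr_ae Φ ρ _ h)]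

/-- A measurable representative is set to zero where it exceeds the essential supremum. The
estimates above need measurability and a bound at every point. -/
theorem exists_measurable_bounded_ae_eq {α : Type*} [MeasurableSpace α] {μ : Measure α}
    {σ : α → ℂ} (hσ : MemLp σ ∞ μ) :
    ∃ (τ : α → ℂ) (M : ℝ), Measurable τ ∧ (∀ z, ‖τ z‖ ≤ M) ∧ σ =ᵐ[μ] τ := by
  set τ := hσ.1.mk σ with hτ
  have hm : Measurable τ := hσ.1.stronglyMeasurable_mk.measurable
  have hfin : eLpNormEssSup σ μ ≠ ∞ := by
    have := hσ.2.ne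
    rwa [eLpNorm_exponent_top] at this
  set M := (eLpNormEssSup σ μ).toReal with hM
  refine ⟨Set.indicator {z | ‖τ z‖ ≤ M} τ, M,
    hm.indicator (measurableSet_le hm.norm measurable_const), fun z => ?_, ?_⟩
  · by_cases hz : z ∈ {z | ‖τ z‖ ≤ M}
    · rw [Set.indicator_of_mem hz]; exact hz
    · rw [Set.indicator_of_notMem hz, norm_zero]; exact ENNReal.toReal_nonneg
  · filter_upwards [hσ.1.ae_eq_mk, enorm_ae_le_eLpNormEssSup σ μ] with z h1 h2
    have h1' : σ z = τ z := h1
    rw [Set.indicator_of_mem, h1']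
    change ‖τ z‖ ≤ M
    rw [← h1']
    have := ENNReal.toReal_mono hfin h2
    rwa [toReal_enorm] at this

/-- Averages of a bounded function are bounded. Finiteness is what the duality argument needs. -/
theorem bmoNorm_schwartz_ne_top (g : 𝓢(Eu n, ℂ)) : bmoNorm g ≠ ∞ := by
  obtain ⟨c, hc⟩ := schwartz_bdd g
  set B := ENNReal.ofReal c with hB
  have hb : ∀ x, ‖g x‖ₑ ≤ B := fun x => by
    rw [← ofReal_norm]; exact ENNReal.ofReal_le_ofReal (hc x)
  have havg : ∀ (x : Eu n) (R : ℝ), 0 < R → ∀ (u : Eu n → ℝ≥0∞) (A : ℝ≥0∞), (∀ y, u y ≤ A) →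
      (volume (cube x R))⁻¹ * ∫⁻ y in cube x R, u y ≤ A := fun x R hR u A hu => by
    rw [ENNReal.inv_mul_le_iff (volume_cube_ne_zero x hR) (volume_cube_ne_top x hR)]
    refine (lintegral_mono hu).trans ?_
    rw [setLIntegral_const, mul_comm]
  refine ne_top_of_le_ne_top (b := (B + (B + B)) + B) (by finiteness) (add_le_add ?_ ?_)
  · refine iSup₂_le fun x R => iSup₂_le fun hR _ => havg x R hR _ _ fun y => ?_
    refine (enorm_sub_cubeMean_le g.integrable x hR (g y)).trans ?_
    refine (havg x R hR _ _ fun z => ?_).trans le_add_self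
    exact (enorm_sub_le).trans (add_le_add (hb z) (hb y))
  · exact iSup₂_le fun x R => iSup₂_le fun hR _ => havg x R hR _ _ hb

/-! ### The zero-dimensional case -/

theorem volume_real_univ_eu_zero : (volume : Measure (Eu 0)).real Set.univ = 1 := by
  have h : cube (0 : Eu 0) 1 = Set.univ := Set.eq_univ_of_forall fun _ i => i.elim0
  rw [measureReal_def, ← h, volume_cube _ zero_le_one]
  simp

theorem enorm_le_bmoNorm_zero (g : Eu 0 → ℂ) : ‖g 0‖ₑ ≤ bmoNorm g := by
  have hv : volume (cube (0 : Eu 0) 1) = 1 := by rw [volume_cube _ zero_le_one]; simp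
  have h := setLIntegral_cube_le g 0 one_pos hv.ge
  have hu : cube (0 : Eu 0) 1 = Set.univ := Set.eq_univ_of_forall fun _ i => i.elim0
  have e : ∀ y : Eu 0, g y = g 0 := fun y => by rw [Subsingleton.elim y 0]
  simp_rw [e] at h
  rwa [setLIntegral_const, hv, mul_one, one_mul] at h

theorem eLpNorm_eu_zero (u : Eu 0 → ℂ) : eLpNorm u 2 volume = ‖u 0‖ₑ := by
  have hv : (volume : Measure (Eu 0)) Set.univ = 1 := by
    have hu : cube (0 : Eu 0) 1 = Set.univ := Set.eq_univ_of_forall fun _ i => i.elim0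
    rw [← hu, volume_cube _ zero_le_one]; simp
  have e : u = fun _ => u 0 := by ext y; rw [Subsingleton.elim y 0]
  rw [e, eLpNorm_const' _ two_ne_zero (by norm_num), hv]
  simp

theorem integral_subsingleton {α : Type*} [MeasurableSpace α] [Subsingleton α] {μ : Measure α}
    (F : α → ℂ) (a : α) : ∫ x, F x ∂μ = μ.real Set.univ • F a := by
  have e : ∀ x, F x = F a := fun x => by rw [Subsingleton.elim x a]
  simp_rw [e]
  rw [integral_const]

theorem fourierHat_eu_zero (f : Eu 0 → ℂ) (ξ : Eu 0) : fourierHat f ξ = f 0 := by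
  rw [fourierHat, integral_subsingleton _ 0, volume_real_univ_eu_zero]
  simp

theorem bilinOp_eu_zero (σ : Eu 0 × Eu 0 × Eu 0 → ℂ) (f g : 𝓢(Eu 0, ℂ)) (x : Eu 0) :
    bilinOp σ f g x = σ 0 * f 0 * g 0 := by
  have h1 : (volume : Measure (Eu 0 × Eu 0)).real Set.univ = 1 := by
    rw [Measure.volume_eq_prod, ← Set.univ_prod_univ, measureReal_prod_prod,
      volume_real_univ_eu_zero, one_mul]
  rw [bilinOp, integral_subsingleton _ 0, h1, Subsingleton.elim x 0]
  simp [fourierHat_eu_zero, Prod.mk_zero_zero]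

end BilinearPsiDO

end

/-! ### The main theorem -/

theorem theorem3p3 (n : ℕ) (ρ s₀ s₁ s₂ : ℝ) (hρ₀ : 0 ≤ ρ) (hρ₁ : ρ < 1)
    (hs₀ : (n : ℝ) / 2 ≤ s₀) (hs₁ : (n : ℝ) / 2 ≤ s₁) (hs₂ : (n : ℝ) / 2 ≤ s₂)
    (φ : SchwartzMap (Eu n) ℂ) (hφ : IsLPGenerator φ)
    (Φ : SchwartzMap (WithLp 2 (Eu n × Eu n)) ℂ) (hΦ : IsLPGenerator Φ)
    (σ : Eu n × Eu n × Eu n → ℂ)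
    (hσ : MemBSStar φ Φ ρ (-(1 - ρ) * (n : ℝ) / 2) s₀ s₁ s₂ σ) :
    ∃ C : ℝ≥0, ∀ f g : SchwartzMap (Eu n) ℂ,
      MemLp (bilinOp σ f g) 2 volume ∧
        eLpNorm (bilinOp σ f g) 2 volume ≤ C * eLpNorm f 2 volume * bmoNorm g := by
  -- In dimension zero `gro` equals 1 and the geometric sums over scales diverge. The space is then
  -- a single point, and T_σ(f,g) is the product of the three values.
  rcases Nat.eq_zero_or_pos n with rfl | hn
  · refine ⟨‖σ 0‖₊, fun f g => ?_⟩
    have e : bilinOp σ f g = fun _ => σ 0 * f 0 * g 0 := funext fun x => bilinOp_eu_zero σ f g x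
    have hfin : eLpNorm (bilinOp σ f g) 2 volume = ‖σ 0‖ₑ * ‖f 0‖ₑ * ‖g 0‖ₑ := by
      rw [eLpNorm_eu_zero, e, enorm_mul, enorm_mul]
    refine ⟨⟨?_, ?_⟩, ?_⟩
    · rw [e]; exact aestronglyMeasurable_const
    · rw [hfin]; finiteness
    · rw [hfin, eLpNorm_eu_zero]
      exact mul_le_mul' le_rfl (enorm_le_bmoNorm_zero g)
  · obtain ⟨τ, M, hτ, hM, hστ⟩ := exists_measurable_bounded_ae_eq hσ.1
    obtain ⟨C, hC, hmain⟩ := exists_enorm_integral_bilinOp_le hφ hΦ hn hρ₀ hρ₁ hs₀ hs₁ hs₂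
    obtain ⟨c, hc⟩ := schwartz_bdd φ
    have hN := hσ.2.ne
    rw [bsStarNorm_congr_ae φ Φ ρ _ s₀ s₁ s₂ hστ] at hN
    set N := bsStarNorm φ Φ ρ (-(1 - ρ) * (n : ℝ) / 2) s₀ s₁ s₂ τ with hN'
    have hK : ENNReal.ofReal c * (C * N) ≠ ∞ := by finiteness
    refine ⟨(ENNReal.ofReal c * (C * N)).toNNReal, fun f g => ?_⟩
    have hae := bilinOp_congr_ae hστ f g
    obtain ⟨B, hB⟩ := exists_norm_bilinOp_le hM f g
    have hf := nrm2_schwartz_ne_top f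
    have hg := bmoNorm_schwartz_ne_top g
    have hD : C * N * (nrm2 f * bmoNorm g) ≠ ∞ := by finiteness
    have hbound : eLpNorm (bilinOp σ f g) 2 volume ≤
        ENNReal.ofReal c * (C * N * (nrm2 f * bmoNorm g)) := by
      rw [eLpNorm_congr_ae hae, ← nrm2_eq_eLpNorm]
      refine nrm2_le_of_forall_schwartz hφ hc (measurable_bilinOp hτ f g) hB hD fun h => ?_
      refine (hmain τ M hτ hM f g h).trans (le_of_eq ?_)
      rw [← hN']
      ring
    refine ⟨⟨(measurable_bilinOp hτ f g).aestronglyMeasurable.congr hae.symm,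
      hbound.trans_lt (by finiteness)⟩, hbound.trans (le_of_eq ?_)⟩
    rw [ENNReal.coe_toNNReal hK, ← nrm2_eq_eLpNorm]
    ring
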